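/- **Setting.** An instance of connected $k$-means consists of a finite vertex set $V=\{0,\dots,n-1\}$, a metric $d:V\times V\to\mathbb R_{\ge 0}$, a graph $G=(V,E)$ and an integer $k$ with $1\le k\le n$. A feasible solution is a partition of $V$ into $k$ clusters $P_1,\dots,P_k$ with centers $c_i\in P_i$ such that every $P_i$ induces a connected subgraph of $G$; its cost is $\sum_{i}\sum_{v\in P_i}d(v,c_i)^2$. In unconstrained $k$-means one chooses $k$ centers $c_1,\dots,c_k\in V$ (repetitions allowed) and pays $\sum_{v\in V}\min_i d(v,c_i)^2$. An algorithm is a $\rho$-approximation if on every instance that has a feasible solution it outputs one whose cost is at most $\rho$ times the cost of every feasible solution. A tree decomposition of $G$ of width $w$ (largest bag size minus one) is *nice* if its tree is rooted at a node with empty bag and every node $t$ with bag $B_t$ is a leaf (no children, $B_t=\emptyset$), introduces a vertex $v$ (one child $s$, $v\notin B_s$, $B_t=B_s\cup\{v\}$), introduces an edge $\{u,v\}\in E$ (one child $s$, $B_t=B_s\ni u,v$), forgets a vertex $v$ (one child $s$, $v\in B_s$, $B_t=B_s\setminus\{v\}$), or is a join node (two children, with the same bag as $t$); every edge is introduced exactly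 once and every vertex is forgotten exactly once. Algorithms are deterministic, uniform real-RAM programs: assignments, conditionals and while-loops over random-access arrays of naturals (with addition and cut-off subtraction) and of reals (with $+,-,\cdot,/$, where $x/0=0$), comparisons, and read-only random access to the input; every elementary operation costs one step. **Theorem.** There is a constant $c$, and for every $K\in\mathbb N$ a constant $C_K$, such that the following holds. Let $A$ be an $\alpha$-approximation algorithm for unconstrained $k$-means that runs in at most $p(n)$ steps on every instance with $n$ points and $1\le k\le n$. Then there is a $(8\alpha+32)$-approximation algorithm $B$ for connected $k$-means on graphs given together with a nice tree decomposition which, for every $K$ and on every input with $n$ vertices, $1\le k\le n$ and a nice tree decomposition of width $w$ with at most $K\,n\max(w,1)$ nodes, halts after at most $$C_K\left(p(n)+n\cdot\big(\max(w,1)\,k\big)^{c\max(w,1)}\right)$$ steps; that is, in time $O\big(p(n)+n(wk)^{O(w)}\big)$. In particular, if $p$ is bounded by a polynomial, then for every $K$ there are a function $f$ and a polynomial $q$ such that $B$ runs on these inputs in at most $f(\max(w,k))\cdot q(n)$ steps, so that $B$ is fixed-parameter tractable in $\max(w,k)$. -/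

import Mathlib

/-! ## Real RAM programs

A program is a finite text over two kinds of memory: arrays of natural numbers and arrays of
real numbers. Arrays are named by numerals fixed in the text and have two indices that are
computed at run time. The input is read-only, offers random access, and consists of
natural-number tables named by the symbols in `S` and of one table of reals (the distances).
Naturals can be added and subtracted (cut off at `0`), reals can be added, subtracted,
multiplied and divided; both can be compared. There are no real constants other than the casts
of naturals and there is no rounding of reals. Every elementary operation costs one step. -/

/-- Read-only input of a program. -/
structure RAMInput (S : Type) where
  nat : S → ℕ → ℕ → ℕ
  dist : ℕ → ℕ → ℝ

/-- Working memory. -/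
structure RAMStore where
  nat : ℕ → ℕ → ℕ → ℕ
  real : ℕ → ℕ → ℕ → ℝ

/-- The working memory at the start of a computation. -/
def RAMStore.zero : RAMStore where
  nat := fun _ _ _ => 0
  real := fun _ _ _ => 0

def RAMStore.setNat (σ : RAMStore) (a i j v : ℕ) : RAMStore where
  nat := fun a' i' j' => if a' = a ∧ i' = i ∧ j' = j then v else σ.nat a' i' j'
  real := σ.real

def RAMStore.setReal (σ : RAMStore) (a i j : ℕ) (v : ℝ) : RAMStore where
  nat := σ.nat
  real := fun a' i' j' => if a' = a ∧ i' = i ∧ j' = j then v else σ.real a' i' j'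

/-- Natural-number expressions. -/
inductive NatExp (S : Type) : Type
  | const (c : ℕ) : NatExp S
  | input (s : S) (i j : NatExp S) : NatExp S
  | read (a : ℕ) (i j : NatExp S) : NatExp S
  | add (e f : NatExp S) : NatExp S
  | sub (e f : NatExp S) : NatExp S

namespace NatExp

def eval {S : Type} (x : RAMInput S) (σ : RAMStore) : NatExp S → ℕ
  | const c => c
  | input s i j => x.nat s (eval x σ i) (eval x σ j)
  | read a i j => σ.nat a (eval x σ i) (eval x σ j)
  | add e f => eval x σ e + eval x σ f
  | sub e f => eval x σ e - eval x σ f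

/-- Number of elementary operations needed to evaluate the expression. -/
def cost {S : Type} : NatExp S → ℕ
  | const _ => 1
  | input _ i j => cost i + cost j + 1
  | read _ i j => cost i + cost j + 1
  | add e f => cost e + cost f + 1
  | sub e f => cost e + cost f + 1

end NatExp

/-- Real expressions. -/
inductive RealExp (S : Type) : Type
  | ofNat (e : NatExp S) : RealExp S
  | dist (i j : NatExp S) : RealExp S
  | read (a : ℕ) (i j : NatExp S) : RealExp S
  | add (e f : RealExp S) : RealExp S
  | sub (e f : RealExp S) : RealExp S
  | mul (e f : RealExp S) : RealExp S
  | div (e f : RealExp S) : RealExp S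

namespace RealExp

noncomputable def eval {S : Type} (x : RAMInput S) (σ : RAMStore) : RealExp S → ℝ
  | ofNat e => (e.eval x σ : ℝ)
  | dist i j => x.dist (i.eval x σ) (j.eval x σ)
  | read a i j => σ.real a (i.eval x σ) (j.eval x σ)
  | add e f => eval x σ e + eval x σ f
  | sub e f => eval x σ e - eval x σ f
  | mul e f => eval x σ e * eval x σ f
  | div e f => eval x σ e / eval x σ f

/-- Number of elementary operations needed to evaluate the expression. -/
def cost {S : Type} : RealExp S → ℕ
  | ofNat e => e.cost + 1
  | dist i j => i.cost + j.cost + 1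
  | read _ i j => i.cost + j.cost + 1
  | add e f => cost e + cost f + 1
  | sub e f => cost e + cost f + 1
  | mul e f => cost e + cost f + 1
  | div e f => cost e + cost f + 1

end RealExp

/-- Tests. -/
inductive TestExp (S : Type) : Type
  | natLe (e f : NatExp S) : TestExp S
  | realLe (e f : RealExp S) : TestExp S
  | not (b : TestExp S) : TestExp S
  | and (b c : TestExp S) : TestExp S

namespace TestExp

def holds {S : Type} (x : RAMInput S) (σ : RAMStore) : TestExp S → Prop
  | natLe e f => e.eval x σ ≤ f.eval x σ
  | realLe e f => e.eval x σ ≤ f.eval x σ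
  | not b => ¬ holds x σ b
  | and b c => holds x σ b ∧ holds x σ c

def cost {S : Type} : TestExp S → ℕ
  | natLe e f => e.cost + f.cost + 1
  | realLe e f => e.cost + f.cost + 1
  | not b => cost b + 1
  | and b c => cost b + cost c + 1

end TestExp

/-- Programs. -/
inductive RAMProgram (S : Type) : Type
  | skip : RAMProgram S
  | setNat (a : ℕ) (i j e : NatExp S) : RAMProgram S
  | setReal (a : ℕ) (i j : NatExp S) (e : RealExp S) : RAMProgram S
  | seq (c d : RAMProgram S) : RAMProgram S
  | ite (b : TestExp S) (c d : RAMProgram S) : RAMProgram S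
  | loop (b : TestExp S) (c : RAMProgram S) : RAMProgram S

/-- `Exec x c σ τ t`: on input `x`, the program `c` started with memory `σ` halts with memory
`τ` after exactly `t` steps. Here `loop b c` repeats `c` while `b` holds. -/
inductive Exec {S : Type} (x : RAMInput S) :
    RAMProgram S → RAMStore → RAMStore → ℕ → Prop
  | skip (σ : RAMStore) : Exec x RAMProgram.skip σ σ 1
  | setNat (σ : RAMStore) (a : ℕ) (i j e : NatExp S) :
      Exec x (RAMProgram.setNat a i j e) σ
        (σ.setNat a (i.eval x σ) (j.eval x σ) (e.eval x σ))
        (i.cost + j.cost + e.cost + 1)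
  | setReal (σ : RAMStore) (a : ℕ) (i j : NatExp S) (e : RealExp S) :
      Exec x (RAMProgram.setReal a i j e) σ
        (σ.setReal a (i.eval x σ) (j.eval x σ) (e.eval x σ))
        (i.cost + j.cost + e.cost + 1)
  | seq {c d : RAMProgram S} {σ τ υ : RAMStore} {s t : ℕ} :
      Exec x c σ τ s → Exec x d τ υ t → Exec x (RAMProgram.seq c d) σ υ (s + t)
  | iteTrue {b : TestExp S} {c d : RAMProgram S} {σ τ : RAMStore} {t : ℕ} :
      b.holds x σ → Exec x c σ τ t → Exec x (RAMProgram.ite b c d) σ τ (b.cost + t + 1)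
  | iteFalse {b : TestExp S} {c d : RAMProgram S} {σ τ : RAMStore} {t : ℕ} :
      ¬ b.holds x σ → Exec x d σ τ t → Exec x (RAMProgram.ite b c d) σ τ (b.cost + t + 1)
  | loopDone {b : TestExp S} {c : RAMProgram S} {σ : RAMStore} :
      ¬ b.holds x σ → Exec x (RAMProgram.loop b c) σ σ (b.cost + 1)
  | loopStep {b : TestExp S} {c : RAMProgram S} {σ τ υ : RAMStore} {s t : ℕ} :
      b.holds x σ → Exec x c σ τ s → Exec x (RAMProgram.loop b c) τ υ t →
      Exec x (RAMProgram.loop b c) σ υ (b.cost + s + t + 1)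

/-- Started on `x` with zero memory, `c` halts after at most `T` steps, with a final memory
that satisfies `Q`. -/
def RunsWithin {S : Type} (c : RAMProgram S) (x : RAMInput S) (T : ℕ)
    (Q : RAMStore → Prop) : Prop :=
  ∃ (τ : RAMStore) (t : ℕ), Exec x c RAMStore.zero τ t ∧ t ≤ T ∧ Q τ

/-! ## Metrics and the unconstrained `k`-means problem -/

/-- `d` is a metric (nonnegativity follows). -/
structure IsMetric {V : Type} (d : V → V → ℝ) : Prop where
  eq_zero_iff : ∀ u v, d u v = 0 ↔ u = v
  symm : ∀ u v, d u v = d v u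
  triangle : ∀ u v w, d u w ≤ d u v + d v w

/-- Cost of a tuple of centers: every point pays the squared distance to a nearest center. -/
noncomputable def kMeansCost {n k : ℕ} (d : Fin n → Fin n → ℝ) (c : Fin k → Fin n) : ℝ :=
  ∑ v, ⨅ i, d v (c i) ^ 2

/-- The distance table, filled up with zeros. -/
noncomputable def distTable {n : ℕ} (d : Fin n → Fin n → ℝ) (i j : ℕ) : ℝ :=
  if h : i < n ∧ j < n then d ⟨i, h.1⟩ ⟨j, h.2⟩ else 0

inductive KMeansSymbol : Type
  | numPoints
  | numClusters

/-- The input of an algorithm for unconstrained `k`-means: `n`, `k` and the distances. -/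
noncomputable def kMeansInput {n : ℕ} (k : ℕ) (d : Fin n → Fin n → ℝ) :
    RAMInput KMeansSymbol where
  nat := fun s _ _ =>
    match s with
    | KMeansSymbol.numPoints => n
    | KMeansSymbol.numClusters => k
  dist := distTable d

/-- `A` is an `α`-approximation algorithm for unconstrained `k`-means with running time `p n`.
The `i`-th center is returned in cell `(i, 0)` of the natural-number array `0`. -/
def ApproximatesKMeans (A : RAMProgram KMeansSymbol) (α : ℝ) (p : ℕ → ℕ) : Prop :=
  ∀ (n k : ℕ) (d : Fin n → Fin n → ℝ), IsMetric d → 1 ≤ k → k ≤ n →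
    RunsWithin A (kMeansInput k d) (p n) fun τ =>
      ∃ c : Fin k → Fin n, (∀ i : Fin k, τ.nat 0 i 0 = c i) ∧
        ∀ c' : Fin k → Fin n, kMeansCost d c ≤ α * kMeansCost d c'

/-! ## Connected `k`-means -/

/-- `part` assigns to every vertex the index of its cluster and `center` gives the centers.
All clusters are nonempty, since they contain their centers. -/
structure IsConnectedClustering {n k : ℕ} (G : SimpleGraph (Fin n))
    (part : Fin n → Fin k) (center : Fin k → Fin n) : Prop where
  connected : ∀ i, (G.induce {v | part v = i}).Connected
  center_mem : ∀ i, part (center i) = i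

def connectedKMeansCost {n k : ℕ} (d : Fin n → Fin n → ℝ)
    (part : Fin n → Fin k) (center : Fin k → Fin n) : ℝ :=
  ∑ i, ∑ v with part v = i, d v (center i) ^ 2

/-! ## Nice tree decompositions -/

structure TreeDecomposition {V : Type} (G : SimpleGraph V) (ι : Type) where
  tree : SimpleGraph ι
  isTree : tree.IsTree
  bag : ι → Finset V
  cover : ∀ v, ∃ t, v ∈ bag t
  edge_mem : ∀ u v, G.Adj u v → ∃ t, u ∈ bag t ∧ v ∈ bag t
  connected : ∀ v, (tree.induce {t | v ∈ bag t}).Connected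

/-- Size of a largest bag minus one. (For a nonempty graph some bag is nonempty.) -/
def TreeDecomposition.width {V ι : Type} [Fintype ι] {G : SimpleGraph V}
    (D : TreeDecomposition G ι) : ℕ :=
  (Finset.univ.sup fun t => (D.bag t).card) - 1

/-- The type of a node, with the vertex or the edge it introduces or forgets. -/
inductive NodeKind (V : Type) : Type
  | leaf : NodeKind V
  | introVertex (v : V) : NodeKind V
  | introEdge (u v : V) : NodeKind V
  | forget (v : V) : NodeKind V
  | join : NodeKind V

/-- The children of `t` when the tree `T` is rooted at `z`. -/
def rootedChildren {ι : Type} (T : SimpleGraph ι) (z t : ι) : Set ι :=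
  {s | T.Adj t s ∧ T.dist z s = T.dist z t + 1}

/-- What being of a given type demands of a node. -/
def NodeKind.Valid {V ι : Type} [DecidableEq V] {G : SimpleGraph V}
    (D : TreeDecomposition G ι) (z t : ι) : NodeKind V → Prop
  | leaf => rootedChildren D.tree z t = ∅ ∧ D.bag t = ∅
  | introVertex v => ∃ s, rootedChildren D.tree z t = {s} ∧
      v ∉ D.bag s ∧ D.bag t = insert v (D.bag s)
  | introEdge u v => G.Adj u v ∧ ∃ s, rootedChildren D.tree z t = {s} ∧
      D.bag t = D.bag s ∧ u ∈ D.bag t ∧ v ∈ D.bag t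
  | forget v => ∃ s, rootedChildren D.tree z t = {s} ∧
      v ∈ D.bag s ∧ D.bag t = (D.bag s).erase v
  | join => ∃ s₁ s₂, s₁ ≠ s₂ ∧ rootedChildren D.tree z t = {s₁, s₂} ∧
      D.bag s₁ = D.bag t ∧ D.bag s₂ = D.bag t

structure NiceTreeDecomposition {V : Type} [DecidableEq V] (G : SimpleGraph V) (ι : Type)
    extends TreeDecomposition G ι where
  root : ι
  root_bag : bag root = ∅
  kind : ι → NodeKind V
  valid : ∀ t, (kind t).Valid toTreeDecomposition root t
  edge_once : ∀ u v, G.Adj u v →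
    ∃! t, kind t = NodeKind.introEdge u v ∨ kind t = NodeKind.introEdge v u
  forget_once : ∀ v, ∃! t, kind t = NodeKind.forget v

/-! ## The input of an algorithm for connected `k`-means -/

inductive ConnSymbol : Type
  | numPoints
  | numClusters
  | adj
  | numNodes
  | root
  | kind
  | label
  | numChildren
  | child
  | bagSize
  | bag

/-- Numerical code of a node type. -/
def NodeKind.code {V : Type} : NodeKind V → ℕ
  | leaf => 0
  | introVertex _ => 1
  | introEdge _ _ => 2
  | forget _ => 3
  | join => 4

/-- The vertices with which a node of the given type is labelled. -/
def NodeKind.labels {V : Type} : NodeKind V → List V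
  | leaf => []
  | introVertex v => [v]
  | introEdge u v => [u, v]
  | forget v => [v]
  | join => []

/-- Row `t` of the table `s` starts with the entries of `l`. -/
def RAMInput.RowLists {S : Type} (x : RAMInput S) (s : S) (t : ℕ) {m : ℕ}
    (l : List (Fin m)) : Prop :=
  ∀ (i : ℕ) (h : i < l.length), x.nat s t i = l[i]

open Classical in
/-- `x` describes the graph `G` (adjacency matrix), the distances `d`, the number `k` and the
nice tree decomposition `D` (root, node types with labels, lists of children, lists of the bags;
the lists of children and the bags may be in any order). -/
structure EncodesConnected {n N : ℕ} (k : ℕ) (G : SimpleGraph (Fin n)) (d : Fin n → Fin n → ℝ)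
    (D : NiceTreeDecomposition G (Fin N)) (x : RAMInput ConnSymbol) : Prop where
  numPoints : ∀ i j, x.nat ConnSymbol.numPoints i j = n
  numClusters : ∀ i j, x.nat ConnSymbol.numClusters i j = k
  numNodes : ∀ i j, x.nat ConnSymbol.numNodes i j = N
  root : ∀ i j, x.nat ConnSymbol.root i j = D.root
  dist : x.dist = distTable d
  adj : ∀ u v : Fin n, x.nat ConnSymbol.adj u v = if G.Adj u v then 1 else 0
  kind : ∀ t : Fin N, x.nat ConnSymbol.kind t 0 = (D.kind t).code
  label : ∀ t : Fin N, x.RowLists ConnSymbol.label t (D.kind t).labels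
  children : ∀ t : Fin N, ∃ l : List (Fin N), l.Nodup ∧
    (∀ s, s ∈ l ↔ s ∈ rootedChildren D.tree D.root t) ∧
    x.nat ConnSymbol.numChildren t 0 = l.length ∧ x.RowLists ConnSymbol.child t l
  bag : ∀ t : Fin N, ∃ l : List (Fin n), l.Nodup ∧ (∀ v, v ∈ l ↔ v ∈ D.bag t) ∧
    x.nat ConnSymbol.bagSize t 0 = l.length ∧ x.RowLists ConnSymbol.bag t l

/-- `B` is a `ρ`-approximation algorithm for connected `k`-means on graphs that are given with
a nice tree decomposition of some width `w` and at most `K * n * max w 1` nodes, and it halts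
within `T n k w` steps. The `i`-th center is returned in cell `(i, 0)` of the natural-number
array `0`, the index of the cluster of the vertex `v` in cell `(v, 0)` of the array `1`. -/
def ApproximatesConnectedKMeans (B : RAMProgram ConnSymbol) (ρ : ℝ) (K : ℕ)
    (T : ℕ → ℕ → ℕ → ℕ) : Prop :=
  ∀ (n k N : ℕ) (G : SimpleGraph (Fin n)) (d : Fin n → Fin n → ℝ)
    (D : NiceTreeDecomposition G (Fin N)) (x : RAMInput ConnSymbol),
    IsMetric d → 1 ≤ k → k ≤ n → N ≤ K * n * max D.width 1 → EncodesConnected k G d D x →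
    RunsWithin B x (T n k D.width) fun τ =>
      (∃ (part : Fin n → Fin k) (center : Fin k → Fin n),
        IsConnectedClustering G part center) →
      ∃ (part : Fin n → Fin k) (center : Fin k → Fin n),
        (∀ i : Fin k, τ.nat 0 i 0 = center i) ∧ (∀ v : Fin n, τ.nat 1 v 0 = part v) ∧
        IsConnectedClustering G part center ∧
        ∀ (part' : Fin n → Fin k) (center' : Fin k → Fin n),
          IsConnectedClustering G part' center' →
          connectedKMeansCost d part center ≤ ρ * connectedKMeansCost d part' center'

/-! The algorithm for unconstrained `k`-means supplies centers `c`. With these fixed, a dynamic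
program solves a simpler problem exactly: partition the vertices into `k` connected clusters, give
each cluster a label that names one of the `c i`, and minimise the sum of the squared distances of
the vertices from the centers named by their labels. Two inequalities link this problem to connected
`k`-means. Take a connected clustering of cost `O` and let `U` be the unconstrained cost of `c`. If
each cluster with center `o` is labelled by the member of `c` nearest to `o`, every vertex `v` of
the cluster is within `2 d(v, o) + d(v, c)` of the named center, where `d(v, c)` is the distance
from the nearest `c i`. As `(2a + b)² ≤ 8a² + 2b²`, the labelled cost is at most `8 O + 2 U`
(`exists_label_cost_le`), and `U ≤ α O`, because the centers of the clustering compete in the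
unconstrained problem. Conversely, if each cluster takes its member nearest to the named center as
its center, distances at most double and the cost grows by a factor of at most `4`
(`IsSolution.exists_clustering`). Altogether the factor is `4 (8 + 2 α) = 8 α + 32`.

A state of a node of the tree decomposition gives every bag vertex a colour and a label and counts
the clusters that are already complete. Equal colours mean connected by edges that have been used so
far. Using an introduced edge is optional, and it is allowed only between equal labels. A vertex
that is alone in its colour class just before it is forgotten is the last one of its cluster and
increases the count; every forgotten vertex is charged its squared distance. Since the root bag is
empty and every vertex is forgotten once, counts and costs add up to the right totals at the root
(`IsOrder.root_eq_sum`, `count_root`).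

Derivations, that is, compatible choices of states, correspond to clusterings. From a clustering one
uses all edges inside clusters (`TreeData.exists_derivation`). From a derivation one lets each
vertex that is not last follow a vertex of its colour that is forgotten higher up; this ends in a
last vertex, so that clusters correspond to last vertices (`part_eq_of_comp_eq`, `exists_last`,
`Clusters.isSolution`). Connectivity is expressed without walks: a part is connected if its members
are related by every equivalence relation that contains the edges inside parts. This form passes
easily through merging of colour classes (`ColorsRefine`).

For the running time, states are coded by `2 * m + 1` digits below `m + k`, where `m` is the largest
bag size, and every node tries all triples of codes for itself and its children. `Runs` bounds the
time by the length of the program text times `M * (X + 1) ^ depth`: loops over nodes or vertices are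
paid by `M`, and all other loops have at most `X` rounds, where `X` is the number of codes. The text
of the dynamic program is fixed, so its length and depth are absolute constants (`time_bound`). -/

/-! ## Executions with bounded loops -/

section Framework

variable {S : Type}

namespace RAMProgram

/-- The arrays of naturals that a program may write. -/
def natArrays : RAMProgram S → List ℕ
  | skip => []
  | setNat a _ _ _ => [a]
  | setReal _ _ _ _ => []
  | seq c d => c.natArrays ++ d.natArrays
  | ite _ c d => c.natArrays ++ d.natArrays
  | loop _ c => c.natArrays

/-- The arrays of reals that a program may write. -/
def realArrays : RAMProgram S → List ℕ
  | skip => []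
  | setNat _ _ _ _ => []
  | setReal a _ _ _ => [a]
  | seq c d => c.realArrays ++ d.realArrays
  | ite _ c d => c.realArrays ++ d.realArrays
  | loop _ c => c.realArrays

/-- Cost of one pass through the text of a program. -/
def size : RAMProgram S → ℕ
  | skip => 1
  | setNat _ i j e => i.cost + j.cost + e.cost + 1
  | setReal _ i j e => i.cost + j.cost + e.cost + 1
  | seq c d => c.size + d.size
  | ite b c d => b.cost + c.size + d.size + 1
  | loop b c => b.cost + c.size + 1

/-- Nesting depth of loops. -/
def depth : RAMProgram S → ℕ
  | skip => 0
  | setNat _ _ _ _ => 0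
  | setReal _ _ _ _ => 0
  | seq c d => max c.depth d.depth
  | ite _ c d => max c.depth d.depth
  | loop _ c => c.depth + 1

/-- Cell `(0, 0)` of an array of naturals. -/
abbrev cell (a : ℕ) : NatExp S := NatExp.read a (NatExp.const 0) (NatExp.const 0)

/-- Execute `body` with cell `(0, 0)` of array `a` running through the numbers below `bound`;
cell `(0, 1)` holds the value of `bound`. -/
def forLoop (a : ℕ) (bound : NatExp S) (body : RAMProgram S) : RAMProgram S :=
  seq (setNat a (NatExp.const 0) (NatExp.const 1) bound)
    (seq (setNat a (NatExp.const 0) (NatExp.const 0) (NatExp.const 0))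
      (loop (TestExp.natLe (NatExp.add (cell a) (NatExp.const 1))
          (NatExp.read a (NatExp.const 0) (NatExp.const 1)))
        (seq body
          (setNat a (NatExp.const 0) (NatExp.const 0) (NatExp.add (cell a) (NatExp.const 1))))))

/-- Clear cell `(0, 0)` of array `f` if the test `b` fails for some value of the counter `a`. -/
def checkAll (a : ℕ) (bound : NatExp S) (b : TestExp S) (f : ℕ) : RAMProgram S :=
  forLoop a bound (ite b skip (setNat f (NatExp.const 0) (NatExp.const 0) (NatExp.const 0)))

end RAMProgram

@[simp] theorem RAMStore.setNat_nat (σ : RAMStore) (a i j v a' i' j' : ℕ) :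
    (σ.setNat a i j v).nat a' i' j' =
      if a' = a ∧ i' = i ∧ j' = j then v else σ.nat a' i' j' := rfl

@[simp] theorem RAMStore.setNat_real (σ : RAMStore) (a i j v : ℕ) :
    (σ.setNat a i j v).real = σ.real := rfl

@[simp] theorem RAMStore.setReal_nat (σ : RAMStore) (a i j : ℕ) (v : ℝ) :
    (σ.setReal a i j v).nat = σ.nat := rfl

@[simp] theorem RAMStore.setReal_real (σ : RAMStore) (a i j : ℕ) (v : ℝ) (a' i' j' : ℕ) :
    (σ.setReal a i j v).real a' i' j' =
      if a' = a ∧ i' = i ∧ j' = j then v else σ.real a' i' j' := rfl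

theorem RAMStore.setNat_nat_of_ne (σ : RAMStore) {a a' : ℕ} (i j v : ℕ) (h : a' ≠ a) :
    (σ.setNat a i j v).nat a' = σ.nat a' := by
  funext i' j'; simp [h]

theorem RAMStore.setReal_real_of_ne (σ : RAMStore) {a a' : ℕ} (i j : ℕ) (v : ℝ) (h : a' ≠ a) :
    (σ.setReal a i j v).real a' = σ.real a' := by
  funext i' j'; simp [h]

/-- The two stores differ only in the arrays of `W` and `R`. -/
def SameOutside (W R : List ℕ) (σ τ : RAMStore) : Prop :=
  (∀ a ∉ W, τ.nat a = σ.nat a) ∧ ∀ a ∉ R, τ.real a = σ.real a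

namespace SameOutside

theorem refl (W R : List ℕ) (σ : RAMStore) : SameOutside W R σ σ :=
  ⟨fun _ _ => rfl, fun _ _ => rfl⟩

theorem trans {W R : List ℕ} {σ τ υ : RAMStore} (h : SameOutside W R σ τ)
    (h' : SameOutside W R τ υ) : SameOutside W R σ υ :=
  ⟨fun a ha => (h'.1 a ha).trans (h.1 a ha), fun a ha => (h'.2 a ha).trans (h.2 a ha)⟩

theorem mono {W R W' R' : List ℕ} {σ τ : RAMStore} (h : SameOutside W R σ τ)
    (hW : W ⊆ W') (hR : R ⊆ R') : SameOutside W' R' σ τ :=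
  ⟨fun a ha => h.1 a fun h => ha (hW h), fun a ha => h.2 a fun h => ha (hR h)⟩

theorem setNat {W R : List ℕ} (σ : RAMStore) {a : ℕ} (i j v : ℕ) (h : a ∈ W) :
    SameOutside W R σ (σ.setNat a i j v) :=
  ⟨fun _ ha => σ.setNat_nat_of_ne _ _ _ fun e => ha (e ▸ h), fun _ _ => rfl⟩

theorem setReal {W R : List ℕ} (σ : RAMStore) {a : ℕ} (i j : ℕ) (v : ℝ) (h : a ∈ R) :
    SameOutside W R σ (σ.setReal a i j v) :=
  ⟨fun _ _ => rfl, fun _ ha => σ.setReal_real_of_ne _ _ _ fun e => ha (e ▸ h)⟩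

end SameOutside

/-- The frame rule: which arrays can change is visible in the program text. Through `Runs.frame` it
carries facts about untouched arrays across subprograms, the side conditions being decidable. -/
theorem Exec.sameOutside {x : RAMInput S} {c : RAMProgram S} {σ τ : RAMStore} {t : ℕ}
    (h : Exec x c σ τ t) : SameOutside c.natArrays c.realArrays σ τ := by
  induction h with
  | skip σ => exact SameOutside.refl _ _ _
  | setNat σ a i j e => exact SameOutside.setNat _ _ _ _ (by simp [RAMProgram.natArrays])
  | setReal σ a i j e => exact SameOutside.setReal _ _ _ _ (by simp [RAMProgram.realArrays])
  | seq _ _ h₁ h₂ =>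
    exact (h₁.mono (List.subset_append_left _ _) (List.subset_append_left _ _)).trans
      (h₂.mono (List.subset_append_right _ _) (List.subset_append_right _ _))
  | iteTrue _ _ h => exact h.mono (List.subset_append_left _ _) (List.subset_append_left _ _)
  | iteFalse _ _ h => exact h.mono (List.subset_append_right _ _) (List.subset_append_right _ _)
  | loopDone _ => exact SameOutside.refl _ _ _
  | loopStep _ _ _ h₁ h₂ => exact SameOutside.trans h₁ h₂

/-- Started with memory `σ`, the program `c` halts with a memory satisfying `Q`, in a time that
is accounted for by one loop level with fewer than `M` rounds and inner loops with at most `X`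
rounds each. -/
def Runs (x : RAMInput S) (X M : ℕ) (c : RAMProgram S) (σ : RAMStore) (Q : RAMStore → Prop) :
    Prop :=
  ∃ (τ : RAMStore) (t : ℕ), Exec x c σ τ t ∧ t ≤ c.size * (M * (X + 1) ^ c.depth) ∧ Q τ

namespace Runs

variable {x : RAMInput S} {X M : ℕ} {c d : RAMProgram S} {σ : RAMStore} {Q : RAMStore → Prop}

theorem weaken {Q' : RAMStore → Prop} (h : Runs x X M c σ Q) (hQ : ∀ τ, Q τ → Q' τ) :
    Runs x X M c σ Q' := by
  obtain ⟨τ, t, h₁, h₂, h₃⟩ := h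
  exact ⟨τ, t, h₁, h₂, hQ τ h₃⟩

/-- Strengthen the postcondition by the information which arrays are left alone. -/
theorem frame {Q' : RAMStore → Prop} (h : Runs x X M c σ Q)
    (hQ : ∀ τ, SameOutside c.natArrays c.realArrays σ τ → Q τ → Q' τ) : Runs x X M c σ Q' := by
  obtain ⟨τ, t, h₁, h₂, h₃⟩ := h
  exact ⟨τ, t, h₁, h₂, hQ τ h₁.sameOutside h₃⟩

theorem one_le_budget (X : ℕ) (hM : 1 ≤ M) (e : ℕ) : 1 ≤ M * (X + 1) ^ e :=
  Nat.mul_pos hM (Nat.pow_pos (Nat.succ_pos X))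

theorem skip (hM : 1 ≤ M) (h : Q σ) : Runs x X M RAMProgram.skip σ Q :=
  ⟨σ, _, Exec.skip σ, Nat.le_mul_of_pos_right _ (one_le_budget X hM _), h⟩

theorem setNat {a : ℕ} {i j e : NatExp S} (hM : 1 ≤ M)
    (h : Q (σ.setNat a (i.eval x σ) (j.eval x σ) (e.eval x σ))) :
    Runs x X M (RAMProgram.setNat a i j e) σ Q :=
  ⟨_, _, Exec.setNat σ a i j e, Nat.le_mul_of_pos_right _ (one_le_budget X hM _), h⟩

theorem setReal {a : ℕ} {i j : NatExp S} {e : RealExp S} (hM : 1 ≤ M)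
    (h : Q (σ.setReal a (i.eval x σ) (j.eval x σ) (e.eval x σ))) :
    Runs x X M (RAMProgram.setReal a i j e) σ Q :=
  ⟨_, _, Exec.setReal σ a i j e, Nat.le_mul_of_pos_right _ (one_le_budget X hM _), h⟩

theorem seq (h : Runs x X M c σ fun τ => Runs x X M d τ Q) :
    Runs x X M (RAMProgram.seq c d) σ Q := by
  obtain ⟨τ, t, h₁, h₂, υ, s, h₃, h₄, h₅⟩ := h
  refine ⟨υ, _, h₁.seq h₃, ?_, h₅⟩
  have e₁ : (X + 1) ^ c.depth ≤ (X + 1) ^ (RAMProgram.seq c d).depth :=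
    Nat.pow_le_pow_right (Nat.succ_pos X) (le_max_left _ _)
  have e₂ : (X + 1) ^ d.depth ≤ (X + 1) ^ (RAMProgram.seq c d).depth :=
    Nat.pow_le_pow_right (Nat.succ_pos X) (le_max_right _ _)
  calc t + s ≤ c.size * (M * (X + 1) ^ c.depth) + d.size * (M * (X + 1) ^ d.depth) :=
        Nat.add_le_add h₂ h₄
    _ ≤ c.size * (M * (X + 1) ^ (RAMProgram.seq c d).depth) +
          d.size * (M * (X + 1) ^ (RAMProgram.seq c d).depth) := by gcongr
    _ = _ := by rw [← Nat.add_mul]; rfl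

theorem ite {b : TestExp S} (hM : 1 ≤ M) (h₁ : b.holds x σ → Runs x X M c σ Q)
    (h₂ : ¬ b.holds x σ → Runs x X M d σ Q) : Runs x X M (RAMProgram.ite b c d) σ Q := by
  have e₁ : (X + 1) ^ c.depth ≤ (X + 1) ^ (RAMProgram.ite b c d).depth :=
    Nat.pow_le_pow_right (Nat.succ_pos X) (le_max_left _ _)
  have e₂ : (X + 1) ^ d.depth ≤ (X + 1) ^ (RAMProgram.ite b c d).depth :=
    Nat.pow_le_pow_right (Nat.succ_pos X) (le_max_right _ _)
  have hB := one_le_budget X hM (RAMProgram.ite b c d).depth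
  set B := M * (X + 1) ^ (RAMProgram.ite b c d).depth with hBdef
  have key : b.cost * B + c.size * B + d.size * B + B = (RAMProgram.ite b c d).size * B := by
    simp only [RAMProgram.size]; ring
  have hb : b.cost ≤ b.cost * B := Nat.le_mul_of_pos_right _ hB
  by_cases hb' : b.holds x σ
  · obtain ⟨τ, t, h₃, h₄, h₅⟩ := h₁ hb'
    refine ⟨τ, _, Exec.iteTrue hb' h₃, ?_, h₅⟩
    have : t ≤ c.size * B := h₄.trans (by rw [hBdef]; gcongr)
    rw [← key]
    have := Nat.zero_le (d.size * B)
    omega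
  · obtain ⟨τ, t, h₃, h₄, h₅⟩ := h₂ hb'
    refine ⟨τ, _, Exec.iteFalse hb' h₃, ?_, h₅⟩
    have : t ≤ d.size * B := h₄.trans (by rw [hBdef]; gcongr)
    rw [← key]
    have := Nat.zero_le (c.size * B)
    omega

/-- A loop with `n` rounds whose bodies have the budget `B`. -/
theorem exec_loop {b : TestExp S} {B : ℕ} (I : ℕ → RAMStore → Prop) (n : ℕ)
    (hb : ∀ j τ, j ≤ n → I j τ → (b.holds x τ ↔ j < n))
    (hs : ∀ j < n, ∀ τ, I j τ → ∃ υ t, Exec x c τ υ t ∧ t ≤ B ∧ I (j + 1) υ)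
    {j : ℕ} (hj : j ≤ n) (h : I j σ) :
    ∃ τ t, Exec x (RAMProgram.loop b c) σ τ t ∧
      t ≤ (n - j) * (b.cost + B + 1) + (b.cost + 1) ∧ I n τ := by
  induction hd : n - j generalizing j σ with
  | zero =>
    obtain rfl : j = n := by omega
    exact ⟨σ, _, Exec.loopDone (fun hh => lt_irrefl _ ((hb j σ hj h).1 hh)), by simp, h⟩
  | succ m ih =>
    have hlt : j < n := by omega
    obtain ⟨υ, t, h₁, h₂, h₃⟩ := hs j hlt σ h
    obtain ⟨τ, s, h₄, h₅, h₆⟩ := ih hlt h₃ (by omega)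
    refine ⟨τ, _, Exec.loopStep ((hb j σ hj h).2 hlt) h₁ h₄, ?_, h₆⟩
    rw [Nat.succ_mul]
    omega

/-- The two loop rules below differ only in how the rounds are paid for. With `M' = M` and `n ≤ X`
they are paid by one more level of depth; with `M' = 1` and `n < M` they are paid by the factor `M`,
which can therefore be spent only once in a nest of loops. The invariant must not depend on the
counter array, hence `hI`. -/
theorem forLoop_aux {a : ℕ} {bound : NatExp S} {M' : ℕ} (I : ℕ → RAMStore → Prop) (n : ℕ)
    (hn : bound.eval x σ = n) (hM : 1 ≤ M) (hM' : 1 ≤ M')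
    (hX : (n + 1) * M' ≤ M * (X + 1)) (ha : a ∉ c.natArrays)
    (h0 : I 0 σ)
    (hI : ∀ j τ τ', (∀ a' ≠ a, τ'.nat a' = τ.nat a') → τ'.real = τ.real → I j τ → I j τ')
    (hs : ∀ j < n, ∀ τ, SameOutside (a :: c.natArrays) c.realArrays σ τ → τ.nat a 0 0 = j →
      I j τ → Runs x X M' c τ (I (j + 1)))
    (hq : ∀ τ, SameOutside (a :: c.natArrays) c.realArrays σ τ → I n τ → Q τ) :
    Runs x X M (RAMProgram.forLoop a bound c) σ Q := by
  refine Runs.seq (Runs.setNat hM (Runs.seq (Runs.setNat hM ?_)))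
  set σ' := ((σ.setNat a ((NatExp.const 0 : NatExp S).eval x σ)
    ((NatExp.const 1 : NatExp S).eval x σ) (bound.eval x σ)).setNat a _ _ _) with hσ'
  set step : RAMProgram S := RAMProgram.seq c
    (RAMProgram.setNat a (NatExp.const 0) (NatExp.const 0)
      (NatExp.add (RAMProgram.cell a) (NatExp.const 1))) with hstep
  set b : TestExp S := TestExp.natLe (NatExp.add (RAMProgram.cell a) (NatExp.const 1))
          (NatExp.read a (NatExp.const 0) (NatExp.const 1)) with hb
  let J : ℕ → RAMStore → Prop := fun j τ =>
    SameOutside (a :: c.natArrays) c.realArrays σ τ ∧ τ.nat a 0 0 = j ∧ τ.nat a 0 1 = n ∧ I j τ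
  have hJ0 : J 0 σ' := by
    refine ⟨?_, by simp [hσ', NatExp.eval], by simp [hσ', NatExp.eval, hn], ?_⟩
    · exact (SameOutside.setNat _ _ _ _ (by simp)).trans (SameOutside.setNat _ _ _ _ (by simp))
    · refine hI 0 σ σ' (fun a' ha' => ?_) rfl h0
      rw [hσ', RAMStore.setNat_nat_of_ne _ _ _ _ ha', RAMStore.setNat_nat_of_ne _ _ _ _ ha']
  obtain ⟨τ, t, h₁, h₂, h₃⟩ := exec_loop (x := x) (c := step) (b := b) (B := step.size * (M' * (X + 1) ^ step.depth)) J n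
    (by
      rintro j τ hj ⟨-, e₁, e₂, -⟩
      simp only [hb, TestExp.holds, NatExp.eval, e₁, e₂]
      omega)
    (by
      rintro j hj τ ⟨hf, e₁, e₂, hIj⟩
      have hr : Runs x X M' step τ (J (j + 1)) := by
        refine Runs.seq ((hs j hj τ hf e₁ hIj).frame fun υ hυ hI' => Runs.setNat hM' ?_)
        have e₃ : υ.nat a = τ.nat a := hυ.1 a ha
        refine ⟨?_, by simp [NatExp.eval, e₃, e₁], by simp [NatExp.eval, e₃, e₂], ?_⟩
        · exact (hf.trans (hυ.mono (List.subset_cons_self _ _) (List.Subset.refl _))).trans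
            (SameOutside.setNat _ _ _ _ (by simp))
        · exact hI _ _ _ (fun a' ha' => RAMStore.setNat_nat_of_ne _ _ _ _ ha') rfl hI'
      exact hr)
    (Nat.zero_le n) hJ0
  refine ⟨τ, t, h₁, h₂.trans ?_, hq τ h₃.1 h₃.2.2.2⟩
  have hB : 1 ≤ M' * (X + 1) ^ step.depth := one_le_budget X hM' _
  simp only [RAMProgram.size, RAMProgram.depth, Nat.sub_zero]
  change n * (b.cost + step.size * (M' * (X + 1) ^ step.depth) + 1) + (b.cost + 1) ≤
    (b.cost + step.size + 1) * (M * (X + 1) ^ (step.depth + 1))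
  set P := (X + 1) ^ step.depth with hP
  have e₁ : b.cost + 1 ≤ (b.cost + 1) * (M' * P) := Nat.le_mul_of_pos_right _ hB
  calc n * (b.cost + step.size * (M' * P) + 1) + (b.cost + 1)
      = n * ((b.cost + 1) + step.size * (M' * P)) + (b.cost + 1) := by ring
    _ ≤ n * ((b.cost + 1) * (M' * P) + step.size * (M' * P)) + (b.cost + 1) * (M' * P) := by
        gcongr
    -- The factor `n + 1` instead of `n` pays for the test that ends the loop.
    _ ≤ (b.cost + step.size + 1) * (((n + 1) * M') * P) := by
        have := Nat.zero_le (step.size * (M' * P))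
        nlinarith
    _ ≤ (b.cost + step.size + 1) * ((M * (X + 1)) * P) := by gcongr
    _ = _ := by rw [pow_succ]; ring

/-- A loop with at most `X` rounds. -/
theorem forLoop {a : ℕ} {bound : NatExp S} (I : ℕ → RAMStore → Prop) (n : ℕ)
    (hn : bound.eval x σ = n) (hM : 1 ≤ M) (hX : n ≤ X) (ha : a ∉ c.natArrays)
    (h0 : I 0 σ)
    (hI : ∀ j τ τ', (∀ a' ≠ a, τ'.nat a' = τ.nat a') → τ'.real = τ.real → I j τ → I j τ')
    (hs : ∀ j < n, ∀ τ, SameOutside (a :: c.natArrays) c.realArrays σ τ → τ.nat a 0 0 = j →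
      I j τ → Runs x X M c τ (I (j + 1)))
    (hq : ∀ τ, SameOutside (a :: c.natArrays) c.realArrays σ τ → I n τ → Q τ) :
    Runs x X M (RAMProgram.forLoop a bound c) σ Q :=
  forLoop_aux I n hn hM hM (by rw [Nat.mul_comm]; gcongr) ha h0 hI hs hq

/-- A loop with fewer than `M` rounds. -/
theorem forLoop_large {a : ℕ} {bound : NatExp S} (I : ℕ → RAMStore → Prop) (n : ℕ)
    (hn : bound.eval x σ = n) (hX : n < M) (ha : a ∉ c.natArrays)
    (h0 : I 0 σ)
    (hI : ∀ j τ τ', (∀ a' ≠ a, τ'.nat a' = τ.nat a') → τ'.real = τ.real → I j τ → I j τ')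
    (hs : ∀ j < n, ∀ τ, SameOutside (a :: c.natArrays) c.realArrays σ τ → τ.nat a 0 0 = j →
      I j τ → Runs x X 1 c τ (I (j + 1)))
    (hq : ∀ τ, SameOutside (a :: c.natArrays) c.realArrays σ τ → I n τ → Q τ) :
    Runs x X M (RAMProgram.forLoop a bound c) σ Q :=
  forLoop_aux I n hn (by omega) le_rfl (by nlinarith) ha h0 hI hs hq

open Classical in
-- Cell `(0, 0)` of `f` is a flag that is only ever cleared, so successive checks form a
-- conjunction.
theorem checkAll {a f : ℕ} {bound : NatExp S} {b : TestExp S} (P : ℕ → Prop) (n : ℕ)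
    (hn : bound.eval x σ = n) (hM : 1 ≤ M) (hX : n ≤ X) (haf : a ≠ f)
    (hb : ∀ j < n, ∀ τ, SameOutside [a, f] [] σ τ → τ.nat a 0 0 = j → (b.holds x τ ↔ P j))
    (hq : ∀ τ, SameOutside [a, f] [] σ τ →
      τ.nat f 0 0 = (if ∀ j < n, P j then σ.nat f 0 0 else 0) → Q τ) :
    Runs x X M (RAMProgram.checkAll a bound b f) σ Q := by
  have hW : ∀ {τ : RAMStore}, SameOutside (a :: (RAMProgram.ite b RAMProgram.skip
      (RAMProgram.setNat f (NatExp.const 0) (NatExp.const 0) (NatExp.const 0))).natArrays)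
      (RAMProgram.ite b RAMProgram.skip
      (RAMProgram.setNat f (NatExp.const 0) (NatExp.const 0) (NatExp.const 0))).realArrays σ τ →
      SameOutside [a, f] [] σ τ := fun h => h.mono (by simp [RAMProgram.natArrays])
        (by simp [RAMProgram.realArrays])
  refine Runs.forLoop (fun j τ => τ.nat f 0 0 = if ∀ i < j, P i then σ.nat f 0 0 else 0) n hn hM hX
    (by simp [RAMProgram.natArrays, haf]) (by simp) ?_ ?_ ?_
  · intro j τ τ' h _ e
    simp only [h f haf.symm, e]
  · intro j hj τ hf e₁ e₂
    have hbj := hb j hj τ (hW hf) e₁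
    have hsplit : (∀ i < j + 1, P i) ↔ (∀ i < j, P i) ∧ P j := by
      constructor
      · exact fun h => ⟨fun i hi => h i (by omega), h j (by omega)⟩
      · rintro ⟨h, h'⟩ i hi
        rcases Nat.lt_succ_iff_lt_or_eq.1 hi with h₁ | rfl
        · exact h i h₁
        · exact h'
    refine Runs.ite hM (fun h => Runs.skip hM ?_) (fun h => Runs.setNat hM ?_)
    · simp only [hsplit, hbj.1 h, and_true, e₂]
    · have : ¬ P j := fun h' => h (hbj.2 h')
      rw [if_neg fun h' => this (hsplit.1 h').2]
      simp [NatExp.eval]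
  · exact fun τ hf e => hq τ (hW hf) e

end Runs

end Framework

/-! ## Running a program inside another one -/

section Translation

variable {S S' : Type}

/-- Rename the input symbols along `f` and shift the arrays by `o`. -/
def NatExp.shift (f : S → S') (o : ℕ) : NatExp S → NatExp S'
  | const c => const c
  | input s i j => input (f s) (i.shift f o) (j.shift f o)
  | read a i j => read (a + o) (i.shift f o) (j.shift f o)
  | add e g => add (e.shift f o) (g.shift f o)
  | sub e g => sub (e.shift f o) (g.shift f o)

def RealExp.shift (f : S → S') (o : ℕ) : RealExp S → RealExp S'
  | ofNat e => ofNat (e.shift f o)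
  | dist i j => dist (i.shift f o) (j.shift f o)
  | read a i j => read (a + o) (i.shift f o) (j.shift f o)
  | add e g => add (e.shift f o) (g.shift f o)
  | sub e g => sub (e.shift f o) (g.shift f o)
  | mul e g => mul (e.shift f o) (g.shift f o)
  | div e g => div (e.shift f o) (g.shift f o)

def TestExp.shift (f : S → S') (o : ℕ) : TestExp S → TestExp S'
  | natLe e g => natLe (e.shift f o) (g.shift f o)
  | realLe e g => realLe (e.shift f o) (g.shift f o)
  | not b => not (b.shift f o)
  | and b c => and (b.shift f o) (c.shift f o)

def RAMProgram.shift (f : S → S') (o : ℕ) : RAMProgram S → RAMProgram S'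
  | skip => skip
  | setNat a i j e => setNat (a + o) (i.shift f o) (j.shift f o) (e.shift f o)
  | setReal a i j e => setReal (a + o) (i.shift f o) (j.shift f o) (e.shift f o)
  | seq c d => seq (c.shift f o) (d.shift f o)
  | ite b c d => ite (b.shift f o) (c.shift f o) (d.shift f o)
  | loop b c => loop (b.shift f o) (c.shift f o)

/-- `σ'` holds a copy of `σ` in the arrays from `o` on, and zeros in the arrays below `o`. -/
structure ShiftedStore (o : ℕ) (σ σ' : RAMStore) : Prop where
  nat : ∀ a, σ'.nat (a + o) = σ.nat a
  real : ∀ a, σ'.real (a + o) = σ.real a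
  nat_zero : ∀ a < o, ∀ i j, σ'.nat a i j = 0
  real_zero : ∀ a < o, ∀ i j, σ'.real a i j = 0

variable {f : S → S'} {o : ℕ} {x : RAMInput S} {x' : RAMInput S'}

theorem NatExp.eval_shift (hx : ∀ s, x'.nat (f s) = x.nat s) {σ σ' : RAMStore}
    (h : ShiftedStore o σ σ') (e : NatExp S) : (e.shift f o).eval x' σ' = e.eval x σ := by
  induction e with
  | const c => rfl
  | input s i j hi hj => simp [shift, eval, hi, hj, hx]
  | read a i j hi hj => simp [shift, eval, hi, hj, h.nat]
  | add e g he hg => simp [shift, eval, he, hg]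
  | sub e g he hg => simp [shift, eval, he, hg]

theorem NatExp.cost_shift (e : NatExp S) : (e.shift f o).cost = e.cost := by
  induction e <;> simp_all [shift, cost]

theorem RealExp.eval_shift (hx : ∀ s, x'.nat (f s) = x.nat s) (hd : x'.dist = x.dist)
    {σ σ' : RAMStore} (h : ShiftedStore o σ σ') (e : RealExp S) :
    (e.shift f o).eval x' σ' = e.eval x σ := by
  induction e with
  | ofNat e => simp [shift, eval, NatExp.eval_shift hx h]
  | dist i j => simp [shift, eval, NatExp.eval_shift hx h, hd]
  | read a i j => simp [shift, eval, NatExp.eval_shift hx h, h.real]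
  | add e g he hg => simp [shift, eval, he, hg]
  | sub e g he hg => simp [shift, eval, he, hg]
  | mul e g he hg => simp [shift, eval, he, hg]
  | div e g he hg => simp [shift, eval, he, hg]

theorem RealExp.cost_shift (e : RealExp S) : (e.shift f o).cost = e.cost := by
  induction e <;> simp_all [shift, cost, NatExp.cost_shift]

theorem TestExp.holds_shift (hx : ∀ s, x'.nat (f s) = x.nat s) (hd : x'.dist = x.dist)
    {σ σ' : RAMStore} (h : ShiftedStore o σ σ') (b : TestExp S) :
    (b.shift f o).holds x' σ' ↔ b.holds x σ := by
  induction b with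
  | natLe e g => simp [shift, holds, NatExp.eval_shift hx h]
  | realLe e g => simp [shift, holds, RealExp.eval_shift hx hd h]
  | not b hb => simp [shift, holds, hb]
  | and b c hb hc => simp [shift, holds, hb, hc]

theorem TestExp.cost_shift (b : TestExp S) : (b.shift f o).cost = b.cost := by
  induction b <;> simp_all [shift, cost, NatExp.cost_shift, RealExp.cost_shift]

theorem ShiftedStore.setNat {σ σ' : RAMStore} (h : ShiftedStore o σ σ') (a i j v : ℕ) :
    ShiftedStore o (σ.setNat a i j v) (σ'.setNat (a + o) i j v) where
  nat b := by funext i' j'; simp [h.nat]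
  real b := h.real b
  nat_zero b hb i' j' := by
    rw [RAMStore.setNat_nat_of_ne _ _ _ _ (by omega)]; exact h.nat_zero b hb i' j'
  real_zero := h.real_zero

theorem ShiftedStore.setReal {σ σ' : RAMStore} (h : ShiftedStore o σ σ') (a i j : ℕ) (v : ℝ) :
    ShiftedStore o (σ.setReal a i j v) (σ'.setReal (a + o) i j v) where
  nat b := h.nat b
  real b := by funext i' j'; simp [h.real]
  nat_zero := h.nat_zero
  real_zero b hb i' j' := by
    rw [RAMStore.setReal_real_of_ne _ _ _ _ (by omega)]; exact h.real_zero b hb i' j'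

theorem ShiftedStore.zero : ShiftedStore o RAMStore.zero RAMStore.zero :=
  ⟨fun _ => rfl, fun _ => rfl, fun _ _ _ _ => rfl, fun _ _ _ _ => rfl⟩

/-- The translation commutes with evaluation and preserves costs, so the shifted program makes the
same steps in the same time. It writes only arrays from `o` on; the arrays below stay zero and are
the clean memory in which the dynamic program starts. -/
theorem Exec.shift (hx : ∀ s, x'.nat (f s) = x.nat s) (hd : x'.dist = x.dist)
    {c : RAMProgram S} {σ τ : RAMStore} {t : ℕ} (h : Exec x c σ τ t) {σ' : RAMStore}
    (hσ : ShiftedStore o σ σ') :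
    ∃ τ', Exec x' (c.shift f o) σ' τ' t ∧ ShiftedStore o τ τ' := by
  induction h generalizing σ' with
  | skip σ => exact ⟨σ', Exec.skip σ', hσ⟩
  | setNat σ a i j e =>
    have := Exec.setNat (x := x') σ' (a + o) (i.shift f o) (j.shift f o) (e.shift f o)
    rw [NatExp.eval_shift hx hσ, NatExp.eval_shift hx hσ, NatExp.eval_shift hx hσ,
      NatExp.cost_shift, NatExp.cost_shift, NatExp.cost_shift] at this
    exact ⟨_, this, hσ.setNat _ _ _ _⟩
  | setReal σ a i j e =>
    have := Exec.setReal (x := x') σ' (a + o) (i.shift f o) (j.shift f o) (e.shift f o)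
    rw [NatExp.eval_shift hx hσ, NatExp.eval_shift hx hσ, RealExp.eval_shift hx hd hσ,
      NatExp.cost_shift, NatExp.cost_shift, RealExp.cost_shift] at this
    exact ⟨_, this, hσ.setReal _ _ _ _⟩
  | seq _ _ h₁ h₂ =>
    obtain ⟨τ', e₁, hτ⟩ := h₁ hσ
    obtain ⟨υ', e₂, hυ⟩ := h₂ hτ
    exact ⟨υ', e₁.seq e₂, hυ⟩
  | iteTrue hb _ h =>
    obtain ⟨τ', e, hτ⟩ := h hσ
    refine ⟨τ', ?_, hτ⟩
    rw [← TestExp.cost_shift (f := f) (o := o)]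
    exact Exec.iteTrue ((TestExp.holds_shift hx hd hσ _).2 hb) e
  | iteFalse hb _ h =>
    obtain ⟨τ', e, hτ⟩ := h hσ
    refine ⟨τ', ?_, hτ⟩
    rw [← TestExp.cost_shift (f := f) (o := o)]
    exact Exec.iteFalse (fun h' => hb ((TestExp.holds_shift hx hd hσ _).1 h')) e
  | loopDone hb =>
    refine ⟨σ', ?_, hσ⟩
    rw [← TestExp.cost_shift (f := f) (o := o)]
    exact Exec.loopDone (fun h' => hb ((TestExp.holds_shift hx hd hσ _).1 h'))
  | loopStep hb _ _ h₁ h₂ =>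
    obtain ⟨τ', e₁, hτ⟩ := h₁ hσ
    obtain ⟨υ', e₂, hυ⟩ := h₂ hτ
    refine ⟨υ', ?_, hυ⟩
    rw [← TestExp.cost_shift (f := f) (o := o)]
    exact Exec.loopStep ((TestExp.holds_shift hx hd hσ _).2 hb) e₁ e₂

end Translation

/-! ## Nice trees given by tables -/

/-- Tables describing a rooted tree on the nodes below `num`. A missing child is represented by
the node `num`. -/
structure TreeData where
  num : ℕ
  root : ℕ
  kind : ℕ → ℕ
  lab : ℕ → ℕ → ℕ
  fst : ℕ → ℕ
  snd : ℕ → ℕ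
  size : ℕ → ℕ
  bag : ℕ → ℕ → ℕ

namespace TreeData

def Mem (D : TreeData) (u t : ℕ) : Prop := ∃ i < D.size t, D.bag t i = u

/-- The tables describe a nice tree decomposition of a graph on the vertices below `n`. -/
structure IsNice (D : TreeData) (n : ℕ) (Adj : ℕ → ℕ → Prop) : Prop where
  size_num : D.size D.num = 0
  bag_lt : ∀ t i, i < D.size t → D.bag t i < n
  bag_inj : ∀ t i j, i < D.size t → j < D.size t → D.bag t i = D.bag t j → i = j
  kind_cases : ∀ t < D.num, D.kind t = 0 ∨ D.kind t = 1 ∨ D.kind t = 2 ∨ D.kind t = 3 ∨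
    D.kind t = 4
  leaf : ∀ t < D.num, D.kind t = 0 → D.fst t = D.num ∧ D.snd t = D.num ∧ D.size t = 0
  introVertex : ∀ t < D.num, D.kind t = 1 → D.fst t < D.num ∧ D.snd t = D.num ∧
    ¬ D.Mem (D.lab t 0) (D.fst t) ∧ ∀ u, D.Mem u t ↔ u = D.lab t 0 ∨ D.Mem u (D.fst t)
  introEdge : ∀ t < D.num, D.kind t = 2 → D.fst t < D.num ∧ D.snd t = D.num ∧
    Adj (D.lab t 0) (D.lab t 1) ∧ D.Mem (D.lab t 0) t ∧ D.Mem (D.lab t 1) t ∧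
    ∀ u, D.Mem u t ↔ D.Mem u (D.fst t)
  forget : ∀ t < D.num, D.kind t = 3 → D.fst t < D.num ∧ D.snd t = D.num ∧
    D.Mem (D.lab t 0) (D.fst t) ∧ ∀ u, D.Mem u t ↔ u ≠ D.lab t 0 ∧ D.Mem u (D.fst t)
  join : ∀ t < D.num, D.kind t = 4 → D.fst t < D.num ∧ D.snd t < D.num ∧
    ∀ u, (D.Mem u t ↔ D.Mem u (D.fst t)) ∧ (D.Mem u t ↔ D.Mem u (D.snd t))
  root_lt : D.root < D.num
  root_size : D.size D.root = 0
  forget_exists : ∀ v < n, ∃ t < D.num, D.kind t = 3 ∧ D.lab t 0 = v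
  forget_unique : ∀ s < D.num, ∀ t < D.num, D.kind s = 3 → D.kind t = 3 →
    D.lab s 0 = D.lab t 0 → s = t
  edge : ∀ u v, Adj u v → ∃ t < D.num, D.kind t = 2 ∧
    (D.lab t 0 = u ∧ D.lab t 1 = v ∨ D.lab t 0 = v ∧ D.lab t 1 = u)

/-- `ord` lists the nodes, parents before their children. -/
structure IsOrder (D : TreeData) (ord : ℕ → ℕ) : Prop where
  lt : ∀ i < D.num, ord i < D.num
  inj : ∀ i < D.num, ∀ j < D.num, ord i = ord j → i = j
  zero : ord 0 = D.root
  fst_later : ∀ i < D.num, D.fst (ord i) < D.num →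
    ∃ j, i < j ∧ j < D.num ∧ ord j = D.fst (ord i)
  snd_later : ∀ i < D.num, D.snd (ord i) < D.num →
    ∃ j, i < j ∧ j < D.num ∧ ord j = D.snd (ord i)
  earlier : ∀ j < D.num, 0 < j → ∃ i < j, D.fst (ord i) = ord j ∨ D.snd (ord i) = ord j
  sum_children : ∀ g : ℕ → ℝ, g D.num = 0 →
    g D.root + ∑ i ∈ Finset.range D.num, (g (D.fst (ord i)) + g (D.snd (ord i))) =
      ∑ i ∈ Finset.range D.num, g (ord i)

variable {D : TreeData} {n : ℕ} {Adj : ℕ → ℕ → Prop}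

theorem not_mem_of_size_eq_zero {u t : ℕ} (h : D.size t = 0) : ¬ D.Mem u t := by
  rintro ⟨i, hi, -⟩; omega

namespace IsNice

theorem lt_of_mem (h : D.IsNice n Adj) {u t : ℕ} (hu : D.Mem u t) : u < n := by
  obtain ⟨i, hi, rfl⟩ := hu
  exact h.bag_lt t i hi

theorem not_mem_num (h : D.IsNice n Adj) (u : ℕ) : ¬ D.Mem u D.num :=
  not_mem_of_size_eq_zero h.size_num

theorem fst_le (h : D.IsNice n Adj) {t : ℕ} (ht : t < D.num) : D.fst t ≤ D.num := by
  rcases h.kind_cases t ht with e | e | e | e | e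
  · exact (h.leaf t ht e).1.le
  · exact (h.introVertex t ht e).1.le
  · exact (h.introEdge t ht e).1.le
  · exact (h.forget t ht e).1.le
  · exact (h.join t ht e).1.le

theorem snd_le (h : D.IsNice n Adj) {t : ℕ} (ht : t < D.num) : D.snd t ≤ D.num := by
  rcases h.kind_cases t ht with e | e | e | e | e
  · exact (h.leaf t ht e).2.1.le
  · exact (h.introVertex t ht e).2.1.le
  · exact (h.introEdge t ht e).2.1.le
  · exact (h.forget t ht e).2.1.le
  · exact (h.join t ht e).2.1.le

theorem snd_eq_num (h : D.IsNice n Adj) {t : ℕ} (ht : t < D.num) (h4 : D.kind t ≠ 4) :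
    D.snd t = D.num := by
  rcases h.kind_cases t ht with e | e | e | e | e
  · exact (h.leaf t ht e).2.1
  · exact (h.introVertex t ht e).2.1
  · exact (h.introEdge t ht e).2.1
  · exact (h.forget t ht e).2.1
  · exact absurd e h4

/-- Except at joins the second child is the sentinel `num`, whose bag is empty. -/
theorem mem_of_mem_snd (h : D.IsNice n Adj) {t u : ℕ} (ht : t < D.num) (hu : D.Mem u (D.snd t)) :
    D.kind t = 4 ∧ D.Mem u t ∧ D.Mem u (D.fst t) := by
  by_cases h4 : D.kind t = 4
  · have := (h.join t ht h4).2.2 u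
    tauto
  · rw [h.snd_eq_num ht h4] at hu
    exact absurd hu (h.not_mem_num u)

/-- A vertex of the bag of a child is forgotten or belongs to the bag of the parent. -/
theorem mem_or_forgotten (h : D.IsNice n Adj) {t u : ℕ} (ht : t < D.num)
    (hu : D.Mem u (D.fst t)) : D.Mem u t ∨ D.kind t = 3 ∧ D.lab t 0 = u := by
  rcases h.kind_cases t ht with e | e | e | e | e
  · rw [(h.leaf t ht e).1] at hu
    exact absurd hu (h.not_mem_num u)
  · exact Or.inl (((h.introVertex t ht e).2.2.2 u).2 (Or.inr hu))
  · exact Or.inl (((h.introEdge t ht e).2.2.2.2.2 u).2 hu)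
  · by_cases hv : u = D.lab t 0
    · exact Or.inr ⟨e, hv.symm⟩
    · exact Or.inl (((h.forget t ht e).2.2.2 u).2 ⟨hv, hu⟩)
  · exact Or.inl (((h.join t ht e).2.2 u).1.2 hu)

end IsNice

namespace IsOrder

variable {ord : ℕ → ℕ}

theorem exists_eq (ho : D.IsOrder ord) {t : ℕ} (ht : t < D.num) : ∃ i < D.num, ord i = t := by
  have hinj : Set.InjOn ord (Finset.range D.num : Set ℕ) := fun i hi j hj e =>
    ho.inj i (by simpa using hi) j (by simpa using hj) e
  have him : (Finset.range D.num).image ord = Finset.range D.num := by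
    apply Finset.eq_of_subset_of_card_le
    · intro s hs
      obtain ⟨i, hi, rfl⟩ := Finset.mem_image.1 hs
      exact Finset.mem_range.2 (ho.lt i (Finset.mem_range.1 hi))
    · rw [Finset.card_image_of_injOn hinj]
  have : t ∈ (Finset.range D.num).image ord := by rw [him]; exact Finset.mem_range.2 ht
  obtain ⟨i, hi, e⟩ := Finset.mem_image.1 this
  exact ⟨i, Finset.mem_range.1 hi, e⟩

theorem sum_eq (ho : D.IsOrder ord) (g : ℕ → ℝ) :
    ∑ i ∈ Finset.range D.num, g (ord i) = ∑ t ∈ Finset.range D.num, g t := by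
  refine Finset.sum_bij (fun i _ => ord i) ?_ ?_ ?_ ?_
  · exact fun i hi => Finset.mem_range.2 (ho.lt i (Finset.mem_range.1 hi))
  · exact fun i hi j hj e => ho.inj i (Finset.mem_range.1 hi) j (Finset.mem_range.1 hj) e
  · intro t ht
    obtain ⟨i, hi, e⟩ := ho.exists_eq (Finset.mem_range.1 ht)
    exact ⟨i, Finset.mem_range.2 hi, e⟩
  · exact fun _ _ => rfl

/-- Every node but the root has its parent at an earlier position of `ord`, so this is strong
induction on positions. -/
theorem topDown (ho : D.IsOrder ord) {P : ℕ → Prop} (hroot : P D.root)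
    (hstep : ∀ t < D.num, P t →
      (D.fst t < D.num → P (D.fst t)) ∧ (D.snd t < D.num → P (D.snd t))) :
    ∀ t < D.num, P t := by
  have key : ∀ j < D.num, P (ord j) := by
    intro j
    induction j using Nat.strong_induction_on with
    | _ j ih =>
      intro hj
      rcases Nat.eq_zero_or_pos j with rfl | hpos
      · rw [ho.zero]; exact hroot
      · obtain ⟨i, hi, e⟩ := ho.earlier j hj hpos
        have hiN : i < D.num := hi.trans hj
        have := hstep _ (ho.lt i hiN) (ih i hi hiN)
        rcases e with e | e
        · rw [← e]; exact this.1 (e ▸ ho.lt j hj)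
        · rw [← e]; exact this.2 (e ▸ ho.lt j hj)
  intro t ht
  obtain ⟨i, hi, rfl⟩ := ho.exists_eq ht
  exact key i hi

/-- Children stand later in `ord`, so this is induction on the distance from its end. The sentinel
takes the place of missing children, which is why `P` must hold there as well. -/
theorem bottomUp (ho : D.IsOrder ord) (h : D.IsNice n Adj) {P : ℕ → Prop} (hnum : P D.num)
    (hstep : ∀ t < D.num, P (D.fst t) → P (D.snd t) → P t) : ∀ t < D.num, P t := by
  have key : ∀ d j, j < D.num → D.num - j = d → P (ord j) := by
    intro d
    induction d using Nat.strong_induction_on with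
    | _ d ih =>
      intro j hj hd
      refine hstep _ (ho.lt j hj) ?_ ?_
      · rcases (h.fst_le (ho.lt j hj)).lt_or_eq with hl | hl
        · obtain ⟨i, h₁, h₂, h₃⟩ := ho.fst_later j hj hl
          rw [← h₃]; exact ih _ (by omega) i h₂ rfl
        · rw [hl]; exact hnum
      · rcases (h.snd_le (ho.lt j hj)).lt_or_eq with hl | hl
        · obtain ⟨i, h₁, h₂, h₃⟩ := ho.snd_later j hj hl
          rw [← h₃]; exact ih _ (by omega) i h₂ rfl
        · rw [hl]; exact hnum
  intro t ht
  obtain ⟨i, hi, rfl⟩ := ho.exists_eq ht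
  exact key _ i hi rfl

/-- Values can be chosen from the leaves to the root. -/
theorem exists_bottomUp (ho : D.IsOrder ord) (h : D.IsNice n Adj) {α : Type}
    (P : ℕ → α → Prop) (Q : ℕ → α → α → α → Prop) (a₀ : α) (h₀ : P D.num a₀)
    (hstep : ∀ t < D.num, ∀ a₁ a₂, P (D.fst t) a₁ → P (D.snd t) a₂ → ∃ a, P t a ∧ Q t a a₁ a₂) :
    ∃ S : ℕ → α, S D.num = a₀ ∧
      ∀ t < D.num, P t (S t) ∧ Q t (S t) (S (D.fst t)) (S (D.snd t)) := by
  have key : ∀ d ≤ D.num, ∃ S : ℕ → α, S D.num = a₀ ∧ ∀ j, D.num - d ≤ j → j < D.num →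
      P (ord j) (S (ord j)) ∧ Q (ord j) (S (ord j)) (S (D.fst (ord j))) (S (D.snd (ord j))) := by
    intro d
    induction d with
    | zero => exact fun _ => ⟨fun _ => a₀, rfl, fun j h₁ h₂ => by omega⟩
    | succ d ih =>
      intro hd
      obtain ⟨S, hS₀, hS⟩ := ih (by omega)
      set i := D.num - (d + 1) with hi
      have hiN : i < D.num := by omega
      have hP : ∀ s, s ≤ D.num → (s < D.num → ∃ j, i < j ∧ j < D.num ∧ ord j = s) →
          P s (S s) ∧ s ≠ ord i := by
        intro s hs hs'
        rcases hs.lt_or_eq with hl | hl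
        · obtain ⟨j, h₁, h₂, rfl⟩ := hs' hl
          exact ⟨(hS j (by omega) h₂).1, fun e => by have := ho.inj _ h₂ _ hiN e; omega⟩
        · rw [hl]
          exact ⟨hS₀ ▸ h₀, (ho.lt i hiN).ne'⟩
      have h₁ := hP _ (h.fst_le (ho.lt i hiN)) (ho.fst_later i hiN)
      have h₂ := hP _ (h.snd_le (ho.lt i hiN)) (ho.snd_later i hiN)
      obtain ⟨a, ha, ha'⟩ := hstep _ (ho.lt i hiN) _ _ h₁.1 h₂.1
      -- The node `ord i` is neither a later node nor a child of itself or of a later node, so the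
      -- choices made before survive the update.
      refine ⟨Function.update S (ord i) a, ?_, ?_⟩
      · rw [Function.update_of_ne (ho.lt i hiN).ne']; exact hS₀
      · intro j hj hjN
        rcases eq_or_lt_of_le hj with rfl | hlt
        · rw [Function.update_self, Function.update_of_ne h₁.2, Function.update_of_ne h₂.2]
          exact ⟨ha, ha'⟩
        · have hne : ∀ s, s ≤ D.num → (s < D.num → ∃ j', j < j' ∧ j' < D.num ∧ ord j' = s) →
              s ≠ ord i := fun s hs hs' => (hP s hs fun hl => by
                obtain ⟨j', q₁, q₂, q₃⟩ := hs' hl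
                exact ⟨j', by omega, q₂, q₃⟩).2
          have hj' : ord j ≠ ord i := fun e => by have := ho.inj _ hjN _ hiN e; omega
          rw [Function.update_of_ne hj',
            Function.update_of_ne (hne _ (h.fst_le (ho.lt j hjN)) (ho.fst_later j hjN)),
            Function.update_of_ne (hne _ (h.snd_le (ho.lt j hjN)) (ho.snd_later j hjN))]
          exact hS j (by omega) hjN
  obtain ⟨S, hS₀, hS⟩ := key D.num le_rfl
  refine ⟨S, hS₀, fun t ht => ?_⟩
  obtain ⟨i, hi, rfl⟩ := ho.exists_eq ht
  exact hS i (by omega) hi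

end IsOrder

/-- The node at which `v` is forgotten. -/
noncomputable def forgetNode (D : TreeData) (v : ℕ) : ℕ :=
  Classical.epsilon fun t => t < D.num ∧ D.kind t = 3 ∧ D.lab t 0 = v

theorem IsNice.forgetNode_spec (h : D.IsNice n Adj) {v : ℕ} (hv : v < n) :
    D.forgetNode v < D.num ∧ D.kind (D.forgetNode v) = 3 ∧ D.lab (D.forgetNode v) 0 = v :=
  Classical.epsilon_spec (p := fun t => t < D.num ∧ D.kind t = 3 ∧ D.lab t 0 = v)
    (h.forget_exists v hv)

theorem IsNice.lab_lt (h : D.IsNice n Adj) {t : ℕ} (ht : t < D.num) (h3 : D.kind t = 3) :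
    D.lab t 0 < n := h.lt_of_mem (h.forget t ht h3).2.2.1

theorem IsNice.forgetNode_lab (h : D.IsNice n Adj) {t : ℕ} (ht : t < D.num)
    (h3 : D.kind t = 3) : D.forgetNode (D.lab t 0) = t := by
  obtain ⟨h₁, h₂, h₃⟩ := h.forgetNode_spec (h.lab_lt ht h3)
  exact h.forget_unique _ h₁ _ ht h₂ h3 h₃

/-- A quantity that is passed up the tree and grows only where vertices are forgotten. -/
theorem IsOrder.root_eq_sum {ord : ℕ → ℕ} (ho : D.IsOrder ord) (h : D.IsNice n Adj)
    (g w : ℕ → ℝ) (hg : g D.num = 0)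
    (hs : ∀ t < D.num, g t = g (D.fst t) + g (D.snd t) +
      if D.kind t = 3 then w (D.lab t 0) else 0) :
    g D.root = ∑ v ∈ Finset.range n, w v := by
  have e₁ := ho.sum_children g hg
  have e₂ : ∑ i ∈ Finset.range D.num, g (ord i) =
      ∑ i ∈ Finset.range D.num, (g (D.fst (ord i)) + g (D.snd (ord i))) +
      ∑ i ∈ Finset.range D.num, if D.kind (ord i) = 3 then w (D.lab (ord i) 0) else 0 := by
    rw [← Finset.sum_add_distrib]
    exact Finset.sum_congr rfl fun i hi => hs _ (ho.lt i (Finset.mem_range.1 hi))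
  have e₃ := ho.sum_eq fun t => if D.kind t = 3 then w (D.lab t 0) else 0
  -- Forget nodes correspond to vertices, since every vertex is forgotten exactly once.
  have e₄ : ∑ t ∈ Finset.range D.num, (if D.kind t = 3 then w (D.lab t 0) else 0) =
      ∑ v ∈ Finset.range n, w v := by
    rw [← Finset.sum_filter]
    refine Finset.sum_bij (fun t _ => D.lab t 0) ?_ ?_ ?_ ?_
    · intro t ht
      simp only [Finset.mem_filter, Finset.mem_range] at ht
      exact Finset.mem_range.2 (h.lab_lt ht.1 ht.2)
    · intro s hs t ht e
      simp only [Finset.mem_filter, Finset.mem_range] at hs ht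
      exact h.forget_unique s hs.1 t ht.1 hs.2 ht.2 e
    · intro v hv
      obtain ⟨t, h₁, h₂, h₃⟩ := h.forget_exists v (Finset.mem_range.1 hv)
      exact ⟨t, by simp [h₁, h₂], h₃⟩
    · exact fun _ _ => rfl
  linarith

end TreeData

/-! ## States of the dynamic program -/

/-! ### Merging one colouring along another -/

section Merging

open Classical in
/-- Within `M`, recolour the class of `u` with the colour of `w`. -/
noncomputable def mergeAt (M : ℕ → Prop) (C : ℕ → ℕ) (u w : ℕ) : ℕ → ℕ :=
  fun y => if M y ∧ C y = C u then C w else C y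

/-- Merge `u` with those of the first `j` vertices of `l` that have the same colour in `C₂`. -/
noncomputable def mergeRow (M : ℕ → Prop) (l C₂ : ℕ → ℕ) (u : ℕ) :
    ℕ → (ℕ → ℕ) → ℕ → ℕ
  | 0, C => C
  | j + 1, C =>
    if C₂ u = C₂ (l j) then mergeAt M (mergeRow M l C₂ u j C) u (l j)
    else mergeRow M l C₂ u j C

/-- Merge the first `i` with the first `s` vertices of `l` where they have the same colour
in `C₂`. -/
noncomputable def mergeRows (M : ℕ → Prop) (l C₂ : ℕ → ℕ) (s : ℕ) : ℕ → (ℕ → ℕ) → ℕ → ℕ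
  | 0, C => C
  | i + 1, C => mergeRow M l C₂ (l i) s (mergeRows M l C₂ s i C)

/-- `C'` is coarser than `C` on `M`. -/
def Coarser (M : ℕ → Prop) (C C' : ℕ → ℕ) : Prop :=
  ∀ y z, M y → M z → C y = C z → C' y = C' z

/-- On `M`, vertices of the same colour are related by `R`. -/
def ColorsRefine (M : ℕ → Prop) (C : ℕ → ℕ) (R : ℕ → ℕ → Prop) : Prop :=
  ∀ y z, M y → M z → C y = C z → R y z

variable {M : ℕ → Prop} {l C C' C₂ C₂' : ℕ → ℕ} {R : ℕ → ℕ → Prop}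

theorem mergeAt_coarser (u w : ℕ) : Coarser M C (mergeAt M C u w) := by
  intro y z hy hz e
  simp [mergeAt, hy, hz, e]

theorem mergeAt_eq {u w : ℕ} (hu : M u) : mergeAt M C u w u = mergeAt M C u w w := by
  by_cases e : C w = C u <;> simp [mergeAt, hu, e]

/-- Merging joins nothing that is not forced: `R` is an arbitrary equivalence that respects the old
classes and relates `u` and `w`, so the new classes are as small as possible. -/
theorem mergeAt_refine (hR : Equivalence R) {u w : ℕ} (hu : M u) (hw : M w) (huw : R u w)
    (h : ColorsRefine M C R) : ColorsRefine M (mergeAt M C u w) R := by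
  intro y z hy hz e
  simp only [mergeAt, hy, hz, true_and] at e
  split_ifs at e with h₁ h₂ h₂
  · exact hR.trans (h y u hy hu h₁) (hR.symm (h z u hz hu h₂))
  · exact hR.trans (h y u hy hu h₁) (hR.trans huw (h w z hw hz e))
  · exact hR.trans (h y w hy hw e) (hR.trans (hR.symm huw) (hR.symm (h z u hz hu h₂)))
  · exact h y z hy hz e

theorem mergeAt_lt {b u w : ℕ} (hw : M w) (h : ∀ y, M y → C y < b) :
    ∀ y, M y → mergeAt M C u w y < b := by
  intro y hy
  simp only [mergeAt]
  split_ifs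
  · exact h w hw
  · exact h y hy

theorem mergeAt_congr {u w : ℕ} (hu : M u) (hw : M w) (h : ∀ y, M y → C y = C' y) :
    ∀ y, M y → mergeAt M C u w y = mergeAt M C' u w y := by
  intro y hy
  by_cases e : C' y = C' u <;> simp [mergeAt, hy, e, h u hu, h w hw, h y hy]

/-- Properties preserved by merging are preserved by repeated merging. -/
theorem mergeRow_induction {Q : (ℕ → ℕ) → Prop} {u s : ℕ} (h₀ : Q C)
    (hs : ∀ C' i, i < s → C₂ u = C₂ (l i) → Q C' → Q (mergeAt M C' u (l i))) :
    ∀ j ≤ s, Q (mergeRow M l C₂ u j C) := by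
  intro j
  induction j with
  | zero => exact fun _ => h₀
  | succ j ih =>
    intro hj
    simp only [mergeRow]
    split_ifs with e
    · exact hs _ j hj e (ih (by omega))
    · exact ih (by omega)

theorem mergeRows_induction {Q : (ℕ → ℕ) → Prop} {s : ℕ} (h₀ : Q C)
    (hs : ∀ C' i j, i < s → j < s → C₂ (l i) = C₂ (l j) → Q C' → Q (mergeAt M C' (l i) (l j))) :
    ∀ i ≤ s, Q (mergeRows M l C₂ s i C) := by
  intro i
  induction i with
  | zero => exact fun _ => h₀
  | succ i ih =>
    intro hi
    exact mergeRow_induction (ih (by omega)) (fun C' j hj e => hs C' i j hi hj e) s le_rfl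

theorem Coarser.trans {C'' : ℕ → ℕ} (h : Coarser M C C') (h' : Coarser M C' C'') :
    Coarser M C C'' := fun y z hy hz e => h' y z hy hz (h y z hy hz e)

/-- Merges only coarsen, so an equality produced by one of them is never lost later. -/
theorem mergeRow_eq {u s : ℕ} (hu : M u) (hl : ∀ i < s, M (l i)) :
    ∀ j ≤ s, ∀ i < j, C₂ u = C₂ (l i) →
      mergeRow M l C₂ u j C u = mergeRow M l C₂ u j C (l i) := by
  intro j
  induction j with
  | zero => intro _ i hi; omega
  | succ j ih =>
    intro hj i hi e
    simp only [mergeRow]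
    rcases Nat.lt_succ_iff_lt_or_eq.1 hi with h | rfl
    · have := ih (by omega) i h e
      split_ifs
      · exact mergeAt_coarser _ _ _ _ hu (hl i (by omega)) this
      · exact this
    · rw [if_pos e]
      exact mergeAt_eq hu

theorem mergeRows_eq {s : ℕ} (hl : ∀ i < s, M (l i)) :
    ∀ i ≤ s, ∀ i' < i, ∀ j < s, C₂ (l i') = C₂ (l j) →
      mergeRows M l C₂ s i C (l i') = mergeRows M l C₂ s i C (l j) := by
  intro i
  induction i with
  | zero => intro _ i hi; omega
  | succ i ih =>
    intro hi i' hi' j hj e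
    simp only [mergeRows]
    rcases Nat.lt_succ_iff_lt_or_eq.1 hi' with h | rfl
    · have := ih (by omega) i' h j hj e
      exact mergeRow_induction (Q := fun C' => C' (l i') = C' (l j)) this
        (fun C' _ _ _ h => mergeAt_coarser _ _ _ _ (hl i' (by omega)) (hl j hj) h) s le_rfl
    · exact mergeRow_eq (hl i' (by omega)) hl s le_rfl j hj e

theorem mergeRow_congr {u s : ℕ} (hu : M u) (hl : ∀ i < s, M (l i)) (h : ∀ y, M y → C y = C' y)
    (h₂ : ∀ y, M y → C₂ y = C₂' y) : ∀ j ≤ s, ∀ y, M y →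
      mergeRow M l C₂ u j C y = mergeRow M l C₂' u j C' y := by
  intro j
  induction j with
  | zero => exact fun _ => h
  | succ j ih =>
    intro hj y hy
    simp only [mergeRow, h₂ u hu, h₂ (l j) (hl j hj)]
    split_ifs
    · exact mergeAt_congr hu (hl j hj) (ih (by omega)) y hy
    · exact ih (by omega) y hy

theorem mergeRows_congr {s : ℕ} (hl : ∀ i < s, M (l i)) (h : ∀ y, M y → C y = C' y)
    (h₂ : ∀ y, M y → C₂ y = C₂' y) : ∀ i ≤ s, ∀ y, M y →
      mergeRows M l C₂ s i C y = mergeRows M l C₂' s i C' y := by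
  intro i
  induction i with
  | zero => exact fun _ => h
  | succ i ih =>
    intro hi
    exact mergeRow_congr (hl i hi) hl (ih (by omega)) h₂ s le_rfl

end Merging

/-- A state: the component and the label of every vertex of a bag, and the number of clusters
that are already complete. -/
structure DPState where
  comp : ℕ → ℕ
  label : ℕ → ℕ
  count : ℕ

/-! ### The transition relation of the dynamic program -/

namespace TreeData

variable {D : TreeData} {n k : ℕ} {Adj : ℕ → ℕ → Prop}

/-- The components that are left when the children of `t` are glued. -/
noncomputable def joinComp (D : TreeData) (t : ℕ) (C₁ C₂ : ℕ → ℕ) : ℕ → ℕ :=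
  mergeRows (fun u => D.Mem u (D.fst t)) (D.bag (D.snd t)) C₂ (D.size (D.snd t))
    (D.size (D.snd t)) C₁

/-- The components after the vertex or edge of `t` has been introduced into `C` according
to the colours `C₀`. -/
noncomputable def introComp (D : TreeData) (t : ℕ) (C₀ C : ℕ → ℕ) : ℕ → ℕ :=
  if D.kind t = 1 then Function.update C (D.lab t 0) (C₀ (D.lab t 0))
  else if D.kind t = 2 ∧ C₀ (D.lab t 0) = C₀ (D.lab t 1) then
    mergeAt (fun u => D.Mem u (D.fst t)) C (D.lab t 0) (D.lab t 1)
  else C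

/-- The label of a vertex is a free choice at the node that introduces it; the choice is read off
the new labels `L₀`. All other nodes copy. -/
noncomputable def introLabel (D : TreeData) (t : ℕ) (L₀ L : ℕ → ℕ) : ℕ → ℕ :=
  if D.kind t = 1 then Function.update L (D.lab t 0) (L₀ (D.lab t 0)) else L

/-- The vertex `v` is alone in its component in the bag of `t`. -/
def Alone (D : TreeData) (t : ℕ) (C : ℕ → ℕ) (v : ℕ) : Prop :=
  ∀ u, D.Mem u t → u ≠ v → C u ≠ C v

open Classical in
/-- `S` can be the state of `t` if `S₁` and `S₂` are the states of its children. -/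
structure Step (D : TreeData) (k t : ℕ) (S S₁ S₂ : DPState) : Prop where
  labels : ∀ u, D.Mem u (D.snd t) → S₁.label u = S₂.label u
  fresh : D.kind t = 1 → ∀ u, D.Mem u (D.fst t) →
    D.joinComp t S₁.comp S₂.comp u ≠ S.comp (D.lab t 0)
  merge : D.kind t = 2 → S.comp (D.lab t 0) = S.comp (D.lab t 1) →
    S₁.label (D.lab t 0) = S₁.label (D.lab t 1)
  label_lt : D.kind t = 3 → S₁.label (D.lab t 0) < k
  comp : ∀ u, D.Mem u t →
    S.comp u = D.introComp t S.comp (D.joinComp t S₁.comp S₂.comp) u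
  label : ∀ u, D.Mem u t → S.label u = D.introLabel t S.label S₁.label u
  count : S.count = S₁.count + S₂.count +
    if D.kind t = 3 ∧ D.Alone (D.fst t) (D.joinComp t S₁.comp S₂.comp) (D.lab t 0) then 1 else 0

theorem IsNice.mem_bag_snd (h : D.IsNice n Adj) {t : ℕ} (ht : t < D.num) :
    ∀ i < D.size (D.snd t), D.Mem (D.bag (D.snd t) i) (D.fst t) := fun i hi =>
  (h.mem_of_mem_snd ht ⟨i, hi, rfl⟩).2.2

/-- With the sentinel as second child there is nothing to merge. This is what lets all types of
nodes share one formula for the glued components. -/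
theorem IsNice.joinComp_eq (h : D.IsNice n Adj) {t : ℕ} (ht : t < D.num) (h4 : D.kind t ≠ 4)
    (C₁ C₂ : ℕ → ℕ) : D.joinComp t C₁ C₂ = C₁ := by
  rw [joinComp, h.snd_eq_num ht h4, h.size_num]
  rfl

theorem joinComp_coarser_fst (D : TreeData) (t : ℕ) (C₁ C₂ : ℕ → ℕ) :
    Coarser (fun u => D.Mem u (D.fst t)) C₁ (D.joinComp t C₁ C₂) :=
  mergeRows_induction (Q := fun C' => Coarser _ C₁ C') (fun _ _ _ _ e => e)
    (fun _ _ _ _ _ _ hC => hC.trans (mergeAt_coarser _ _)) _ le_rfl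

theorem joinComp_coarser_snd (h : D.IsNice n Adj) {t : ℕ} (ht : t < D.num) (C₁ C₂ : ℕ → ℕ) :
    Coarser (fun u => D.Mem u (D.snd t)) C₂ (D.joinComp t C₁ C₂) := by
  rintro _ _ ⟨i, hi, rfl⟩ ⟨j, hj, rfl⟩ e
  exact mergeRows_eq (h.mem_bag_snd ht) _ le_rfl i hi j hj e

theorem joinComp_refine (h : D.IsNice n Adj) {t : ℕ} (ht : t < D.num) {C₁ C₂ : ℕ → ℕ}
    {R : ℕ → ℕ → Prop} (hR : Equivalence R)
    (h₁ : ColorsRefine (fun u => D.Mem u (D.fst t)) C₁ R)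
    (h₂ : ColorsRefine (fun u => D.Mem u (D.snd t)) C₂ R) :
    ColorsRefine (fun u => D.Mem u (D.fst t)) (D.joinComp t C₁ C₂) R :=
  mergeRows_induction (Q := fun C' => ColorsRefine _ C' R) h₁
    (fun _ i j hi hj e hC => mergeAt_refine hR (h.mem_bag_snd ht i hi) (h.mem_bag_snd ht j hj)
      (h₂ _ _ ⟨i, hi, rfl⟩ ⟨j, hj, rfl⟩ e) hC) _ le_rfl

theorem joinComp_lt (h : D.IsNice n Adj) {t b : ℕ} (ht : t < D.num) {C₁ C₂ : ℕ → ℕ}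
    (h₁ : ∀ u, D.Mem u (D.fst t) → C₁ u < b) :
    ∀ u, D.Mem u (D.fst t) → D.joinComp t C₁ C₂ u < b :=
  mergeRows_induction (Q := fun C' => ∀ u, D.Mem u (D.fst t) → C' u < b) h₁
    (fun _ _ j _ hj _ hC => mergeAt_lt (h.mem_bag_snd ht j hj) hC) _ le_rfl

theorem joinComp_congr (h : D.IsNice n Adj) {t : ℕ} (ht : t < D.num) {C₁ C₂ C₁' C₂' : ℕ → ℕ}
    (h₁ : ∀ u, D.Mem u (D.fst t) → C₁ u = C₁' u) (h₂ : ∀ u, D.Mem u (D.snd t) → C₂ u = C₂' u) :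
    ∀ u, D.Mem u (D.fst t) → D.joinComp t C₁ C₂ u = D.joinComp t C₁' C₂' u := by
  by_cases h4 : D.kind t = 4
  · refine mergeRows_congr (h.mem_bag_snd ht) h₁ (fun u hu => h₂ u ?_) _ le_rfl
    have := (h.join t ht h4).2.2 u
    tauto
  · rw [h.joinComp_eq ht h4, h.joinComp_eq ht h4]
    exact h₁

/-- Steps depend only on the values of the states on the bags. -/
theorem Step.congr (h : D.IsNice n Adj) {t : ℕ} (ht : t < D.num) {S S₁ S₂ S' S₁' S₂' : DPState}
    (hs : D.Step k t S S₁ S₂)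
    (h₀ : ∀ u, D.Mem u t → S.comp u = S'.comp u ∧ S.label u = S'.label u)
    (h₁ : ∀ u, D.Mem u (D.fst t) → S₁.comp u = S₁'.comp u ∧ S₁.label u = S₁'.label u)
    (h₂ : ∀ u, D.Mem u (D.snd t) → S₂.comp u = S₂'.comp u ∧ S₂.label u = S₂'.label u)
    (c₀ : S.count = S'.count) (c₁ : S₁.count = S₁'.count) (c₂ : S₂.count = S₂'.count) :
    D.Step k t S' S₁' S₂' := by
  classical
  have hj := joinComp_congr h ht (fun u hu => (h₁ u hu).1) (fun u hu => (h₂ u hu).1)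
  have m1 : D.kind t = 1 → D.Mem (D.lab t 0) t := fun e =>
    ((h.introVertex t ht e).2.2.2 _).2 (Or.inl rfl)
  have m2 : D.kind t = 2 → D.Mem (D.lab t 0) t ∧ D.Mem (D.lab t 1) t ∧
      D.Mem (D.lab t 0) (D.fst t) ∧ D.Mem (D.lab t 1) (D.fst t) := fun e => by
    obtain ⟨-, -, -, q₁, q₂, q₃⟩ := h.introEdge t ht e
    exact ⟨q₁, q₂, (q₃ _).1 q₁, (q₃ _).1 q₂⟩
  have hmem : ∀ u, D.Mem u t → D.kind t ≠ 1 → D.Mem u (D.fst t) := by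
    intro u hu hk
    rcases h.kind_cases t ht with e | e | e | e | e
    · exact absurd hu (not_mem_of_size_eq_zero (h.leaf t ht e).2.2)
    · exact absurd e hk
    · exact ((h.introEdge t ht e).2.2.2.2.2 u).1 hu
    · exact (((h.forget t ht e).2.2.2 u).1 hu).2
    · exact ((h.join t ht e).2.2 u).1.1 hu
  refine ⟨?_, ?_, ?_, ?_, ?_, ?_, ?_⟩
  · intro u hu
    rw [← (h₁ u (h.mem_of_mem_snd ht hu).2.2).2, ← (h₂ u hu).2]
    exact hs.labels u hu
  · intro e u hu
    rw [← hj u hu, ← (h₀ _ (m1 e)).1]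
    exact hs.fresh e u hu
  · intro e
    obtain ⟨q₁, q₂, q₃, q₄⟩ := m2 e
    rw [← (h₀ _ q₁).1, ← (h₀ _ q₂).1, ← (h₁ _ q₃).2, ← (h₁ _ q₄).2]
    exact hs.merge e
  · intro e
    rw [← (h₁ _ (h.forget t ht e).2.2.1).2]
    exact hs.label_lt e
  · intro u hu
    rw [← (h₀ u hu).1, hs.comp u hu]
    unfold introComp
    by_cases e1 : D.kind t = 1
    · rw [if_pos e1, if_pos e1, ← (h₀ _ (m1 e1)).1]
      by_cases hv : u = D.lab t 0
      · rw [hv, Function.update_self, Function.update_self]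
      · rw [Function.update_of_ne hv, Function.update_of_ne hv]
        exact hj u ((((h.introVertex t ht e1).2.2.2 u).1 hu).resolve_left hv)
    · rw [if_neg e1, if_neg e1]
      by_cases e2 : D.kind t = 2
      · obtain ⟨q₁, q₂, q₃, q₄⟩ := m2 e2
        rw [← (h₀ _ q₁).1, ← (h₀ _ q₂).1]
        split_ifs
        · exact mergeAt_congr (M := fun u => D.Mem u (D.fst t)) q₃ q₄ hj u (hmem u hu e1)
        · exact hj u (hmem u hu e1)
      · rw [if_neg (by tauto), if_neg (by tauto)]
        exact hj u (hmem u hu e1)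
  · intro u hu
    rw [← (h₀ u hu).2, hs.label u hu]
    unfold introLabel
    by_cases e1 : D.kind t = 1
    · rw [if_pos e1, if_pos e1, ← (h₀ _ (m1 e1)).2]
      by_cases hv : u = D.lab t 0
      · rw [hv, Function.update_self, Function.update_self]
      · rw [Function.update_of_ne hv, Function.update_of_ne hv]
        exact (h₁ u ((((h.introVertex t ht e1).2.2.2 u).1 hu).resolve_left hv)).2
    · rw [if_neg e1, if_neg e1]
      exact (h₁ u (hmem u hu e1)).2
  · rw [← c₀, ← c₁, ← c₂, hs.count]
    congr 1
    refine if_congr (and_congr_right fun e => ?_) rfl rfl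
    refine forall_congr' fun u => forall_congr' fun hu => forall_congr' fun _ => ?_
    rw [hj u hu, hj _ (h.forget t ht e).2.2.1]

namespace Step

variable {t : ℕ} {S S₁ S₂ : DPState}

/-- Introducing a vertex or an edge never separates two old vertices; the only vertex that is
recoloured at will is the introduced one, and it is not in the bag of the child. -/
theorem coarser_aux (h : D.IsNice n Adj) (ht : t < D.num) (hs : D.Step k t S S₁ S₂) {u w : ℕ}
    (hu : D.Mem u t) (hw : D.Mem w t) (hu' : D.Mem u (D.fst t)) (hw' : D.Mem w (D.fst t))
    (e : D.joinComp t S₁.comp S₂.comp u = D.joinComp t S₁.comp S₂.comp w) :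
    S.comp u = S.comp w := by
  rw [hs.comp u hu, hs.comp w hw]
  unfold introComp
  split_ifs with e1 e2
  · have := (h.introVertex t ht e1).2.2.1
    rw [Function.update_of_ne, Function.update_of_ne, e]
    · rintro rfl; exact this hw'
    · rintro rfl; exact this hu'
  · exact mergeAt_coarser (M := fun u => D.Mem u (D.fst t)) _ _ _ _ hu' hw' e
  · exact e

theorem coarser_fst (h : D.IsNice n Adj) (ht : t < D.num) (hs : D.Step k t S S₁ S₂) {u w : ℕ}
    (hu : D.Mem u t) (hw : D.Mem w t) (hu' : D.Mem u (D.fst t)) (hw' : D.Mem w (D.fst t))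
    (e : S₁.comp u = S₁.comp w) : S.comp u = S.comp w :=
  hs.coarser_aux h ht hu hw hu' hw' (joinComp_coarser_fst D t _ _ _ _ hu' hw' e)

theorem coarser_snd (h : D.IsNice n Adj) (ht : t < D.num) (hs : D.Step k t S S₁ S₂) {u w : ℕ}
    (hu : D.Mem u (D.snd t)) (hw : D.Mem w (D.snd t)) (e : S₂.comp u = S₂.comp w) :
    S.comp u = S.comp w := by
  obtain ⟨-, h₁, h₂⟩ := h.mem_of_mem_snd ht hu
  obtain ⟨-, h₃, h₄⟩ := h.mem_of_mem_snd ht hw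
  exact hs.coarser_aux h ht h₁ h₃ h₂ h₄ (joinComp_coarser_snd h ht _ _ _ _ hu hw e)

theorem label_fst (h : D.IsNice n Adj) (ht : t < D.num) (hs : D.Step k t S S₁ S₂) {u : ℕ}
    (hu : D.Mem u t) (hu' : D.Mem u (D.fst t)) : S.label u = S₁.label u := by
  rw [hs.label u hu]
  unfold introLabel
  split_ifs with e1
  · have := (h.introVertex t ht e1).2.2.1
    rw [Function.update_of_ne]
    rintro rfl; exact this hu'
  · rfl

theorem label_snd (h : D.IsNice n Adj) (ht : t < D.num) (hs : D.Step k t S S₁ S₂) {u : ℕ}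
    (hu : D.Mem u (D.snd t)) : S.label u = S₂.label u := by
  obtain ⟨-, h₁, h₂⟩ := h.mem_of_mem_snd ht hu
  rw [hs.label_fst h ht h₁ h₂, hs.labels u hu]

/-- One step of soundness from the leaves to the root. Only a used edge contributes a pair that has
to be in `R` by assumption; joins follow by transitivity, and the fresh colour keeps an introduced
vertex apart from all others. -/
theorem refine (h : D.IsNice n Adj) (ht : t < D.num) (hs : D.Step k t S S₁ S₂)
    {R : ℕ → ℕ → Prop} (hR : Equivalence R)
    (h₁ : ColorsRefine (fun u => D.Mem u (D.fst t)) S₁.comp R)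
    (h₂ : ColorsRefine (fun u => D.Mem u (D.snd t)) S₂.comp R)
    (he : D.kind t = 2 → S.comp (D.lab t 0) = S.comp (D.lab t 1) → R (D.lab t 0) (D.lab t 1)) :
    ColorsRefine (fun u => D.Mem u t) S.comp R := by
  have hj := joinComp_refine h ht hR h₁ h₂
  intro y z hy hz e
  rcases h.kind_cases t ht with e' | e' | e' | e' | e'
  · exact absurd hy (not_mem_of_size_eq_zero (h.leaf t ht e').2.2)
  · obtain ⟨-, -, q₁, q₂⟩ := h.introVertex t ht e'
    have hc : ∀ u, D.Mem u (D.fst t) →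
        S.comp u = D.joinComp t S₁.comp S₂.comp u := by
      intro u hu
      rw [hs.comp u ((q₂ u).2 (Or.inr hu)), introComp, if_pos e', Function.update_of_ne]
      rintro rfl; exact q₁ hu
    rcases (q₂ y).1 hy with rfl | hy' <;> rcases (q₂ z).1 hz with rfl | hz'
    · exact hR.refl _
    · rw [hc z hz'] at e
      exact absurd e.symm (hs.fresh e' z hz')
    · rw [hc y hy'] at e
      exact absurd e (hs.fresh e' y hy')
    · exact hj y z hy' hz' (by rw [← hc y hy', ← hc z hz', e])
  · obtain ⟨-, -, -, q₁, q₂, q₃⟩ := h.introEdge t ht e'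
    have e'' := e
    rw [hs.comp y hy, hs.comp z hz] at e''
    simp only [introComp, e'] at e''
    split_ifs at e'' with e₁ e₂
    · omega
    · exact mergeAt_refine (M := fun u => D.Mem u (D.fst t)) hR ((q₃ _).1 q₁) ((q₃ _).1 q₂)
        (he e' e₂.2) hj y z ((q₃ _).1 hy) ((q₃ _).1 hz) e''
    · exact hj y z ((q₃ _).1 hy) ((q₃ _).1 hz) e''
  · have q := (h.forget t ht e').2.2.2
    rw [hs.comp y hy, hs.comp z hz] at e
    simp only [introComp, e'] at e
    exact hj y z ((q y).1 hy).2 ((q z).1 hz).2 (by simpa using e)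
  · have q := (h.join t ht e').2.2
    rw [hs.comp y hy, hs.comp z hz] at e
    simp only [introComp, e'] at e
    exact hj y z ((q y).1.1 hy) ((q z).1.1 hz) (by simpa using e)

end Step

/-! ### From a derivation to a clustering -/

/-- The state of every node arises from the states of its children. -/
def Derivation (D : TreeData) (k : ℕ) (S : ℕ → DPState) : Prop :=
  (S D.num).count = 0 ∧ ∀ t < D.num, D.Step k t (S t) (S (D.fst t)) (S (D.snd t))

/-- `v` is the last vertex of its cluster to be forgotten. -/
def IsLast (D : TreeData) (S : ℕ → DPState) (v : ℕ) : Prop :=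
  D.Alone (D.fst (D.forgetNode v)) (S (D.fst (D.forgetNode v))).comp v

/-- The label of `v`. -/
noncomputable def vertexLabel (D : TreeData) (S : ℕ → DPState) (v : ℕ) : ℕ :=
  (S (D.fst (D.forgetNode v))).label v

/-- `part` puts a vertex that is not the last one of its cluster into the cluster of a
vertex that is forgotten later. -/
def FollowsParts {α : Type} (D : TreeData) (n : ℕ) (S : ℕ → DPState) (part : ℕ → α) : Prop :=
  ∀ v < n, ¬ D.IsLast S v → ∃ u, D.Mem u (D.fst (D.forgetNode v)) ∧ u ≠ v ∧
    (S (D.fst (D.forgetNode v))).comp u = (S (D.fst (D.forgetNode v))).comp v ∧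
    part u = part v

variable {ord : ℕ → ℕ} {S : ℕ → DPState}

/-- As the root bag is empty, a vertex in the bag of `t` has to be forgotten on the way up, strictly
above `t`, and it is forgotten at one node only. This makes recursions in which vertices refer to
vertices forgotten higher up well founded. -/
theorem mem_forgotten_earlier (h : D.IsNice n Adj) (ho : D.IsOrder ord) {t u : ℕ}
    (ht : t < D.num) (hu : D.Mem u t) :
    ∃ i j, i < j ∧ j < D.num ∧ ord j = t ∧ ord i = D.forgetNode u := by
  have key : ∀ t < D.num, ∀ u, D.Mem u t →
      ∃ i j, i < j ∧ j < D.num ∧ ord j = t ∧ ord i = D.forgetNode u := by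
    refine ho.topDown (fun u hu => absurd hu (not_mem_of_size_eq_zero h.root_size)) ?_
    intro t ht ih
    constructor
    · intro hl u hu
      obtain ⟨i', hi', rfl⟩ := ho.exists_eq ht
      obtain ⟨j, q₁, q₂, q₃⟩ := ho.fst_later i' hi' hl
      rcases h.mem_or_forgotten ht hu with hm | ⟨h3, rfl⟩
      · obtain ⟨i, j', r₁, r₂, r₃, r₄⟩ := ih u hm
        have := ho.inj _ r₂ _ hi' r₃
        exact ⟨i, j, by omega, q₂, q₃, r₄⟩
      · exact ⟨i', j, q₁, q₂, q₃, (h.forgetNode_lab ht h3).symm⟩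
    · intro hl u hu
      obtain ⟨i', hi', rfl⟩ := ho.exists_eq ht
      obtain ⟨j, q₁, q₂, q₃⟩ := ho.snd_later i' hi' hl
      obtain ⟨i, j', r₁, r₂, r₃, r₄⟩ := ih u (h.mem_of_mem_snd ht hu).2.1
      have := ho.inj _ r₂ _ hi' r₃
      exact ⟨i, j, by omega, q₂, q₃, r₄⟩
  exact key t ht u hu

/-- Labels are copied unchanged up to the node that forgets the vertex, and `vertexLabel` is the
label just below that node. -/
theorem label_eq_vertexLabel (h : D.IsNice n Adj) (ho : D.IsOrder ord) (hS : D.Derivation k S) :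
    ∀ t < D.num, ∀ u, D.Mem u t → (S t).label u = D.vertexLabel S u := by
  refine ho.topDown (fun u hu => absurd hu (not_mem_of_size_eq_zero h.root_size)) ?_
  intro t ht ih
  constructor
  · intro _ u hu
    rcases h.mem_or_forgotten ht hu with hm | ⟨h3, rfl⟩
    · rw [← ih u hm, (hS.2 t ht).label_fst h ht hm hu]
    · rw [vertexLabel, h.forgetNode_lab ht h3]
  · intro _ u hu
    rw [← ih u (h.mem_of_mem_snd ht hu).2.1, (hS.2 t ht).label_snd h ht hu]

/-- Colours that are equal at a child stay equal at the parent, so the claim is inherited downwards.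
The exception is the vertex forgotten at the parent, which `FollowsParts` ties to a vertex of its
colour that remains. -/
theorem part_eq_of_comp_eq {α : Type} {part : ℕ → α} (h : D.IsNice n Adj) (ho : D.IsOrder ord)
    (hS : D.Derivation k S) (hp : D.FollowsParts n S part) :
    ∀ t < D.num, ∀ u w, D.Mem u t → D.Mem w t → (S t).comp u = (S t).comp w →
      part u = part w := by
  refine ho.topDown (fun u w hu => absurd hu (not_mem_of_size_eq_zero h.root_size)) ?_
  intro t ht ih
  constructor
  -- Here `u` survives and has the colour of the forgotten vertex, and `u'` is the vertex whose part
  -- the forgotten one shares. Both belong to the bag of `t` and have a common colour there, so the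
  -- induction hypothesis applies to them.
  · have aux : ∀ u, D.Mem u (D.fst t) → D.Mem u t → D.kind t = 3 →
        D.Mem (D.lab t 0) (D.fst t) → u ≠ D.lab t 0 →
        (S (D.fst t)).comp u = (S (D.fst t)).comp (D.lab t 0) → part u = part (D.lab t 0) := by
      intro u hu hut h3 hv hne e
      have hf := h.forgetNode_lab ht h3
      have hnl : ¬ D.IsLast S (D.lab t 0) := fun hl => by
        rw [IsLast, hf] at hl
        exact hl u hu hne e
      obtain ⟨u', q₁, q₂, q₃, q₄⟩ := hp _ (h.lab_lt ht h3) hnl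
      rw [hf] at q₁ q₃
      have hut' : D.Mem u' t := ((h.forget t ht h3).2.2.2 u').2 ⟨q₂, q₁⟩
      rw [← q₄]
      exact ih u u' hut hut' ((hS.2 t ht).coarser_fst h ht hut hut' hu q₁ (e.trans q₃.symm))
    intro _ u w hu hw e
    rcases h.mem_or_forgotten ht hu with hm | ⟨h3, h3'⟩ <;>
      rcases h.mem_or_forgotten ht hw with hm' | ⟨h3'', h4'⟩
    · exact ih u w hm hm' ((hS.2 t ht).coarser_fst h ht hm hm' hu hw e)
    · by_cases huw : u = w
      · rw [huw]
      · subst h4'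
        exact aux u hu hm h3'' hw huw e
    · by_cases huw : u = w
      · rw [huw]
      · subst h3'
        exact (aux w hw hm' h3 hu (Ne.symm huw) e.symm).symm
    · rw [← h3', ← h4']
  · intro _ u w hu hw e
    exact ih u w (h.mem_of_mem_snd ht hu).2.1 (h.mem_of_mem_snd ht hw).2.1
      ((hS.2 t ht).coarser_snd h ht hu hw e)

/-- As `R` ranges over all equivalences that contain the used edges, this says that vertices of one
colour are connected by used edges. -/
theorem colorsRefine_of_derivation (h : D.IsNice n Adj) (ho : D.IsOrder ord)
    (hS : D.Derivation k S) {R : ℕ → ℕ → Prop} (hR : Equivalence R)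
    (he : ∀ t < D.num, D.kind t = 2 → (S t).comp (D.lab t 0) = (S t).comp (D.lab t 1) →
      R (D.lab t 0) (D.lab t 1)) :
    ∀ t < D.num, ColorsRefine (fun u => D.Mem u t) (S t).comp R :=
  ho.bottomUp h (fun u _ hu => absurd hu (h.not_mem_num u)) fun t ht h₁ h₂ =>
    (hS.2 t ht).refine h ht hR h₁ h₂ (he t ht)

/-- Every vertex is related to the last vertex of its cluster. -/
theorem exists_last (h : D.IsNice n Adj) (ho : D.IsOrder ord)
    (hS : D.Derivation k S) {R : ℕ → ℕ → Prop} (hR : Equivalence R)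
    (he : ∀ t < D.num, D.kind t = 2 → (S t).comp (D.lab t 0) = (S t).comp (D.lab t 1) →
      R (D.lab t 0) (D.lab t 1)) {α : Type} {part : ℕ → α} (hp : D.FollowsParts n S part)
    {v : ℕ} (hv : v < n) : ∃ w < n, D.IsLast S w ∧ part w = part v ∧ R v w := by
  have key : ∀ i, i < D.num → ∀ v < n, ord i = D.forgetNode v →
      ∃ w < n, D.IsLast S w ∧ part w = part v ∧ R v w := by
    intro i
    induction i using Nat.strong_induction_on with
    | _ i ih =>
      intro hi v hv e
      by_cases hl : D.IsLast S v
      · exact ⟨v, hv, hl, rfl, hR.refl v⟩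
      -- The vertex `u` that `v` follows is forgotten higher up, hence at an earlier position, and
      -- the induction continues from there.
      · obtain ⟨u, q₁, q₂, q₃, q₄⟩ := hp v hv hl
        obtain ⟨f₁, f₂, f₃⟩ := h.forgetNode_spec hv
        have hf := h.forget _ f₁ f₂
        have hut : D.Mem u (D.forgetNode v) := (hf.2.2.2 u).2 ⟨by rw [f₃]; exact q₂, q₁⟩
        obtain ⟨i', j, r₁, r₂, r₃, r₄⟩ := mem_forgotten_earlier h ho f₁ hut
        have := ho.inj _ r₂ _ hi (r₃.trans e.symm)
        obtain ⟨w, s₁, s₂, s₃, s₄⟩ := ih i' (by omega) (by omega) u (h.lt_of_mem hut) r₄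
        refine ⟨w, s₁, s₂, s₃.trans q₄, hR.trans ?_ s₄⟩
        exact colorsRefine_of_derivation h ho hS hR he _ hf.1 v u
          (by have := hf.2.2.1; rwa [f₃] at this) q₁ q₃.symm
  obtain ⟨f₁, -, -⟩ := h.forgetNode_spec hv
  obtain ⟨i, hi, e⟩ := ho.exists_eq f₁
  exact key i hi v hv e

open Classical in
-- Counts of children are added, and one is added exactly at the nodes that forget a last vertex.
theorem count_root (h : D.IsNice n Adj) (ho : D.IsOrder ord) (hS : D.Derivation k S) :
    (S D.root).count = ((Finset.range n).filter fun v => D.IsLast S v).card := by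
  have := ho.root_eq_sum h (fun t => ((S t).count : ℝ)) (fun v => if D.IsLast S v then 1 else 0)
    (by simp [hS.1]) (by
      intro t ht
      have e := (hS.2 t ht).count
      have e' : ((S t).count : ℝ) = (S (D.fst t)).count + (S (D.snd t)).count +
        ((if D.kind t = 3 ∧ D.Alone (D.fst t) (D.joinComp t (S (D.fst t)).comp (S (D.snd t)).comp)
          (D.lab t 0) then 1 else 0 : ℕ) : ℝ) := by exact_mod_cast e
      rw [e']
      congr 1
      by_cases h3 : D.kind t = 3
      · rw [h.joinComp_eq ht (by omega), IsLast, h.forgetNode_lab ht h3]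
        simp [h3]
      · simp [h3])
  rw [Finset.sum_boole] at this
  exact_mod_cast this

/-- Counts only grow towards the root. Hence all of them are at most `k` if the final one is `k`,
and they fit into one digit of a code. -/
theorem count_le_root (ho : D.IsOrder ord) (hS : D.Derivation k S) :
    ∀ t < D.num, (S t).count ≤ (S D.root).count := by
  refine ho.topDown le_rfl fun t ht ih => ?_
  have := (hS.2 t ht).count
  exact ⟨fun _ => by omega, fun _ => by omega⟩

/-! ### From a clustering to a derivation -/

/-- The state `S` of `t` only joins vertices of the same cluster and has the right labels. -/
structure Respects (D : TreeData) (b : ℕ) (P ℓ : ℕ → ℕ) (t : ℕ) (S : DPState) : Prop where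
  comp : ∀ u w, D.Mem u t → D.Mem w t → S.comp u = S.comp w → P u = P w
  label : ∀ u, D.Mem u t → S.label u = ℓ (P u)
  lt : ∀ u, D.Mem u t → S.comp u < b

/-- Pigeonhole principle: a supply of colours larger than every bag suffices. -/
theorem exists_fresh (D : TreeData) (t b : ℕ) (hb : D.size t < b) (C : ℕ → ℕ) :
    ∃ c < b, ∀ u, D.Mem u t → C u ≠ c := by
  have : ((Finset.range (D.size t)).image fun i => C (D.bag t i)).card < (Finset.range b).card :=
    Finset.card_image_le.trans_lt (by simpa using hb)
  obtain ⟨c, h₁, h₂⟩ := Finset.exists_mem_notMem_of_card_lt_card this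
  refine ⟨c, Finset.mem_range.1 h₁, ?_⟩
  rintro _ ⟨i, hi, rfl⟩ e
  exact h₂ (Finset.mem_image.2 ⟨i, Finset.mem_range.2 hi, e⟩)

/-- The choices follow the clustering `P`: a new vertex gets an unused colour and the label of its
cluster, an edge is used exactly if its ends share a cluster, and the other nodes leave no choice.
The last conjunct records that no edge inside a cluster is wasted. -/
theorem exists_step (h : D.IsNice n Adj) {b : ℕ} (hb : ∀ t, D.size t < b) {P ℓ : ℕ → ℕ}
    (hℓ : ∀ v < n, ℓ (P v) < k) {t : ℕ} (ht : t < D.num) {S₁ S₂ : DPState}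
    (h₁ : D.Respects b P ℓ (D.fst t) S₁) (h₂ : D.Respects b P ℓ (D.snd t) S₂) :
    ∃ S, D.Respects b P ℓ t S ∧ D.Step k t S S₁ S₂ ∧
      (D.kind t = 2 → P (D.lab t 0) = P (D.lab t 1) →
        S.comp (D.lab t 0) = S.comp (D.lab t 1)) := by
  classical
  have hR : Equivalence fun u w => P u = P w := ⟨fun _ => rfl, fun e => e.symm, fun e e' => e.trans e'⟩
  set J := D.joinComp t S₁.comp S₂.comp with hJ
  have hj : ColorsRefine (fun u => D.Mem u (D.fst t)) J fun u w => P u = P w :=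
    joinComp_refine h ht hR h₁.comp h₂.comp
  have hjb : ∀ u, D.Mem u (D.fst t) → J u < b := joinComp_lt h ht h₁.lt
  have hlab : ∀ u, D.Mem u (D.snd t) → S₁.label u = S₂.label u := fun u hu => by
    rw [h₁.label u (h.mem_of_mem_snd ht hu).2.2, h₂.label u hu]
  set q := S₁.count + S₂.count + (if D.kind t = 3 ∧ D.Alone (D.fst t) J (D.lab t 0)
    then 1 else 0) with hq
  -- Leaves, forget nodes and joins: the glued colours and the labels of the first child are kept.
  have easy : D.kind t ≠ 1 → D.kind t ≠ 2 → (∀ u, D.Mem u t → D.Mem u (D.fst t)) →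
      (D.kind t = 3 → S₁.label (D.lab t 0) < k) →
      ∃ S, D.Respects b P ℓ t S ∧ D.Step k t S S₁ S₂ ∧
      (D.kind t = 2 → P (D.lab t 0) = P (D.lab t 1) →
        S.comp (D.lab t 0) = S.comp (D.lab t 1)) := by
    intro n1 n2 hm hlt
    refine ⟨⟨J, S₁.label, q⟩, ⟨fun u w hu hw e => hj u w (hm u hu) (hm w hw) e,
      fun u hu => h₁.label u (hm u hu), fun u hu => hjb u (hm u hu)⟩,
      ⟨hlab, fun e => absurd e n1, fun e => absurd e n2, hlt, ?_, ?_, rfl⟩,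
      fun e => absurd e n2⟩
    · intro u _; simp [introComp, n1, n2, hJ]
    · intro u _; simp [introLabel, n1]
  rcases h.kind_cases t ht with e | e | e | e | e
  · exact easy (by omega) (by omega)
      (fun u hu => absurd hu (not_mem_of_size_eq_zero (h.leaf t ht e).2.2)) (by omega)
  · obtain ⟨q₁, q₂, q₃, q₄⟩ := h.introVertex t ht e
    obtain ⟨c, hc, hc'⟩ := D.exists_fresh (D.fst t) b (hb _) J
    set v := D.lab t 0 with hv
    have hne : ∀ u, D.Mem u (D.fst t) → u ≠ v := by rintro u hu rfl; exact q₃ hu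
    refine ⟨⟨Function.update J v c, Function.update S₁.label v (ℓ (P v)), q⟩, ⟨?_, ?_, ?_⟩,
      ⟨hlab, ?_, by omega, by omega, ?_, ?_, rfl⟩, by omega⟩
    · intro u w hu hw e'
      rcases (q₄ u).1 hu with rfl | hu' <;> rcases (q₄ w).1 hw with rfl | hw'
      · rfl
      · simp only [Function.update_self, Function.update_of_ne (hne w hw')] at e'
        exact absurd e'.symm (hc' w hw')
      · simp only [Function.update_self, Function.update_of_ne (hne u hu')] at e'
        exact absurd e' (hc' u hu')
      · simp only [Function.update_of_ne (hne u hu'), Function.update_of_ne (hne w hw')] at e'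
        exact hj u w hu' hw' e'
    · intro u hu
      rcases (q₄ u).1 hu with rfl | hu'
      · simp
      · simp only [Function.update_of_ne (hne u hu')]
        exact h₁.label u hu'
    · intro u hu
      rcases (q₄ u).1 hu with rfl | hu'
      · simpa using hc
      · simp only [Function.update_of_ne (hne u hu')]
        exact hjb u hu'
    · intro _ u hu
      change J u ≠ Function.update J v c v
      rw [Function.update_self]
      exact hc' u hu
    · intro u _
      simp [introComp, e, ← hv, hJ]
    · intro u _
      simp [introLabel, e, ← hv]
  · obtain ⟨q₁, q₂, -, q₃, q₄, q₅⟩ := h.introEdge t ht e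
    by_cases hP : P (D.lab t 0) = P (D.lab t 1)
    · have hm := mergeAt_eq (C := J) (w := D.lab t 1) (M := fun u => D.Mem u (D.fst t))
        ((q₅ _).1 q₃)
      refine ⟨⟨mergeAt (fun u => D.Mem u (D.fst t)) J (D.lab t 0) (D.lab t 1), S₁.label, q⟩,
        ⟨?_, ?_, ?_⟩, ⟨hlab, by omega, ?_, by omega, ?_, ?_, rfl⟩, fun _ _ => hm⟩
      · exact fun u w hu hw e' => mergeAt_refine (M := fun u => D.Mem u (D.fst t)) hR
          ((q₅ _).1 q₃) ((q₅ _).1 q₄) hP hj u w ((q₅ _).1 hu) ((q₅ _).1 hw) e'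
      · exact fun u hu => h₁.label u ((q₅ u).1 hu)
      · exact fun u hu => mergeAt_lt (M := fun u => D.Mem u (D.fst t)) ((q₅ _).1 q₄) hjb u
          ((q₅ u).1 hu)
      · intro _ _
        rw [h₁.label _ ((q₅ _).1 q₃), h₁.label _ ((q₅ _).1 q₄), hP]
      · intro u _
        simp [introComp, e, ← hJ, hm]
      · intro u _
        simp [introLabel, e]
    · refine ⟨⟨J, S₁.label, q⟩, ⟨?_, ?_, ?_⟩, ⟨hlab, by omega, ?_, by omega, ?_, ?_, rfl⟩,
        fun _ h' => absurd h' hP⟩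
      · exact fun u w hu hw e' => hj u w ((q₅ _).1 hu) ((q₅ _).1 hw) e'
      · exact fun u hu => h₁.label u ((q₅ u).1 hu)
      · exact fun u hu => hjb u ((q₅ u).1 hu)
      · exact fun _ e' => absurd (hj _ _ ((q₅ _).1 q₃) ((q₅ _).1 q₄) e') hP
      · intro u _
        have : ¬ J (D.lab t 0) = J (D.lab t 1) := fun e' =>
          absurd (hj _ _ ((q₅ _).1 q₃) ((q₅ _).1 q₄) e') hP
        simp [introComp, e, ← hJ, this]
      · intro u _
        simp [introLabel, e]
  · obtain ⟨-, -, q₁, q₂⟩ := h.forget t ht e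
    exact easy (by omega) (by omega) (fun u hu => ((q₂ u).1 hu).2) fun _ => by
      rw [h₁.label _ q₁]; exact hℓ _ (h.lt_of_mem q₁)
  · have q₂ := (h.join t ht e).2.2
    exact easy (by omega) (by omega) (fun u hu => (q₂ u).1.1 hu) (by omega)

/-- There is a map that sends every vertex to the last vertex of its cluster. -/
theorem exists_followsParts (h : D.IsNice n Adj) (ho : D.IsOrder ord) (S : ℕ → DPState) :
    ∃ part : ℕ → ℕ, D.FollowsParts n S part ∧ ∀ v < n, D.IsLast S v → part v = v := by
  classical
  have key : ∀ d ≤ D.num, ∃ part : ℕ → ℕ, ∀ i < d, ∀ v < n, ord i = D.forgetNode v →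
      (D.IsLast S v → part v = v) ∧
      (¬ D.IsLast S v → ∃ u, D.Mem u (D.fst (D.forgetNode v)) ∧ u ≠ v ∧
        (S (D.fst (D.forgetNode v))).comp u = (S (D.fst (D.forgetNode v))).comp v ∧
        part u = part v) := by
    intro d
    induction d with
    | zero => exact fun _ => ⟨id, fun i hi => by omega⟩
    | succ d ih =>
      intro hd
      obtain ⟨part, hpart⟩ := ih (by omega)
      set t := ord d with ht
      have htN : t < D.num := ho.lt d (by omega)
      by_cases h3 : D.kind t = 3
      swap
      · refine ⟨part, fun i hi v hv e => ?_⟩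
        rcases Nat.lt_succ_iff_lt_or_eq.1 hi with hi' | rfl
        · exact hpart i hi' v hv e
        · exact absurd ((h.forgetNode_spec hv).2.1) (by rw [← e]; exact h3)
      · set v₀ := D.lab t 0 with hv₀
        have hf : D.forgetNode v₀ = t := h.forgetNode_lab htN h3
        -- Defining `part` at `v₀` does not disturb what has been achieved: `v₀` is neither a vertex
        -- treated before nor a vertex that such a vertex may follow, since it is forgotten at the
        -- later position `d`.
        have hearlier : ∀ i < d, ∀ v < n, ord i = D.forgetNode v → v ≠ v₀ ∧
            ∀ u, D.Mem u (D.fst (D.forgetNode v)) → u ≠ v → u ≠ v₀ := by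
          intro i hi v hv e
          obtain ⟨f₁, f₂, f₃⟩ := h.forgetNode_spec hv
          refine ⟨?_, ?_⟩
          · rintro rfl
            have := ho.inj i (by omega) d (by omega) (by rw [e, hf])
            omega
          · rintro u hu huv rfl
            have hm : D.Mem v₀ (D.forgetNode v) :=
              ((h.forget _ f₁ f₂).2.2.2 _).2 ⟨by rw [f₃]; exact huv, hu⟩
            obtain ⟨i', j, r₁, r₂, r₃, r₄⟩ := mem_forgotten_earlier h ho f₁ hm
            have e₁ := ho.inj _ r₂ _ (by omega) (r₃.trans e.symm)
            have e₂ := ho.inj _ (by omega) _ (by omega) (r₄.trans hf)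
            omega
        have extend : ∀ c, (D.IsLast S v₀ → c = v₀) →
            (¬ D.IsLast S v₀ → ∃ u, D.Mem u (D.fst (D.forgetNode v₀)) ∧ u ≠ v₀ ∧
              (S (D.fst (D.forgetNode v₀))).comp u = (S (D.fst (D.forgetNode v₀))).comp v₀ ∧
              part u = c) → ∃ part : ℕ → ℕ, ∀ i < d + 1, ∀ v < n, ord i = D.forgetNode v →
              (D.IsLast S v → part v = v) ∧
              (¬ D.IsLast S v → ∃ u, D.Mem u (D.fst (D.forgetNode v)) ∧ u ≠ v ∧
                (S (D.fst (D.forgetNode v))).comp u = (S (D.fst (D.forgetNode v))).comp v ∧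
                part u = part v) := by
          intro c h₁ h₂
          refine ⟨Function.update part v₀ c, fun i hi v hv e => ?_⟩
          rcases Nat.lt_succ_iff_lt_or_eq.1 hi with hi' | rfl
          · obtain ⟨q₁, q₂⟩ := hearlier i hi' v hv e
            rw [Function.update_of_ne q₁]
            refine ⟨(hpart i hi' v hv e).1, fun hl => ?_⟩
            obtain ⟨u, r₁, r₂, r₃, r₄⟩ := (hpart i hi' v hv e).2 hl
            exact ⟨u, r₁, r₂, r₃, by rw [Function.update_of_ne (q₂ u r₁ r₂)]; exact r₄⟩
          · have hvv : v = v₀ := by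
              rw [hv₀, ht, e, (h.forgetNode_spec hv).2.2]
            subst hvv
            rw [Function.update_self]
            refine ⟨h₁, fun hl => ?_⟩
            obtain ⟨u, r₁, r₂, r₃, r₄⟩ := h₂ hl
            exact ⟨u, r₁, r₂, r₃, by rw [Function.update_of_ne r₂]; exact r₄⟩
        by_cases hl : D.IsLast S v₀
        · exact extend v₀ (fun _ => rfl) (fun h' => absurd hl h')
        · have hl' := hl
          simp only [IsLast, Alone, not_forall, not_not] at hl'
          obtain ⟨u, r₁, r₂, r₃⟩ := hl'
          exact extend (part u) (fun h' => absurd h' hl) fun _ => ⟨u, r₁, r₂, r₃, rfl⟩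
  obtain ⟨part, hpart⟩ := key D.num le_rfl
  have hget : ∀ v < n, ∃ i < D.num, ord i = D.forgetNode v := fun v hv =>
    ho.exists_eq (h.forgetNode_spec hv).1
  refine ⟨part, fun v hv => ?_, fun v hv => ?_⟩
  · obtain ⟨i, hi, e⟩ := hget v hv
    exact (hpart i hi v hv e).2
  · obtain ⟨i, hi, e⟩ := hget v hv
    exact (hpart i hi v hv e).1

/-- A partition into `k` connected clusters comes from a derivation that counts `k` clusters. -/
theorem exists_derivation (h : D.IsNice n Adj) (ho : D.IsOrder ord) {b : ℕ}
    (hb : ∀ t, D.size t < b) {P ℓ : ℕ → ℕ} (hℓ : ∀ v < n, ℓ (P v) < k) (hP : ∀ v < n, P v < k)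
    (hsurj : ∀ i < k, ∃ v < n, P v = i)
    (hconn : ∀ u < n, ∀ w < n, P u = P w → ∀ R : ℕ → ℕ → Prop, Equivalence R →
      (∀ y z, Adj y z → P y = P z → R y z) → R u w) :
    ∃ S, D.Derivation k S ∧ (S D.root).count = k ∧ ∀ t < D.num, D.Respects b P ℓ t (S t) := by
  classical
  obtain ⟨S, hS₀, hS⟩ := ho.exists_bottomUp h (D.Respects b P ℓ)
    (fun t S S₁ S₂ => D.Step k t S S₁ S₂ ∧ (D.kind t = 2 → P (D.lab t 0) = P (D.lab t 1) →
        S.comp (D.lab t 0) = S.comp (D.lab t 1))) ⟨fun _ => 0, fun _ => 0, 0⟩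
    ⟨fun u _ hu => absurd hu (h.not_mem_num u), fun u hu => absurd hu (h.not_mem_num u),
      fun u hu => absurd hu (h.not_mem_num u)⟩
    (fun t ht S₁ S₂ h₁ h₂ => exists_step h hb hℓ ht h₁ h₂)
  have hder : D.Derivation k S := ⟨by rw [hS₀], fun t ht => (hS t ht).2.1⟩
  refine ⟨S, hder, ?_, fun t ht => (hS t ht).1⟩
  -- The map `ν` names each component by its last vertex.
  obtain ⟨ν, hν, hν'⟩ := exists_followsParts h ho S
  -- Edges inside clusters are all used, so their ends have the same image under `ν`, and
  -- connectedness extends this to whole clusters. Hence no cluster has two last vertices.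
  have hνP : ∀ u < n, ∀ w < n, P u = P w → ν u = ν w := by
    intro u hu w hw e
    refine hconn u hu w hw e (fun y z => ν y = ν z)
      ⟨fun _ => rfl, fun e => e.symm, fun e e' => e.trans e'⟩ ?_
    intro y z hyz e
    obtain ⟨t, ht, h2, hlab⟩ := h.edge y z hyz
    obtain ⟨-, -, -, q₁, q₂, -⟩ := h.introEdge t ht h2
    have hPe : P (D.lab t 0) = P (D.lab t 1) := by
      rcases hlab with ⟨e₁, e₂⟩ | ⟨e₁, e₂⟩ <;> rw [e₁, e₂, e]
    have := part_eq_of_comp_eq h ho hder hν t ht _ _ q₁ q₂ ((hS t ht).2.2 h2 hPe)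
    rcases hlab with ⟨e₁, e₂⟩ | ⟨e₁, e₂⟩
    · rw [e₁, e₂] at this; exact this
    · rw [e₁, e₂] at this; exact this.symm
  rw [count_root h ho hder]
  conv_rhs => rw [← Finset.card_range k]
  -- Last vertices correspond to clusters: injectivity comes from `hνP`, surjectivity from
  -- `exists_last`.
  refine Finset.card_bij (fun v _ => P v) ?_ ?_ ?_
  · intro v hv
    exact Finset.mem_range.2 (hP v (by simpa using (Finset.mem_filter.1 hv).1))
  · intro v hv w hw e
    simp only [Finset.mem_filter, Finset.mem_range] at hv hw
    have := hνP v hv.1 w hw.1 e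
    rwa [hν' v hv.1 hv.2, hν' w hw.1 hw.2] at this
  · intro i hi
    obtain ⟨v, hv, rfl⟩ := hsurj i (Finset.mem_range.1 hi)
    obtain ⟨w, q₁, q₂, -, q₃⟩ := exists_last h ho hder (R := fun u w => P u = P w)
      ⟨fun _ => rfl, fun e => e.symm, fun e e' => e.trans e'⟩
      (fun t ht h2 e => by
        obtain ⟨-, -, -, r₁, r₂, -⟩ := h.introEdge t ht h2
        exact (hS t ht).1.comp _ _ r₁ r₂ e) hν hv
    exact ⟨w, by simp [q₁, q₂], q₃.symm⟩

end TreeData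

/-! ## The tables of the input -/

namespace TreeData

/-- Every node but the root is the child of exactly one node and is reached from the root. -/
structure IsRooted (D : TreeData) : Prop where
  root_lt : D.root < D.num
  fst_le : ∀ t < D.num, D.fst t ≤ D.num
  snd_le : ∀ t < D.num, D.snd t ≤ D.num
  fst_ne_root : ∀ t < D.num, D.fst t ≠ D.root
  snd_ne_root : ∀ t < D.num, D.snd t ≠ D.root
  fst_inj : ∀ s < D.num, ∀ t < D.num, D.fst s < D.num → D.fst s = D.fst t → s = t
  snd_inj : ∀ s < D.num, ∀ t < D.num, D.snd s < D.num → D.snd s = D.snd t → s = t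
  fst_ne_snd : ∀ s < D.num, ∀ t < D.num, D.fst s < D.num → D.fst s ≠ D.snd t
  reached : ∀ P : ℕ → Prop, P D.root → (∀ t < D.num, P t →
    (D.fst t < D.num → P (D.fst t)) ∧ (D.snd t < D.num → P (D.snd t))) → ∀ t < D.num, P t

end TreeData

/-! ### Children and parents in rooted trees -/

section RootedTrees

variable {ι : Type} {T : SimpleGraph ι} {z s t t' : ι}

/-- Shortest walks to the two parents extend to shortest walks to `s`. A tree has only one path from
the root to `s`, and both parents are its penultimate vertex. -/
theorem rootedChildren_parent_unique (hT : T.IsTree) (h : s ∈ rootedChildren T z t)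
    (h' : s ∈ rootedChildren T z t') : t = t' := by
  obtain ⟨p, hp⟩ := hT.connected.exists_walk_length_eq_dist z t
  obtain ⟨p', hp'⟩ := hT.connected.exists_walk_length_eq_dist z t'
  have q : (p.concat h.1).IsPath := SimpleGraph.Walk.isPath_of_length_eq_dist _ (by
    rw [SimpleGraph.Walk.length_concat, hp, h.2])
  have q' : (p'.concat h'.1).IsPath := SimpleGraph.Walk.isPath_of_length_eq_dist _ (by
    rw [SimpleGraph.Walk.length_concat, hp', h'.2])
  have e : p.concat h.1 = p'.concat h'.1 := by
    have := (hT.isAcyclic.subsingleton_path z s).elim ⟨_, q⟩ ⟨_, q'⟩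
    exact congrArg Subtype.val this
  have := congrArg SimpleGraph.Walk.penultimate e
  simpa using this

theorem root_notMem_rootedChildren : z ∉ rootedChildren T z t := by
  rintro ⟨-, h⟩
  simp at h

/-- Induction on the distance from the root: the penultimate vertex of a shortest walk to `t` is a
parent of `t`. -/
theorem rootedChildren_reached (hT : T.IsTree) (P : ι → Prop) (hz : P z)
    (hs : ∀ t, P t → ∀ s ∈ rootedChildren T z t, P s) (t : ι) : P t := by
  have key : ∀ d t, T.dist z t = d → P t := by
    intro d
    induction d with
    | zero =>
      intro t ht
      rw [hT.connected.dist_eq_zero_iff] at ht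
      exact ht ▸ hz
    | succ d ih =>
      intro t ht
      obtain ⟨p, hp⟩ := hT.connected.exists_walk_length_eq_dist z t
      have hnil : ¬ p.Nil := by
        intro h
        have := SimpleGraph.Walk.length_eq_zero_iff.2 h
        omega
      have hadj := p.adj_penultimate hnil
      have hc := p.dropLast.length_concat hadj
      rw [SimpleGraph.Walk.concat_dropLast hadj] at hc
      have h₁ := SimpleGraph.dist_le p.dropLast
      have h₂ := hT.connected.dist_triangle (u := z) (v := p.penultimate) (w := t)
      have h₃ := SimpleGraph.dist_eq_one_iff_adj.2 hadj
      have h₄ : T.dist z p.penultimate = d := by omega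
      exact hs _ (ih _ h₄) t ⟨hadj, by omega⟩
  exact key _ t rfl

end RootedTrees

/-- The tables read off the input. -/
def RAMInput.treeData (x : RAMInput ConnSymbol) (N : ℕ) : TreeData where
  num := N
  root := x.nat ConnSymbol.root 0 0
  kind t := x.nat ConnSymbol.kind t 0
  lab t i := x.nat ConnSymbol.label t i
  fst t := if 1 ≤ x.nat ConnSymbol.numChildren t 0 then x.nat ConnSymbol.child t 0 else N
  snd t := if 2 ≤ x.nat ConnSymbol.numChildren t 0 then x.nat ConnSymbol.child t 1 else N
  size t := if t < N then x.nat ConnSymbol.bagSize t 0 else 0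
  bag t i := x.nat ConnSymbol.bag t i

/-- Adjacency of vertices given by their numbers. -/
def AdjNat {n : ℕ} (G : SimpleGraph (Fin n)) (u v : ℕ) : Prop :=
  ∃ (hu : u < n) (hv : v < n), G.Adj ⟨u, hu⟩ ⟨v, hv⟩

/-! ### The input tables describe a nice rooted tree -/

section ReadingTrees

variable {n N k : ℕ} {G : SimpleGraph (Fin n)} {d : Fin n → Fin n → ℝ}
  {D : NiceTreeDecomposition G (Fin N)} {x : RAMInput ConnSymbol}

theorem list_length_of_mem_iff_empty {α : Type} {l : List α} {A : Set α} (hA : A = ∅)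
    (hm : ∀ s, s ∈ l ↔ s ∈ A) : l = [] := by
  rw [List.eq_nil_iff_forall_not_mem]
  intro a ha
  simpa [hA] using (hm a).1 ha

theorem list_eq_of_mem_iff_singleton {α : Type} {l : List α} {A : Set α} {s : α} (hA : A = {s})
    (hl : l.Nodup) (hm : ∀ s, s ∈ l ↔ s ∈ A) : l = [s] := by
  rw [← List.perm_singleton, List.perm_ext_iff_of_nodup hl (List.nodup_singleton s)]
  intro a
  rw [hm, hA]; simp

theorem list_eq_of_mem_iff_pair {α : Type} {l : List α} {A : Set α} {s₁ s₂ : α}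
    (hA : A = {s₁, s₂}) (hs : s₁ ≠ s₂) (hl : l.Nodup) (hm : ∀ s, s ∈ l ↔ s ∈ A) :
    l = [s₁, s₂] ∨ l = [s₂, s₁] := by
  have : l.Perm [s₁, s₂] := by
    rw [List.perm_ext_iff_of_nodup hl (by simp [hs])]
    intro a
    rw [hm, hA]; simp
  rcases List.perm_pair.1 this with h | h
  · exact Or.inl h
  · exact Or.inr h

/-- The children of a node as they appear in the tables. -/
theorem EncodesConnected.children_cases (hx : EncodesConnected k G d D x) (t : Fin N) :
    (rootedChildren D.tree D.root t = ∅ ∧ (x.treeData N).fst t = N ∧ (x.treeData N).snd t = N) ∨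
    (∃ s, rootedChildren D.tree D.root t = {s} ∧ (x.treeData N).fst t = s ∧
      (x.treeData N).snd t = N) ∨
    (∃ s₁ s₂, s₁ ≠ s₂ ∧ rootedChildren D.tree D.root t = {s₁, s₂} ∧
      (x.treeData N).fst t = s₁ ∧ (x.treeData N).snd t = s₂) := by
  obtain ⟨l, h₁, h₂, h₃, h₄⟩ := hx.children t
  have empty : rootedChildren D.tree D.root t = ∅ →
      (x.treeData N).fst t = N ∧ (x.treeData N).snd t = N := by
    intro e
    have hl := list_length_of_mem_iff_empty e h₂
    simp [RAMInput.treeData, h₃, hl]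
  have single : ∀ s, rootedChildren D.tree D.root t = {s} →
      (x.treeData N).fst t = s ∧ (x.treeData N).snd t = N := by
    intro s e
    have hl := list_eq_of_mem_iff_singleton e h₁ h₂
    have := h₄ 0 (by simp [hl])
    simp [hl] at this
    simp [RAMInput.treeData, h₃, hl, this]
  have pair : ∀ s₁ s₂, l = [s₁, s₂] →
      (x.treeData N).fst t = s₁ ∧ (x.treeData N).snd t = s₂ := by
    intro s₁ s₂ hl
    have e₀ := h₄ 0 (by simp [hl])
    have e₁ := h₄ 1 (by simp [hl])
    simp [hl] at e₀ e₁
    simp [RAMInput.treeData, h₃, hl, e₀, e₁]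
  have hv := D.valid t
  revert hv
  cases D.kind t with
  | leaf => exact fun hv => Or.inl ⟨hv.1, empty hv.1⟩
  | introVertex v =>
    rintro ⟨s, e, -⟩
    exact Or.inr (Or.inl ⟨s, e, single s e⟩)
  | introEdge u v =>
    rintro ⟨-, s, e, -⟩
    exact Or.inr (Or.inl ⟨s, e, single s e⟩)
  | forget v =>
    rintro ⟨s, e, -⟩
    exact Or.inr (Or.inl ⟨s, e, single s e⟩)
  | join =>
    rintro ⟨s₁, s₂, hne, e, -⟩
    right; right
    rcases list_eq_of_mem_iff_pair e hne h₁ h₂ with hl | hl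
    · exact ⟨s₁, s₂, hne, e, pair _ _ hl⟩
    · exact ⟨s₂, s₁, hne.symm, by rw [e, Set.pair_comm], pair _ _ hl⟩

theorem EncodesConnected.isRooted (hx : EncodesConnected k G d D x) :
    (x.treeData N).IsRooted := by
  have hroot : (x.treeData N).root = D.root := hx.root 0 0
  have hfst : ∀ t : Fin N, (x.treeData N).fst t < N →
      ∃ s : Fin N, (x.treeData N).fst t = s ∧ s ∈ rootedChildren D.tree D.root t := by
    intro t ht
    rcases hx.children_cases t with ⟨-, e, -⟩ | ⟨s, e, e', -⟩ | ⟨s₁, s₂, -, e, e', -⟩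
    · omega
    · exact ⟨s, e', by simp [e]⟩
    · exact ⟨s₁, e', by simp [e]⟩
  have hsnd : ∀ t : Fin N, (x.treeData N).snd t < N →
      ∃ s : Fin N, (x.treeData N).snd t = s ∧ s ∈ rootedChildren D.tree D.root t := by
    intro t ht
    rcases hx.children_cases t with ⟨-, -, e⟩ | ⟨s, -, -, e'⟩ | ⟨s₁, s₂, -, e, -, e'⟩
    · omega
    · omega
    · exact ⟨s₂, e', by simp [e]⟩
  have hle : ∀ t : Fin N, (x.treeData N).fst t ≤ N ∧ (x.treeData N).snd t ≤ N := by
    intro t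
    rcases hx.children_cases t with ⟨-, e, e'⟩ | ⟨s, -, e, e'⟩ | ⟨s₁, s₂, -, -, e, e'⟩ <;>
      rw [e, e'] <;> constructor <;> omega
  have huniq : ∀ s t t' : Fin N, s ∈ rootedChildren D.tree D.root t →
      s ∈ rootedChildren D.tree D.root t' → t = t' := fun s t t' h h' =>
    rootedChildren_parent_unique D.isTree h h'
  refine ⟨?_, ?_, ?_, ?_, ?_, ?_, ?_, ?_, ?_⟩
  · rw [hroot]; exact D.root.2
  · exact fun t ht => (hle ⟨t, ht⟩).1
  · exact fun t ht => (hle ⟨t, ht⟩).2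
  · intro t ht e
    obtain ⟨s, h₁, h₂⟩ := hfst ⟨t, ht⟩ (by
      change (x.treeData N).fst t < N
      rw [e, hroot]; exact D.root.2)
    have : s = D.root := Fin.ext (h₁.symm.trans (e.trans hroot))
    exact root_notMem_rootedChildren (this ▸ h₂)
  · intro t ht e
    obtain ⟨s, h₁, h₂⟩ := hsnd ⟨t, ht⟩ (by
      change (x.treeData N).snd t < N
      rw [e, hroot]; exact D.root.2)
    have : s = D.root := Fin.ext (h₁.symm.trans (e.trans hroot))
    exact root_notMem_rootedChildren (this ▸ h₂)
  · intro s hs t ht hl e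
    obtain ⟨a, h₁, h₂⟩ := hfst ⟨s, hs⟩ hl
    obtain ⟨b, h₃, h₄⟩ := hfst ⟨t, ht⟩ (e ▸ hl)
    have : a = b := Fin.ext (h₁.symm.trans (e.trans h₃))
    exact congrArg Fin.val (huniq a _ _ h₂ (this ▸ h₄))
  · intro s hs t ht hl e
    obtain ⟨a, h₁, h₂⟩ := hsnd ⟨s, hs⟩ hl
    obtain ⟨b, h₃, h₄⟩ := hsnd ⟨t, ht⟩ (e ▸ hl)
    have : a = b := Fin.ext (h₁.symm.trans (e.trans h₃))
    exact congrArg Fin.val (huniq a _ _ h₂ (this ▸ h₄))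
  · intro s hs t ht hl e
    obtain ⟨a, h₁, h₂⟩ := hfst ⟨s, hs⟩ hl
    obtain ⟨b, h₃, h₄⟩ := hsnd ⟨t, ht⟩ (e ▸ hl)
    have hab : a = b := Fin.ext (h₁.symm.trans (e.trans h₃))
    have hst := congrArg Fin.val (huniq a _ _ h₂ (hab ▸ h₄))
    simp only at hst
    subst hst
    rcases hx.children_cases ⟨s, hs⟩ with ⟨-, -, e'⟩ | ⟨s', -, -, e'⟩ | ⟨s₁, s₂, hne, -, e', e''⟩
    · simp only at h₃ e'; omega
    · simp only at h₃ e'; omega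
    · exact hne (Fin.ext (e'.symm.trans (e.trans e'')))
  · intro P hP hs t ht
    refine rootedChildren_reached D.isTree (z := D.root) (fun t : Fin N => P t) (hroot ▸ hP) ?_ ⟨t, ht⟩
    intro t ht s hst
    obtain ⟨q₁, q₂⟩ := hs t t.2 ht
    rcases hx.children_cases t with ⟨e, -, -⟩ | ⟨s', e, e', -⟩ | ⟨s₁, s₂, -, e, e', e''⟩
    · simp [e] at hst
    · obtain rfl : s = s' := by simpa [e] using hst
      rw [e'] at q₁; exact q₁ s.2
    · have : s = s₁ ∨ s = s₂ := by simpa [e] using hst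
      rcases this with rfl | rfl
      · rw [e'] at q₁; exact q₁ s.2
      · rw [e''] at q₂; exact q₂ s.2

theorem EncodesConnected.mem_iff (hx : EncodesConnected k G d D x) (t : Fin N) (u : ℕ) :
    (x.treeData N).Mem u t ↔ ∃ h : u < n, (⟨u, h⟩ : Fin n) ∈ D.bag t := by
  obtain ⟨l, h₁, h₂, h₃, h₄⟩ := hx.bag t
  constructor
  · rintro ⟨i, hi, rfl⟩
    have hi' : i < l.length := by simpa [RAMInput.treeData, h₃] using hi
    have e : (x.treeData N).bag t i = l[i] := h₄ i hi'
    refine ⟨e ▸ (l[i]).2, ?_⟩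
    rw [← h₂]
    have : (⟨(x.treeData N).bag t i, e ▸ (l[i]).2⟩ : Fin n) = l[i] := Fin.ext e
    rw [this]
    exact List.getElem_mem hi'
  · rintro ⟨h, hm⟩
    rw [← h₂] at hm
    obtain ⟨i, hi, e⟩ := List.getElem_of_mem hm
    refine ⟨i, by simpa [RAMInput.treeData, h₃] using hi, ?_⟩
    have : (x.treeData N).bag t i = l[i] := h₄ i hi
    rw [this, e]

theorem EncodesConnected.size_eq (hx : EncodesConnected k G d D x) (t : Fin N) :
    (x.treeData N).size t = (D.bag t).card := by
  classical
  obtain ⟨l, h₁, h₂, h₃, h₄⟩ := hx.bag t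
  have : l.toFinset = D.bag t := by ext; simp [h₂]
  rw [← this, List.toFinset_card_of_nodup h₁, ← h₃]
  simp [RAMInput.treeData]

/-- Passes from the typed decomposition to tables of numbers. What the dynamic program needs are the
local rules for bags, the empty bag of the root, and that vertices are forgotten once and all edges
are introduced. -/
theorem EncodesConnected.isNice (hx : EncodesConnected k G d D x) :
    (x.treeData N).IsNice n (AdjNat G) := by
  have hroot : (x.treeData N).root = D.root := hx.root 0 0
  have hkind : ∀ t : Fin N, (x.treeData N).kind t = (D.kind t).code := hx.kind
  have hlab₁ : ∀ t : Fin N, ∀ v, (D.kind t).labels = [v] → (x.treeData N).lab t 0 = v := by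
    intro t v e
    have := hx.label t 0 (by simp [e])
    simp only [e] at this
    exact this
  have hlab₂ : ∀ t : Fin N, ∀ u v, (D.kind t).labels = [u, v] →
      (x.treeData N).lab t 0 = u ∧ (x.treeData N).lab t 1 = v := by
    intro t u v e
    have e₀ := hx.label t 0 (by simp [e])
    have e₁ := hx.label t 1 (by simp [e])
    simp only [e] at e₀ e₁
    exact ⟨e₀, e₁⟩
  have hsingle : ∀ (t s : Fin N), rootedChildren D.tree D.root t = {s} →
      (x.treeData N).fst t = s ∧ (x.treeData N).snd t = N := by
    intro t s e
    rcases hx.children_cases t with ⟨e', -, -⟩ | ⟨s', e', h₁, h₂⟩ | ⟨s₁, s₂, hne, e', -, -⟩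
    · rw [e'] at e
      exact absurd e.symm (Set.singleton_ne_empty s)
    · rw [e', Set.singleton_eq_singleton_iff] at e
      exact ⟨e ▸ h₁, h₂⟩
    · exfalso
      rw [e'] at e
      have q₁ : s₁ ∈ ({s} : Set (Fin N)) := by rw [← e]; simp
      have q₂ : s₂ ∈ ({s} : Set (Fin N)) := by rw [← e]; simp
      exact hne (q₁.trans q₂.symm)
  have hmem := hx.mem_iff
  have hvmem : ∀ (v : Fin n) (t : Fin N), (x.treeData N).Mem v t ↔ v ∈ D.bag t := by
    intro v t
    rw [hmem]
    exact ⟨fun ⟨_, h⟩ => h, fun h => ⟨v.2, h⟩⟩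
  refine ⟨?_, ?_, ?_, ?_, ?_, ?_, ?_, ?_, ?_, ?_, ?_, ?_, ?_, ?_⟩
  · simp [RAMInput.treeData]
  · intro t i hi
    by_cases ht : t < N
    · exact ((hmem ⟨t, ht⟩ _).1 ⟨i, hi, rfl⟩).1
    · simp [RAMInput.treeData, ht] at hi
  · intro t i j hi hj e
    by_cases ht : t < N
    · obtain ⟨l, h₁, h₂, h₃, h₄⟩ := hx.bag ⟨t, ht⟩
      have hi' : i < l.length := by simpa [RAMInput.treeData, ht, h₃] using hi
      have hj' : j < l.length := by simpa [RAMInput.treeData, ht, h₃] using hj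
      have e₁ := h₄ i hi'
      have e₂ := h₄ j hj'
      have : l[i] = l[j] := Fin.ext (e₁.symm.trans (e.trans e₂))
      exact (h₁.getElem_inj_iff).1 this
    · simp [RAMInput.treeData, ht] at hi
  · intro t ht
    have := hkind ⟨t, ht⟩
    simp only at this
    rw [this]
    cases D.kind ⟨t, ht⟩ <;> simp [NodeKind.code]
  · intro t ht e
    have hk := hkind ⟨t, ht⟩
    have hv := D.valid ⟨t, ht⟩
    have hsz := hx.size_eq ⟨t, ht⟩
    simp only at hk hsz
    rw [hk] at e
    revert hv e
    cases D.kind ⟨t, ht⟩ <;> simp only [NodeKind.code, NodeKind.Valid] <;> try omega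
    rintro - ⟨h₁, h₂⟩
    rw [h₂, Finset.card_empty] at hsz
    rcases hx.children_cases ⟨t, ht⟩ with ⟨-, q₁, q₂⟩ | ⟨s, q, -, -⟩ | ⟨s₁, s₂, -, q, -, -⟩
    · exact ⟨q₁, q₂, hsz⟩
    · rw [h₁] at q; exact absurd q.symm (Set.singleton_ne_empty s)
    · rw [h₁] at q; exact absurd q.symm (Set.insert_nonempty _ _).ne_empty
  · intro t ht e
    have hk := hkind ⟨t, ht⟩
    have hv := D.valid ⟨t, ht⟩
    have hl := hlab₁ ⟨t, ht⟩
    simp only at hk hl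
    rw [hk] at e
    revert hv e hl
    cases D.kind ⟨t, ht⟩ <;> simp only [NodeKind.code, NodeKind.Valid] <;> try omega
    rename_i v
    rintro - ⟨s, h₁, h₂, h₃⟩ hl
    have hlv := hl v rfl
    obtain ⟨q₁, q₂⟩ := hsingle _ s h₁
    simp only at q₁ q₂
    rw [q₁, q₂, hlv]
    refine ⟨s.2, rfl, ?_, fun u => ?_⟩
    · rw [hvmem]; exact h₂
    · have := hmem ⟨t, ht⟩ u
      simp only at this
      rw [this, hmem, h₃]
      simp only [Finset.mem_insert, Fin.ext_iff]
      constructor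
      · rintro ⟨h, h' | h'⟩
        · exact Or.inl h'
        · exact Or.inr ⟨h, h'⟩
      · rintro (rfl | ⟨h, h'⟩)
        · exact ⟨v.2, Or.inl rfl⟩
        · exact ⟨h, Or.inr h'⟩
  · intro t ht e
    have hk := hkind ⟨t, ht⟩
    have hv := D.valid ⟨t, ht⟩
    have hl := hlab₂ ⟨t, ht⟩
    simp only at hk hl
    rw [hk] at e
    revert hv e hl
    cases D.kind ⟨t, ht⟩ <;> simp only [NodeKind.code, NodeKind.Valid] <;> try omega
    rename_i u v
    rintro - ⟨hadj, s, h₁, h₂, h₃, h₄⟩ hl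
    obtain ⟨hlu, hlv⟩ := hl u v rfl
    obtain ⟨q₁, q₂⟩ := hsingle _ s h₁
    simp only at q₁ q₂
    have hm := hvmem
    rw [q₁, q₂, hlu, hlv]
    refine ⟨s.2, rfl, ⟨u.2, v.2, hadj⟩, (hm u ⟨t, ht⟩).2 h₃, (hm v ⟨t, ht⟩).2 h₄, fun w => ?_⟩
    have := hmem ⟨t, ht⟩ w
    simp only at this
    rw [this, hmem, h₂]
  · intro t ht e
    have hk := hkind ⟨t, ht⟩
    have hv := D.valid ⟨t, ht⟩
    have hl := hlab₁ ⟨t, ht⟩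
    simp only at hk hl
    rw [hk] at e
    revert hv e hl
    cases D.kind ⟨t, ht⟩ <;> simp only [NodeKind.code, NodeKind.Valid] <;> try omega
    rename_i v
    rintro - ⟨s, h₁, h₂, h₃⟩ hl
    have hlv := hl v rfl
    obtain ⟨q₁, q₂⟩ := hsingle _ s h₁
    simp only at q₁ q₂
    rw [q₁, q₂, hlv]
    refine ⟨s.2, rfl, (hvmem v s).2 h₂, fun u => ?_⟩
    have := hmem ⟨t, ht⟩ u
    simp only at this
    rw [this, hmem, h₃]
    simp only [Finset.mem_erase, ne_eq, Fin.ext_iff]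
    constructor
    · rintro ⟨h, h', h''⟩
      exact ⟨h', h, h''⟩
    · rintro ⟨h', h, h''⟩
      exact ⟨h, h', h''⟩
  · intro t ht e
    have hk := hkind ⟨t, ht⟩
    have hv := D.valid ⟨t, ht⟩
    simp only at hk
    rw [hk] at e
    revert hv e
    cases D.kind ⟨t, ht⟩ <;> simp only [NodeKind.code, NodeKind.Valid] <;> try omega
    rintro - ⟨s₁, s₂, hne, h₁, h₂, h₃⟩
    have hc : ∀ s ∈ rootedChildren D.tree D.root ⟨t, ht⟩, D.bag s = D.bag ⟨t, ht⟩ := by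
      rw [h₁]
      rintro s (rfl | rfl)
      · exact h₂
      · exact h₃
    rcases hx.children_cases ⟨t, ht⟩ with ⟨q, -, -⟩ | ⟨s, q, -, -⟩ | ⟨a, b, -, q, q₁, q₂⟩
    · rw [h₁] at q; exact absurd q (Set.insert_nonempty _ _).ne_empty
    · exfalso
      rw [h₁] at q
      have r₁ : s₁ ∈ ({s} : Set (Fin N)) := by rw [← q]; simp
      have r₂ : s₂ ∈ ({s} : Set (Fin N)) := by rw [← q]; simp
      exact hne (r₁.trans r₂.symm)
    · simp only at q₁ q₂
      rw [q₁, q₂]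
      refine ⟨a.2, b.2, fun u => ?_⟩
      have := hmem ⟨t, ht⟩ u
      simp only at this
      rw [this, hmem, hmem, hc a (by simp [q]), hc b (by simp [q])]
      exact ⟨Iff.rfl, Iff.rfl⟩
  · rw [hroot]; exact D.root.2
  · rw [hroot, hx.size_eq, D.root_bag, Finset.card_empty]
  · intro v hv
    obtain ⟨t, ht, -⟩ := D.forget_once ⟨v, hv⟩
    exact ⟨t, t.2, by rw [hkind, ht]; rfl, by rw [hlab₁ t ⟨v, hv⟩ (by rw [ht]; rfl)]⟩
  · have hforget : ∀ t : Fin N, (x.treeData N).kind t = 3 →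
        ∃ v : Fin n, D.kind t = NodeKind.forget v ∧ (x.treeData N).lab t 0 = v := by
      intro t e
      rw [hkind] at e
      have hl := hlab₁ t
      revert e hl
      cases D.kind t <;> simp only [NodeKind.code] <;> try omega
      rename_i v
      exact fun _ hl => ⟨v, rfl, hl v rfl⟩
    intro s hs t ht es et e
    obtain ⟨v, h₁, h₂⟩ := hforget ⟨s, hs⟩ es
    obtain ⟨w, h₃, h₄⟩ := hforget ⟨t, ht⟩ et
    obtain rfl : v = w := Fin.ext (h₂.symm.trans (e.trans h₄))
    exact congrArg Fin.val ((D.forget_once v).unique h₁ h₃)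
  · rintro u v ⟨hu, hv, hadj⟩
    obtain ⟨t, ht, -⟩ := D.edge_once _ _ hadj
    refine ⟨t, t.2, ?_, ?_⟩
    · rw [hkind]; rcases ht with e | e <;> rw [e] <;> rfl
    · rcases ht with e | e
      · exact Or.inl (hlab₂ t _ _ (by rw [e]; rfl))
      · exact Or.inr (hlab₂ t _ _ (by rw [e]; rfl))

end ReadingTrees

/-! ## The program

Arrays of naturals: `0` centers, `1` clusters, `10` bag sizes, `11`, `12` children, `13` largest
bag size, `14` base of the codes, `15` number of codes, `16` digits of the codes, `17` order of the
nodes, `18` length of the queue, `19` current node, `20`–`26` counters, `30` reachable states,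
`31`, `32` states of the children, `40`–`47` states under inspection, `50` best state of the root,
`51` chosen states, `52` number of clusters, `53` labels of the clusters, from `100` on the memory
of the algorithm for unconstrained `k`-means. Arrays of reals: `0` costs of states, `1` scratch. -/

namespace ConnectedKMeans

open RAMProgram NatExp TestExp

abbrev Code := RAMProgram ConnSymbol

abbrev Index := NatExp ConnSymbol

abbrev zero : Index := const 0

abbrev one : Index := const 1

/-- Cell `(i, 0)` of array `a`. -/
abbrev entry (a : ℕ) (i : Index) : Index := read a i zero

abbrev numNodes : Index := input ConnSymbol.numNodes zero zero

abbrev numClusters : Index := input ConnSymbol.numClusters zero zero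

abbrev natEq (e f : Index) : TestExp ConnSymbol := and (natLe e f) (natLe f e)

/-- Set cell `(0, 0)` of array `a`. -/
abbrev assign (a : ℕ) (e : Index) : Code := setNat a zero zero e

def readTree : Code :=
  forLoop 20 numNodes
    (seq (setNat 10 (cell 20) zero (input ConnSymbol.bagSize (cell 20) zero))
    (seq (ite (natLe one (input ConnSymbol.numChildren (cell 20) zero))
      (setNat 11 (cell 20) zero (input ConnSymbol.child (cell 20) zero))
      (setNat 11 (cell 20) zero numNodes))
    (seq (ite (natLe (const 2) (input ConnSymbol.numChildren (cell 20) zero))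
      (setNat 12 (cell 20) zero (input ConnSymbol.child (cell 20) one))
      (setNat 12 (cell 20) zero numNodes))
    (ite (natLe (cell 13) (input ConnSymbol.bagSize (cell 20) zero))
      (assign 13 (input ConnSymbol.bagSize (cell 20) zero))
      (assign 13 (cell 13))))))

def copyRow : Code :=
  forLoop 23 (cell 20) (setNat 16 (cell 25) (cell 23) (read 16 (cell 22) (cell 23)))

def extendRow : Code :=
  seq copyRow (seq (setNat 16 (cell 25) (cell 20) (cell 21)) (assign 25 (add (cell 25) one)))

def extendRows : Code := forLoop 22 (cell 24) extendRow

/-- Vectors with one more digit are listed in blocks as long as the old list: block `c` consists of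
the old vectors with `c` appended. Block `0` extends the old list in place. -/
def extendCodes : Code :=
  seq (assign 24 (cell 15)) (seq (assign 25 zero)
    (seq (forLoop 21 (cell 14) extendRows) (assign 15 (cell 25))))

/-- A code has one digit for the colour and one for the label of each place in a bag, and one for
the count. For positive `m` and `k` the base `m + k` exceeds all bag sizes, all labels and the final
count `k`. -/
def makeCodes : Code :=
  seq (assign 14 (add (cell 13) numClusters)) (seq (assign 15 one)
    (forLoop 20 (add (add (cell 13) (cell 13)) one) extendCodes))

/-- Append the child of the current node given by array `a` to the queue. -/
def enqueue (a : ℕ) : Code :=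
  ite (natLe (add (entry a (cell 19)) one) numNodes)
    (seq (setNat 17 (cell 18) zero (entry a (cell 19))) (assign 18 (add (cell 18) one)))
    skip

/-- Breadth-first search: array `17` is the queue and in the end lists all nodes. -/
def orderNodes : Code :=
  seq (setNat 17 zero zero (input ConnSymbol.root zero zero)) (seq (assign 18 one)
    (forLoop 20 numNodes
      (seq (assign 19 (entry 17 (cell 20))) (seq (enqueue 11) (enqueue 12)))))

end ConnectedKMeans

namespace Runs

variable {S : Type} {x : RAMInput S} {X M : ℕ} {σ : RAMStore} {Q : RAMStore → Prop}

open Classical in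
-- Describes the outcome of a branch as one store with a conditional value. To make it applicable,
-- programs assign a cell to itself where they could do nothing.
theorem iteSetNat {b : TestExp S} {a : ℕ} {i j e f : NatExp S} (hM : 1 ≤ M)
    (h : Q (σ.setNat a (i.eval x σ) (j.eval x σ)
      (if b.holds x σ then e.eval x σ else f.eval x σ))) :
    Runs x X M (RAMProgram.ite b (RAMProgram.setNat a i j e) (RAMProgram.setNat a i j f)) σ Q := by
  refine Runs.ite hM (fun hb => Runs.setNat hM ?_) (fun hb => Runs.setNat hM ?_)
  · rwa [if_pos hb] at h
  · rwa [if_neg hb] at h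

end Runs

namespace ConnectedKMeans

open RAMProgram

variable {x : RAMInput ConnSymbol} {X M N : ℕ} {σ : RAMStore}

theorem runs_readTree (hN : ∀ i j, x.nat ConnSymbol.numNodes i j = N) (hM : N < M)
    (h0 : σ.nat 13 0 0 = 0) :
    Runs x X M readTree σ fun τ =>
      (∀ t < N, τ.nat 10 t 0 = (x.treeData N).size t ∧ τ.nat 11 t 0 = (x.treeData N).fst t ∧
        τ.nat 12 t 0 = (x.treeData N).snd t) ∧
      (∀ t, N ≤ t → τ.nat 10 t 0 = σ.nat 10 t 0) ∧
      (∀ t < N, (x.treeData N).size t ≤ τ.nat 13 0 0) ∧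
      (τ.nat 13 0 0 = 0 ∨ ∃ t < N, τ.nat 13 0 0 = (x.treeData N).size t) := by
  refine Runs.forLoop_large (fun j τ =>
      (∀ t < j, τ.nat 10 t 0 = (x.treeData N).size t ∧ τ.nat 11 t 0 = (x.treeData N).fst t ∧
        τ.nat 12 t 0 = (x.treeData N).snd t) ∧
      (∀ t, j ≤ t → τ.nat 10 t 0 = σ.nat 10 t 0) ∧
      (∀ t < j, (x.treeData N).size t ≤ τ.nat 13 0 0) ∧
      (τ.nat 13 0 0 = 0 ∨ ∃ t < j, τ.nat 13 0 0 = (x.treeData N).size t)) N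
    (by simp [NatExp.eval, hN]) hM (by decide) ⟨by simp, by simp, by simp, Or.inl h0⟩ ?_ ?_ ?_
  · intro j τ τ' h _ hI
    simpa only [h 10 (by decide), h 11 (by decide), h 12 (by decide), h 13 (by decide)] using hI
  · intro j hj τ _ hc hI
    obtain ⟨h₁, h₂, h₃, h₄⟩ := hI
    have hs : (x.treeData N).size j = x.nat ConnSymbol.bagSize j 0 := by
      simp [RAMInput.treeData, hj]
    refine Runs.seq (Runs.setNat le_rfl (Runs.seq (Runs.iteSetNat le_rfl
      (Runs.seq (Runs.iteSetNat le_rfl (Runs.iteSetNat le_rfl ?_))))))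
    simp only [NatExp.eval, TestExp.holds, RAMStore.setNat_nat, hc, hN]
    refine ⟨?_, ?_, ?_, ?_⟩
    · intro t ht
      rcases Nat.lt_succ_iff_lt_or_eq.1 ht with h | rfl
      · have := h₁ t h
        simpa [h.ne] using this
      · simp [RAMInput.treeData, hj]
    · intro t ht
      have : t ≠ j := by omega
      simpa [this] using h₂ t (by omega)
    · intro t ht
      simp only [Nat.reduceEqDiff, false_and, if_false, and_self, if_true]
      rcases Nat.lt_succ_iff_lt_or_eq.1 ht with h | rfl
      · have := h₃ t h
        split_ifs <;> omega
      · rw [hs]; split_ifs <;> omega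
    · simp only [Nat.reduceEqDiff, false_and, if_false, and_self, if_true]
      split_ifs with h
      · exact Or.inr ⟨j, by omega, hs.symm⟩
      · rcases h₄ with h₄ | ⟨t, ht, h₄⟩
        · exact Or.inl h₄
        · exact Or.inr ⟨t, by omega, h₄⟩
  · exact fun τ _ h => h

end ConnectedKMeans

namespace ConnectedKMeans

open RAMProgram

variable {x : RAMInput ConnSymbol} {X M N : ℕ} {σ : RAMStore}

/-! ### The table of digits -/

theorem runs_copyRow {l q s : ℕ} (hl : σ.nat 20 0 0 = l) (hq : σ.nat 22 0 0 = q)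
    (hs : σ.nat 25 0 0 = s) (hM : 1 ≤ M) (hX : l ≤ X) :
    Runs x X M copyRow σ fun τ => (∀ i < l, τ.nat 16 s i = σ.nat 16 q i) ∧
      ∀ e i, e ≠ s → τ.nat 16 e i = σ.nat 16 e i := by
  refine Runs.forLoop (fun j τ => (∀ i < j, τ.nat 16 s i = σ.nat 16 q i) ∧
    (∀ i, j ≤ i → τ.nat 16 s i = σ.nat 16 s i) ∧
      ∀ e i, e ≠ s → τ.nat 16 e i = σ.nat 16 e i) l (by simp [NatExp.eval, hl]) hM hX (by decide)
    ⟨by simp, by simp, by simp⟩ ?_ ?_ ?_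
  · intro j τ τ' h _ hI
    simpa only [h 16 (by decide)] using hI
  · intro j hj τ hf hc ⟨h₁, h₂, h₃⟩
    have e22 : τ.nat 22 0 0 = q := by rw [hf.1 22 (by decide), hq]
    have e25 : τ.nat 25 0 0 = s := by rw [hf.1 25 (by decide), hs]
    refine Runs.setNat hM ?_
    simp only [NatExp.eval, RAMStore.setNat_nat, hc, e22, e25, true_and]
    -- If source and target are the same row, entry `j` has not been touched yet; otherwise row `q`
    -- is never touched.
    have key : τ.nat 16 q j = σ.nat 16 q j := by
      by_cases h : q = s
      · rw [h]; exact h₂ j le_rfl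
      · exact h₃ q j h
    refine ⟨fun i hi => ?_, fun i hi => ?_, fun e i he => ?_⟩
    · rcases Nat.lt_succ_iff_lt_or_eq.1 hi with h | rfl
      · simpa [h.ne] using h₁ i h
      · simpa using key
    · have : i ≠ j := by omega
      simpa [this] using h₂ i (by omega)
    · simpa [he] using h₃ e i he
  · exact fun τ _ h => ⟨h.1, h.2.2⟩

theorem runs_extendRow {l q s c : ℕ} (hl : σ.nat 20 0 0 = l) (hq : σ.nat 22 0 0 = q)
    (hs : σ.nat 25 0 0 = s) (hc : σ.nat 21 0 0 = c) (hM : 1 ≤ M) (hX : l ≤ X) :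
    Runs x X M extendRow σ fun τ => τ.nat 25 0 0 = s + 1 ∧
      (∀ i < l, τ.nat 16 s i = σ.nat 16 q i) ∧ τ.nat 16 s l = c ∧
      ∀ e i, e ≠ s → τ.nat 16 e i = σ.nat 16 e i := by
  refine Runs.seq ((runs_copyRow hl hq hs hM hX).frame fun τ hf ⟨h₁, h₂⟩ => ?_)
  have e20 : τ.nat 20 0 0 = l := by rw [hf.1 20 (by decide), hl]
  have e21 : τ.nat 21 0 0 = c := by rw [hf.1 21 (by decide), hc]
  have e25 : τ.nat 25 0 0 = s := by rw [hf.1 25 (by decide), hs]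
  refine Runs.seq (Runs.setNat hM (Runs.setNat hM ?_))
  simp only [NatExp.eval, RAMStore.setNat_nat, e20, e21, e25]
  refine ⟨by simp, fun i hi => ?_, by simp, fun e i he => ?_⟩
  · simpa [hi.ne] using h₁ i hi
  · simpa [he] using h₂ e i he

/-- By `hsE` the target block either is the source block or starts behind it, so that no digit is
overwritten before it is copied. -/
theorem runs_extendRows {l s c E₀ : ℕ} (hl : σ.nat 20 0 0 = l) (hE : σ.nat 24 0 0 = E₀)
    (hs : σ.nat 25 0 0 = s) (hc : σ.nat 21 0 0 = c) (hsE : s = 0 ∨ E₀ ≤ s) (hM : 1 ≤ M)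
    (hX : l ≤ X) (hX' : E₀ ≤ X) :
    Runs x X M extendRows σ fun τ => τ.nat 25 0 0 = s + E₀ ∧
      (∀ q < E₀, (∀ i < l, τ.nat 16 (s + q) i = σ.nat 16 q i) ∧ τ.nat 16 (s + q) l = c) ∧
      ∀ e i, e < s → τ.nat 16 e i = σ.nat 16 e i := by
  refine Runs.forLoop (fun j τ => τ.nat 25 0 0 = s + j ∧
      (∀ q < j, (∀ i < l, τ.nat 16 (s + q) i = σ.nat 16 q i) ∧ τ.nat 16 (s + q) l = c) ∧
      ∀ e i, (e < s ∨ s + j ≤ e) → τ.nat 16 e i = σ.nat 16 e i) E₀ (by simp [NatExp.eval, hE]) hM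
    hX' (by decide) ⟨by simp [hs], by simp, by simp⟩ ?_ ?_ ?_
  · intro j τ τ' h _ hI
    simpa only [h 16 (by decide), h 25 (by decide)] using hI
  · intro j hj τ hf hcj ⟨h₁, h₂, h₃⟩
    have e20 : τ.nat 20 0 0 = l := by rw [hf.1 20 (by decide), hl]
    have e21 : τ.nat 21 0 0 = c := by rw [hf.1 21 (by decide), hc]
    refine (runs_extendRow e20 hcj h₁ e21 hM hX).weaken fun υ ⟨q₁, q₂, q₃, q₄⟩ => ?_
    refine ⟨by omega, fun q hq => ?_, fun e i he => ?_⟩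
    · rcases Nat.lt_succ_iff_lt_or_eq.1 hq with h | rfl
      · obtain ⟨r₁, r₂⟩ := h₂ q h
        refine ⟨fun i hi => ?_, ?_⟩
        · rw [q₄ _ _ (by omega), r₁ i hi]
        · rw [q₄ _ _ (by omega), r₂]
      · refine ⟨fun i hi => ?_, q₃⟩
        rw [q₂ i hi, h₃ q i (by omega)]
    · rw [q₄ _ _ (by omega), h₃ e i (by omega)]
  · exact fun τ _ ⟨h₁, h₂, h₃⟩ => ⟨h₁, h₂, fun e i he => h₃ e i (Or.inl he)⟩

theorem runs_extendCodes {l E₀ b : ℕ} (hl : σ.nat 20 0 0 = l) (hE : σ.nat 15 0 0 = E₀)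
    (hb : σ.nat 14 0 0 = b) (hM : 1 ≤ M) (hX : l ≤ X) (hX' : E₀ ≤ X) (hX'' : b ≤ X) :
    Runs x X M extendCodes σ fun τ => τ.nat 15 0 0 = b * E₀ ∧
      ∀ c < b, ∀ q < E₀, (∀ i < l, τ.nat 16 (c * E₀ + q) i = σ.nat 16 q i) ∧
        τ.nat 16 (c * E₀ + q) l = c := by
  refine Runs.seq (Runs.setNat hM (Runs.seq (Runs.setNat hM (Runs.seq ?_))))
  simp only [NatExp.eval, hE]
  set σ' := (σ.setNat 24 0 0 E₀).setNat 25 0 0 0 with hσ'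
  have f16 : ∀ e i, σ'.nat 16 e i = σ.nat 16 e i := by simp [hσ']
  have f14 : σ'.nat 14 0 0 = b := by simp [hσ', hb]
  have f20 : σ'.nat 20 0 0 = l := by simp [hσ', hl]
  have f24 : σ'.nat 24 0 0 = E₀ := by simp [hσ']
  refine Runs.forLoop (fun j τ => τ.nat 25 0 0 = j * E₀ ∧
      (∀ c < j, ∀ q < E₀, (∀ i < l, τ.nat 16 (c * E₀ + q) i = σ.nat 16 q i) ∧
        τ.nat 16 (c * E₀ + q) l = c) ∧ (j = 0 → ∀ e i, τ.nat 16 e i = σ.nat 16 e i)) b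
    (by simp [NatExp.eval, f14]) hM hX'' (by decide) ⟨by simp [hσ'], by simp, fun _ => f16⟩ ?_ ?_ ?_
  · intro j τ τ' h _ hI
    simpa only [h 16 (by decide), h 25 (by decide)] using hI
  · intro j hj τ hf hcj ⟨h₁, h₂, h₃⟩
    have e20 : τ.nat 20 0 0 = l := by rw [hf.1 20 (by decide), f20]
    have e24 : τ.nat 24 0 0 = E₀ := by rw [hf.1 24 (by decide), f24]
    have hjE : j * E₀ = 0 ∨ E₀ ≤ j * E₀ := by
      rcases Nat.eq_zero_or_pos j with rfl | hp
      · simp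
      · exact Or.inr (Nat.le_mul_of_pos_left _ hp)
    refine (runs_extendRows e20 e24 h₁ hcj hjE hM hX hX').weaken fun υ ⟨q₁, q₂, q₃⟩ => ?_
    have src : ∀ q < E₀, ∀ i < l, τ.nat 16 q i = σ.nat 16 q i := by
      intro q hq i hi
      rcases Nat.eq_zero_or_pos j with h0 | hp
      · exact h₃ h0 q i
      · simpa using (h₂ 0 hp q hq).1 i hi
    refine ⟨by rw [q₁, Nat.succ_mul], fun c hc q hq => ?_, by omega⟩
    rcases Nat.lt_succ_iff_lt_or_eq.1 hc with h | rfl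
    · obtain ⟨r₁, r₂⟩ := h₂ c h q hq
      have hlt : c * E₀ + q < j * E₀ := by
        have : (c + 1) * E₀ ≤ j * E₀ := Nat.mul_le_mul_right _ h
        rw [Nat.succ_mul] at this
        omega
      refine ⟨fun i hi => ?_, ?_⟩
      · rw [q₃ _ _ hlt, r₁ i hi]
      · rw [q₃ _ _ hlt, r₂]
    · obtain ⟨r₁, r₂⟩ := q₂ q hq
      exact ⟨fun i hi => by rw [r₁ i hi, src q hq i hi], r₂⟩
  · intro τ hf ⟨h₁, h₂, _⟩
    refine Runs.setNat hM ?_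
    refine ⟨by simp [NatExp.eval, h₁], fun c hc q hq => ?_⟩
    simpa using h₂ c hc q hq

/-- The rows below `E` of `dec` are all vectors of `l` digits below `b`; row `0` is zero. -/
structure IsCodeTable (b l E : ℕ) (dec : ℕ → ℕ → ℕ) : Prop where
  surj : ∀ f : ℕ → ℕ, (∀ j < l, f j < b) → ∃ e < E, ∀ j < l, dec e j = f j
  zero : ∀ j < l, dec 0 j = 0

theorem runs_makeCodes {m k b : ℕ} (hk : ∀ i j, x.nat ConnSymbol.numClusters i j = k)
    (hm : σ.nat 13 0 0 = m) (hb : b = m + k) (hb1 : 1 ≤ b) (hM : 1 ≤ M) (hbX : b ≤ X)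
    (hlX : 2 * m + 1 ≤ X) (hEX : b ^ (2 * m + 1) ≤ X) :
    Runs x X M makeCodes σ fun τ => τ.nat 15 0 0 = b ^ (2 * m + 1) ∧
      IsCodeTable b (2 * m + 1) (b ^ (2 * m + 1)) (τ.nat 16) := by
  refine Runs.seq (Runs.setNat hM (Runs.seq (Runs.setNat hM ?_)))
  simp only [NatExp.eval, hm, hk, ← hb]
  set σ' := (σ.setNat 14 0 0 b).setNat 15 0 0 1 with hσ'
  have f13 : σ'.nat 13 0 0 = m := by simp [hσ', hm]
  have f14 : σ'.nat 14 0 0 = b := by simp [hσ']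
  have f15 : σ'.nat 15 0 0 = 1 := by simp [hσ']
  refine Runs.forLoop (fun j τ => τ.nat 15 0 0 = b ^ j ∧ IsCodeTable b j (b ^ j) (τ.nat 16))
    (2 * m + 1) (by simp [NatExp.eval, f13]; omega) hM hlX (by decide)
    ⟨by simp [f15], ⟨fun f _ => ⟨0, by simp, by simp⟩, by simp⟩⟩ ?_ ?_ ?_
  · intro j τ τ' h _ hI
    simpa only [h 16 (by decide), h 15 (by decide)] using hI
  · intro j hj τ hf hcj ⟨h₁, h₂⟩
    have e14 : τ.nat 14 0 0 = b := by rw [hf.1 14 (by decide), f14]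
    have hpow : b ^ j ≤ X := (Nat.pow_le_pow_right hb1 hj.le).trans hEX
    refine (runs_extendCodes hcj h₁ e14 hM (by omega) hpow hbX).weaken fun υ ⟨q₁, q₂⟩ => ?_
    refine ⟨by rw [q₁, Nat.pow_succ'], ⟨fun f hfb => ?_, fun i hi => ?_⟩⟩
    · obtain ⟨q, hq, hq'⟩ := h₂.surj f fun i hi => hfb i (by omega)
      obtain ⟨r₁, r₂⟩ := q₂ (f j) (hfb j (by omega)) q hq
      -- The new digit selects the block, and `q` is the code of the first `j` digits.
      refine ⟨f j * b ^ j + q, ?_, fun i hi => ?_⟩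
      · have : (f j + 1) * b ^ j ≤ b * b ^ j := Nat.mul_le_mul_right _ (hfb j (by omega))
        rw [Nat.succ_mul] at this
        rw [Nat.pow_succ']
        omega
      · rcases Nat.lt_succ_iff_lt_or_eq.1 hi with h | rfl
        · rw [r₁ i h, hq' i h]
        · exact r₂
    · obtain ⟨r₁, r₂⟩ := q₂ 0 hb1 0 (Nat.pow_pos hb1)
      simp only [Nat.zero_mul, Nat.add_zero] at r₁ r₂
      rcases Nat.lt_succ_iff_lt_or_eq.1 hi with h | rfl
      · rw [r₁ i h, h₂.zero i h]
      · exact r₂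
  · exact fun τ _ h => h

end ConnectedKMeans

/-! ### The order of the nodes -/

namespace TreeData

variable {D : TreeData} {h cnt : ℕ} {ord ord' : ℕ → ℕ}

/-- The `h`-th entry of the sequence of children of the nodes listed by `ord`. -/
def slot (D : TreeData) (ord : ℕ → ℕ) (h : ℕ) : ℕ :=
  if h % 2 = 0 then D.fst (ord (h / 2)) else D.snd (ord (h / 2))

/-- The first `cnt` entries of `ord` are the root and the first `h` entries of the sequence of
children. -/
structure IsQueue (D : TreeData) (h cnt : ℕ) (ord : ℕ → ℕ) : Prop where
  pos : 0 < cnt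
  lt : ∀ j < cnt, ord j < D.num
  inj : ∀ i < cnt, ∀ j < cnt, ord i = ord j → i = j
  zero : ord 0 = D.root
  later : ∀ h' < h, D.slot ord h' < D.num → ∃ j, h' / 2 < j ∧ j < cnt ∧ ord j = D.slot ord h'
  earlier : ∀ j < cnt, 0 < j → ∃ h' < h, h' / 2 < j ∧ D.slot ord h' = ord j
  sum : ∀ g : ℕ → ℝ, g D.num = 0 → g D.root + ∑ i ∈ Finset.range h, g (D.slot ord i) =
    ∑ j ∈ Finset.range cnt, g (ord j)

theorem IsRooted.slot_inj (hD : D.IsRooted) (ho : ∀ j < cnt, ord j < D.num)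
    (hi : ∀ i < cnt, ∀ j < cnt, ord i = ord j → i = j) {h h' : ℕ} (hc : h / 2 < cnt)
    (hc' : h' / 2 < cnt) (hl : D.slot ord h < D.num) (e : D.slot ord h = D.slot ord h') :
    h = h' := by
  unfold slot at hl e
  have o₁ := ho _ hc
  have o₂ := ho _ hc'
  split_ifs at hl e with q₁ q₂ q₂
  · have := hi _ hc _ hc' (hD.fst_inj _ o₁ _ o₂ hl e); omega
  · exact absurd e (hD.fst_ne_snd _ o₁ _ o₂ hl)
  · exact absurd e.symm (hD.fst_ne_snd _ o₂ _ o₁ (e ▸ hl))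
  · have := hi _ hc _ hc' (hD.snd_inj _ o₁ _ o₂ hl e); omega

theorem IsRooted.slot_le (hD : D.IsRooted) {h : ℕ} (ho : ord (h / 2) < D.num) :
    D.slot ord h ≤ D.num := by
  unfold slot
  split_ifs
  · exact hD.fst_le _ ho
  · exact hD.snd_le _ ho

theorem IsRooted.slot_ne_root (hD : D.IsRooted) {h : ℕ} (ho : ord (h / 2) < D.num) :
    D.slot ord h ≠ D.root := by
  unfold slot
  split_ifs
  · exact hD.fst_ne_root _ ho
  · exact hD.snd_ne_root _ ho

namespace IsQueue

theorem le_num (hq : D.IsQueue h cnt ord) : cnt ≤ D.num := by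
  have : ((Finset.range cnt).image ord).card ≤ (Finset.range D.num).card :=
    Finset.card_le_card fun s hs => by
      obtain ⟨i, hi, rfl⟩ := Finset.mem_image.1 hs
      exact Finset.mem_range.2 (hq.lt i (Finset.mem_range.1 hi))
  rwa [Finset.card_image_of_injOn, Finset.card_range, Finset.card_range] at this
  exact fun i hi j hj e => hq.inj i (by simpa using hi) j (by simpa using hj) e

/-- A queue that is exhausted contains all nodes. -/
theorem num_le (hq : D.IsQueue h cnt ord) (hD : D.IsRooted) (hc : 2 * cnt ≤ h) :
    D.num ≤ cnt := by
  have key : ∀ t < D.num, ∃ j < cnt, ord j = t := by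
    refine hD.reached _ ⟨0, hq.pos, hq.zero⟩ ?_
    rintro _ ht ⟨j, hj, rfl⟩
    have e₁ : D.slot ord (2 * j) = D.fst (ord j) := by simp [slot]
    have e₂ : D.slot ord (2 * j + 1) = D.snd (ord j) := by
      have : (2 * j + 1) / 2 = j := by omega
      simp [slot, this]
    refine ⟨fun hl => ?_, fun hl => ?_⟩
    · obtain ⟨i, -, q₂, q₃⟩ := hq.later (2 * j) (by omega) (e₁ ▸ hl)
      exact ⟨i, q₂, q₃.trans e₁⟩
    · obtain ⟨i, -, q₂, q₃⟩ := hq.later (2 * j + 1) (by omega) (e₂ ▸ hl)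
      exact ⟨i, q₂, q₃.trans e₂⟩
  have : (Finset.range D.num).card ≤ ((Finset.range cnt).image ord).card :=
    Finset.card_le_card fun t ht => by
      obtain ⟨j, hj, e⟩ := key t (Finset.mem_range.1 ht)
      exact Finset.mem_image.2 ⟨j, Finset.mem_range.2 hj, e⟩
  simpa using this.trans Finset.card_image_le

/-- The queue does not run dry too early. If slot `h` belonged to no listed node, the list would be
closed under taking children and hence contain all nodes, which forces `2 * D.num ≤ h`. -/
theorem div_lt (hq : D.IsQueue h cnt ord) (hD : D.IsRooted) (hh : h < 2 * D.num) :
    h / 2 < cnt := by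
  by_contra hc
  have := hq.num_le hD (by omega)
  omega

theorem init (hD : D.IsRooted) (h0 : ord 0 = D.root) : D.IsQueue 0 1 ord where
  pos := Nat.one_pos
  lt j hj := by
    obtain rfl : j = 0 := by omega
    rw [h0]; exact hD.root_lt
  inj i hi j hj _ := by omega
  zero := h0
  later h' hh' := by omega
  earlier j hj hj' := by omega
  sum g _ := by simp [h0]

theorem skip (hq : D.IsQueue h cnt ord) (hD : D.IsRooted) (hh : h < 2 * D.num)
    (hs : ¬ D.slot ord h < D.num) : D.IsQueue (h + 1) cnt ord where
  pos := hq.pos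
  lt := hq.lt
  inj := hq.inj
  zero := hq.zero
  later h' hh' hl := by
    rcases Nat.lt_succ_iff_lt_or_eq.1 hh' with h₁ | rfl
    · exact hq.later h' h₁ hl
    · exact absurd hl hs
  earlier j hj hj' := by
    obtain ⟨h', q₁, q₂⟩ := hq.earlier j hj hj'
    exact ⟨h', by omega, q₂⟩
  sum g hg := by
    have e : D.slot ord h = D.num :=
      le_antisymm (hD.slot_le (hq.lt _ (hq.div_lt hD hh))) (not_lt.1 hs)
    rw [Finset.sum_range_succ, e, hg, add_zero, hq.sum g hg]

theorem push (hq : D.IsQueue h cnt ord) (hD : D.IsRooted) (hh : h < 2 * D.num)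
    (hs : D.slot ord h < D.num) (ha : ∀ j < cnt, ord' j = ord j)
    (hn : ord' cnt = D.slot ord h) : D.IsQueue (h + 1) (cnt + 1) ord' := by
  have hd := hq.div_lt hD hh
  have hslot : ∀ h', h' / 2 < cnt → D.slot ord' h' = D.slot ord h' := by
    intro h' hc
    simp only [slot, ha _ hc]
  -- A child is not the root and fills one slot only, so it has not been listed before.
  have hfresh : ∀ j < cnt, ord j ≠ D.slot ord h := by
    intro j hj e
    rcases Nat.eq_zero_or_pos j with rfl | hp
    · exact hD.slot_ne_root (hq.lt _ hd) (e.symm.trans hq.zero)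
    · obtain ⟨h', q₁, q₂, q₃⟩ := hq.earlier j hj hp
      have := hD.slot_inj hq.lt hq.inj hd (q₂.trans hj) hs (e.symm.trans q₃.symm)
      omega
  refine ⟨by omega, ?_, ?_, ?_, ?_, ?_, ?_⟩
  · intro j hj
    rcases Nat.lt_succ_iff_lt_or_eq.1 hj with h₁ | rfl
    · rw [ha j h₁]; exact hq.lt j h₁
    · rw [hn]; exact hs
  · intro i hi j hj e
    rcases Nat.lt_succ_iff_lt_or_eq.1 hi with h₁ | rfl <;>
      rcases Nat.lt_succ_iff_lt_or_eq.1 hj with h₂ | rfl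
    · rw [ha i h₁, ha j h₂] at e
      exact hq.inj i h₁ j h₂ e
    · rw [ha i h₁, hn] at e
      exact absurd e (hfresh i h₁)
    · rw [ha j h₂, hn] at e
      exact absurd e.symm (hfresh j h₂)
    · rfl
  · rw [ha 0 hq.pos, hq.zero]
  · intro h' hh' hl
    rcases Nat.lt_succ_iff_lt_or_eq.1 hh' with h₁ | rfl
    · rw [hslot h' (by omega)] at hl ⊢
      obtain ⟨j, q₁, q₂, q₃⟩ := hq.later h' h₁ hl
      exact ⟨j, q₁, by omega, by rw [ha j q₂, q₃]⟩
    · rw [hslot h' hd]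
      exact ⟨cnt, hd, by omega, hn⟩
  · intro j hj hp
    rcases Nat.lt_succ_iff_lt_or_eq.1 hj with h₁ | rfl
    · obtain ⟨h', q₁, q₂, q₃⟩ := hq.earlier j h₁ hp
      exact ⟨h', by omega, q₂, by rw [hslot h' (by omega), ha j h₁, q₃]⟩
    · exact ⟨h, by omega, hd, by rw [hslot h hd, hn]⟩
  · intro g hg
    rw [Finset.sum_range_succ, Finset.sum_range_succ, hn, hslot h hd, ← add_assoc]
    have s₁ : ∑ j ∈ Finset.range cnt, g (ord' j) = ∑ j ∈ Finset.range cnt, g (ord j) :=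
      Finset.sum_congr rfl fun j hj => by rw [ha j (Finset.mem_range.1 hj)]
    have s₂ : ∑ i ∈ Finset.range h, g (D.slot ord' i) = ∑ i ∈ Finset.range h, g (D.slot ord i) :=
      Finset.sum_congr rfl fun i hi => by
        rw [hslot i (by have := Finset.mem_range.1 hi; omega)]
    rw [s₁, s₂, hq.sum g hg]

theorem isOrder (hq : D.IsQueue (2 * D.num) cnt ord) (hD : D.IsRooted) : D.IsOrder ord := by
  have hcnt : cnt = D.num := le_antisymm hq.le_num (hq.num_le hD (by have := hq.le_num; omega))
  subst hcnt
  have e₁ : ∀ j, D.slot ord (2 * j) = D.fst (ord j) := by simp [slot]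
  have e₂ : ∀ j, D.slot ord (2 * j + 1) = D.snd (ord j) := by
    intro j
    have : (2 * j + 1) / 2 = j := by omega
    simp [slot, this]
  refine ⟨hq.lt, hq.inj, hq.zero, ?_, ?_, ?_, ?_⟩
  · intro i hi hl
    obtain ⟨j, q₁, q₂, q₃⟩ := hq.later (2 * i) (by omega) (e₁ i ▸ hl)
    exact ⟨j, by omega, q₂, q₃.trans (e₁ i)⟩
  · intro i hi hl
    obtain ⟨j, q₁, q₂, q₃⟩ := hq.later (2 * i + 1) (by omega) (e₂ i ▸ hl)
    exact ⟨j, by omega, q₂, q₃.trans (e₂ i)⟩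
  · intro j hj hp
    obtain ⟨h', q₁, q₂, q₃⟩ := hq.earlier j hj hp
    refine ⟨h' / 2, q₂, ?_⟩
    unfold slot at q₃
    split_ifs at q₃
    · exact Or.inl q₃
    · exact Or.inr q₃
  · intro g hg
    rw [← hq.sum g hg]
    congr 1
    have : ∀ N, ∑ i ∈ Finset.range (2 * N), g (D.slot ord i) =
        ∑ i ∈ Finset.range N, (g (D.fst (ord i)) + g (D.snd (ord i))) := by
      intro N
      induction N with
      | zero => simp
      | succ N ih =>
        rw [Nat.mul_succ, Finset.sum_range_succ, Finset.sum_range_succ, ih,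
          Finset.sum_range_succ, e₁, e₂, add_assoc]
    exact (this _).symm

end IsQueue

end TreeData

namespace ConnectedKMeans

open RAMProgram

variable {x : RAMInput ConnSymbol} {X M N : ℕ} {σ : RAMStore}

theorem runs_enqueue {a h t : ℕ} {D : TreeData} (hND : D.num = N) (hD : D.IsRooted)
    (hN : ∀ i j, x.nat ConnSymbol.numNodes i j = N) (hM : 1 ≤ M)
    (hq : D.IsQueue h (σ.nat 18 0 0) fun i => σ.nat 17 i 0) (hh : h < 2 * N)
    (ht : σ.nat 19 0 0 = t) (hs : D.slot (fun i => σ.nat 17 i 0) h = σ.nat a t 0) :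
    Runs x X M (enqueue a) σ fun τ =>
      (D.IsQueue (h + 1) (τ.nat 18 0 0) fun i => τ.nat 17 i 0) ∧
        ∀ j < σ.nat 18 0 0, τ.nat 17 j 0 = σ.nat 17 j 0 := by
  refine Runs.ite hM (fun hb => Runs.seq (Runs.setNat hM (Runs.setNat hM ?_)))
    (fun hb => Runs.skip hM ?_)
  · simp only [TestExp.holds, NatExp.eval, ht, hN] at hb
    have h₁ : ∀ j < σ.nat 18 0 0, (if j = σ.nat 18 0 0 then σ.nat a t 0 else σ.nat 17 j 0) =
        σ.nat 17 j 0 := fun j hj => if_neg hj.ne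
    simp only [NatExp.eval, RAMStore.setNat_nat, ht]
    simp only [Nat.reduceEqDiff, false_and, if_false, and_self, if_true, and_true, true_and]
    refine ⟨hq.push hD (by omega) (by omega) h₁ (by simp [hs]), h₁⟩
  · simp only [TestExp.holds, NatExp.eval, ht, hN] at hb
    exact ⟨hq.skip hD (by omega) (by omega), fun _ _ => rfl⟩

theorem runs_orderNodes {D : TreeData} (hND : D.num = N) (hD : D.IsRooted)
    (hN : ∀ i j, x.nat ConnSymbol.numNodes i j = N) (hM : N < M)
    (hroot : x.nat ConnSymbol.root 0 0 = D.root)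
    (hfst : ∀ t < N, σ.nat 11 t 0 = D.fst t) (hsnd : ∀ t < N, σ.nat 12 t 0 = D.snd t) :
    Runs x X M orderNodes σ fun τ => D.IsOrder fun i => τ.nat 17 i 0 := by
  refine Runs.seq (Runs.setNat (by omega) (Runs.seq (Runs.setNat (by omega) ?_)))
  simp only [NatExp.eval, hroot]
  set σ' := (σ.setNat 17 0 0 D.root).setNat 18 0 0 1 with hσ'
  refine Runs.forLoop_large (fun j τ => D.IsQueue (2 * j) (τ.nat 18 0 0) fun i => τ.nat 17 i 0) N
    (by simp [NatExp.eval, hN]) hM (by decide) ?_ ?_ ?_ ?_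
  · have : σ'.nat 18 0 0 = 1 := by simp [hσ']
    rw [this]
    exact TreeData.IsQueue.init hD (by simp [hσ'])
  · intro j τ τ' h _ hI
    simpa only [h 17 (by decide), h 18 (by decide)] using hI
  · intro j hj τ hf hcj hI
    refine Runs.seq (Runs.setNat le_rfl ?_)
    simp only [NatExp.eval, hcj]
    set t := τ.nat 17 j 0 with ht
    set τ₁ := τ.setNat 19 0 0 t with hτ₁
    have hjc : j < τ.nat 18 0 0 := by
      have := hI.div_lt hD (by omega)
      omega
    have htN : t < N := hND ▸ hI.lt j hjc
    have e11 : ∀ i, τ₁.nat 11 i 0 = σ.nat 11 i 0 := by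
      intro i
      have := hf.1 11 (by decide)
      simp [hτ₁, this, hσ']
    have e12 : ∀ i, τ₁.nat 12 i 0 = σ.nat 12 i 0 := by
      intro i
      have := hf.1 12 (by decide)
      simp [hτ₁, this, hσ']
    have e17 : ∀ i, τ₁.nat 17 i 0 = τ.nat 17 i 0 := by simp [hτ₁]
    have e18 : τ₁.nat 18 0 0 = τ.nat 18 0 0 := by simp [hτ₁]
    have e19 : τ₁.nat 19 0 0 = t := by simp [hτ₁]
    refine Runs.seq ((runs_enqueue (h := 2 * j) (t := t) hND hD hN le_rfl
      (by simpa only [e17, e18] using hI) (by omega) e19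
      (by simp [TreeData.slot, e17, ← ht, e11, hfst t htN])).frame fun υ hυ ⟨q₁, q₂⟩ => ?_)
    refine (runs_enqueue (h := 2 * j + 1) (t := t) hND hD hN le_rfl
      q₁ (by omega) (by rw [hυ.1 19 (by decide), e19]) ?_).weaken fun _ h => h.1
    have : (2 * j + 1) / 2 = j := by omega
    have e : υ.nat 17 j 0 = t := by rw [q₂ j (by rw [e18]; exact hjc), e17]
    rw [hυ.1 12 (by decide)]
    simp [TreeData.slot, this, e, e12, hsnd t htN]
  · intro τ _ hI
    rw [← hND] at hI
    exact hI.isOrder hD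

end ConnectedKMeans

/-! ### Transitions of the dynamic program -/

namespace ConnectedKMeans

open RAMProgram NatExp TestExp

/-- The children of the current node. -/
abbrev fstChild : Index := entry 11 (cell 19)

abbrev sndChild : Index := entry 12 (cell 19)

abbrev bagAt (t i : Index) : Index := input ConnSymbol.bag t i

abbrev labelAt (i : ℕ) : Index := input ConnSymbol.label (cell 19) (const i)

abbrev kindIs (c : ℕ) : TestExp ConnSymbol :=
  natEq (input ConnSymbol.kind (cell 19) zero) (const c)

/-- Write the components and labels that the code `e` assigns to the bag of `t` into the
arrays `a` and `a'`. -/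
def loadState (a a' : ℕ) (t e : Index) : Code :=
  forLoop 24 (entry 10 t)
    (seq (setNat a (bagAt t (cell 24)) zero (read 16 e (cell 24)))
      (setNat a' (bagAt t (cell 24)) zero (read 16 e (add (cell 13) (cell 24)))))

/-- Both colours are saved before the loop starts, because the loop may change the entry of `u`
before it has visited all vertices of the class. -/
def mergeClasses (u w : Index) : Code :=
  seq (assign 27 (entry 42 u)) (seq (assign 28 (entry 42 w))
    (forLoop 26 (entry 10 fstChild)
      (ite (natEq (entry 42 (bagAt fstChild (cell 26))) (cell 27))
        (setNat 42 (bagAt fstChild (cell 26)) zero (cell 28)) skip)))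

def checkLabels : Code :=
  checkAll 24 (entry 10 sndChild) (natEq (entry 43 (bagAt sndChild (cell 24)))
    (entry 45 (bagAt sndChild (cell 24)))) 46

def joinRow : Code :=
  forLoop 25 (entry 10 sndChild)
    (ite (natEq (entry 44 (bagAt sndChild (cell 24))) (entry 44 (bagAt sndChild (cell 25))))
      (mergeClasses (bagAt sndChild (cell 24)) (bagAt sndChild (cell 25))) skip)

def joinRows : Code := forLoop 24 (entry 10 sndChild) joinRow

def introVertex : Code :=
  ite (kindIs 1)
    (seq (checkAll 24 (entry 10 fstChild)
        (not (natEq (entry 42 (bagAt fstChild (cell 24))) (entry 40 (labelAt 0)))) 46)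
      (seq (setNat 42 (labelAt 0) zero (entry 40 (labelAt 0)))
        (setNat 43 (labelAt 0) zero (entry 41 (labelAt 0)))))
    skip

/-- The target state in arrays `40` and `41` decides whether the edge is used: equal colours of its
ends there mean that the classes are to be merged and the labels must agree. -/
def introEdge : Code :=
  ite (and (kindIs 2) (natEq (entry 40 (labelAt 0)) (entry 40 (labelAt 1))))
    (seq (ite (natEq (entry 43 (labelAt 0)) (entry 43 (labelAt 1))) (assign 46 (cell 46))
        (assign 46 zero))
      (mergeClasses (labelAt 0) (labelAt 1)))
    skip

/-- The squared distance of the forgotten vertex from the center given by its label. -/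
def labelCost : RealExp ConnSymbol :=
  RealExp.mul (RealExp.dist (labelAt 0) (entry 100 (entry 43 (labelAt 0))))
    (RealExp.dist (labelAt 0) (entry 100 (entry 43 (labelAt 0))))

/-- Leaves the increment of the count in cell `47` and the charged cost in the real array `1`. Both
are reset first, since nodes of every type add them. -/
def forgetVertex : Code :=
  seq (assign 47 zero) (seq (setReal 1 zero zero (RealExp.ofNat zero))
    (ite (kindIs 3)
      (seq (assign 47 one)
        (seq (checkAll 24 (entry 10 fstChild)
            (not (and (not (natEq (bagAt fstChild (cell 24)) (labelAt 0)))
              (natEq (entry 42 (bagAt fstChild (cell 24))) (entry 42 (labelAt 0))))) 47)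
          (seq (ite (natLe (add (entry 43 (labelAt 0)) one) numClusters) (assign 46 (cell 46))
              (assign 46 zero))
            (setReal 1 zero zero labelCost))))
      skip))

def compareStates : Code :=
  seq (checkAll 24 (entry 10 (cell 19))
      (and (natEq (entry 40 (bagAt (cell 19) (cell 24))) (entry 42 (bagAt (cell 19) (cell 24))))
        (natEq (entry 41 (bagAt (cell 19) (cell 24))) (entry 43 (bagAt (cell 19) (cell 24))))) 46)
    (ite (natEq (read 16 (cell 21) (add (cell 13) (cell 13)))
        (add (add (read 16 (cell 22) (add (cell 13) (cell 13)))
          (read 16 (cell 23) (add (cell 13) (cell 13)))) (cell 47)))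
      (assign 46 (cell 46)) (assign 46 zero))

/-- Set cell `46` to `1` or `0` according to whether the state with code `21` can arise at the
current node from the states `22` and `23` of its children. -/
def transition : Code :=
  seq (loadState 40 41 (cell 19) (cell 21)) (seq (loadState 42 43 fstChild (cell 22))
    (seq (loadState 44 45 sndChild (cell 23)) (seq (assign 46 one) (seq checkLabels
      (seq joinRows (seq introVertex (seq introEdge (seq forgetVertex compareStates))))))))

end ConnectedKMeans

/-! ### Codes of states and the memory of the dynamic program -/

/-- The tables computed before the dynamic program starts. -/
structure DPTables where
  m : ℕ
  E : ℕ
  dec : ℕ → ℕ → ℕ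
  ord : ℕ → ℕ
  cen : ℕ → ℕ

namespace TreeData

open Classical in
/-- Position of `u` in the bag of `t`. -/
noncomputable def index (D : TreeData) (t u : ℕ) : ℕ :=
  if h : ∃ i, i < D.size t ∧ D.bag t i = u then Nat.find h else 0

theorem IsNice.index_bag {D : TreeData} {n : ℕ} {Adj : ℕ → ℕ → Prop} (h : D.IsNice n Adj)
    {t i : ℕ} (hi : i < D.size t) : D.index t (D.bag t i) = i := by
  classical
  have hex : ∃ j, j < D.size t ∧ D.bag t j = D.bag t i := ⟨i, hi, rfl⟩
  rw [index, dif_pos hex]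
  exact h.bag_inj _ _ _ (Nat.find_spec hex).1 hi (Nat.find_spec hex).2

end TreeData

/-- The state of the node `t` with code `e`. -/
noncomputable def DPTables.state (P : DPTables) (D : TreeData) (t e : ℕ) : DPState where
  comp u := P.dec e (D.index t u)
  label u := P.dec e (P.m + D.index t u)
  count := P.dec e (2 * P.m)

/-- The cost that arises at the node `t` if the state of its first child is `S`. -/
noncomputable def DPTables.stepCost (P : DPTables) (D : TreeData) (x : RAMInput ConnSymbol) (t : ℕ)
    (S : DPState) : ℝ :=
  if D.kind t = 3 then
    x.dist (D.lab t 0) (P.cen (S.label (D.lab t 0))) ^ 2 else 0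

namespace ConnectedKMeans

open RAMProgram

/-- The tables have been computed. -/
structure Prepared (x : RAMInput ConnSymbol) (N : ℕ) (P : DPTables) (σ : RAMStore) : Prop where
  size : ∀ t ≤ N, σ.nat 10 t 0 = (x.treeData N).size t
  fst : ∀ t < N, σ.nat 11 t 0 = (x.treeData N).fst t
  snd : ∀ t < N, σ.nat 12 t 0 = (x.treeData N).snd t
  m : σ.nat 13 0 0 = P.m
  E : σ.nat 15 0 0 = P.E
  dec : ∀ e j, σ.nat 16 e j = P.dec e j
  ord : ∀ i, σ.nat 17 i 0 = P.ord i
  cen : ∀ i, σ.nat 100 i 0 = P.cen i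

variable {x : RAMInput ConnSymbol} {X M N n k : ℕ} {σ τ : RAMStore} {P : DPTables}
  {Adj : ℕ → ℕ → Prop} {t : ℕ}

theorem Prepared.congr (h : Prepared x N P σ) {W R : List ℕ} (hf : SameOutside W R σ τ)
    (hW : ∀ a ∈ [10, 11, 12, 13, 15, 16, 17, 100], a ∉ W) : Prepared x N P τ := by
  refine ⟨?_, ?_, ?_, ?_, ?_, ?_, ?_, ?_⟩
  · rw [hf.1 10 (hW 10 (by decide))]; exact h.size
  · rw [hf.1 11 (hW 11 (by decide))]; exact h.fst
  · rw [hf.1 12 (hW 12 (by decide))]; exact h.snd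
  · rw [hf.1 13 (hW 13 (by decide))]; exact h.m
  · rw [hf.1 15 (hW 15 (by decide))]; exact h.E
  · rw [hf.1 16 (hW 16 (by decide))]; exact h.dec
  · rw [hf.1 17 (hW 17 (by decide))]; exact h.ord
  · rw [hf.1 100 (hW 100 (by decide))]; exact h.cen

/-- The tables have been computed and the current node is `t`. -/
structure AtNode (x : RAMInput ConnSymbol) (N : ℕ) (P : DPTables) (t : ℕ) (σ : RAMStore) :
    Prop extends Prepared x N P σ where
  node : σ.nat 19 0 0 = t

theorem AtNode.congr (h : AtNode x N P t σ) {W R : List ℕ} (hf : SameOutside W R σ τ)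
    (hW : ∀ a ∈ [10, 11, 12, 13, 15, 16, 17, 100, 19], a ∉ W) : AtNode x N P t τ :=
  ⟨h.toPrepared.congr hf fun a ha => hW a (by simp only [List.mem_cons] at ha ⊢; tauto),
    by rw [hf.1 19 (hW 19 (by decide))]; exact h.node⟩

theorem ite_congr_iff {α : Type} {p q : Prop} {ip : Decidable p} {iq : Decidable q} (h : p ↔ q)
    (a b : α) : @ite α p ip a b = @ite α q iq a b := by
  by_cases hp : p
  · rw [if_pos hp, if_pos (h.1 hp)]
  · rw [if_neg hp, if_neg fun hq => hp (h.2 hq)]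

/-- The expressions for node and code are evaluated anew in every round, hence the requirement that
writing the counter and the two target arrays does not change them. Vertices outside the bag keep
stale values, so the conclusion speaks only of the bag. -/
theorem runs_loadState {a a' s c : ℕ} {sExp cExp : Index} (hD : (x.treeData N).IsNice n Adj)
    (h : Prepared x N P σ) (ha : a ∉ [10, 11, 12, 13, 15, 16, 17, 100, 19, 24])
    (ha' : a' ∉ [10, 11, 12, 13, 15, 16, 17, 100, 19, 24]) (haa' : a ≠ a')
    (hs : ∀ τ, SameOutside [24, a, a'] [] σ τ → sExp.eval x τ = s)
    (hc : ∀ τ, SameOutside [24, a, a'] [] σ τ → cExp.eval x τ = c)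
    (hsN : s ≤ N) (hX : (x.treeData N).size s ≤ X) :
    Runs x X 1 (loadState a a' sExp cExp) σ fun τ => ∀ u, (x.treeData N).Mem u s →
      τ.nat a u 0 = (P.state (x.treeData N) s c).comp u ∧
      τ.nat a' u 0 = (P.state (x.treeData N) s c).label u := by
  simp only [List.mem_cons, List.not_mem_nil, or_false, not_or] at ha ha'
  set D := x.treeData N with hDdef
  have hbag : ∀ i, x.nat ConnSymbol.bag s i = D.bag s i := fun _ => rfl
  refine Runs.forLoop (fun j τ => ∀ i < j,
      τ.nat a (D.bag s i) 0 = P.dec c i ∧ τ.nat a' (D.bag s i) 0 = P.dec c (P.m + i)) (D.size s)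
    (by simp [NatExp.eval, hs σ (SameOutside.refl _ _ _), h.size s hsN, hDdef]) le_rfl hX ?_
    (by simp) ?_ ?_ ?_
  · simp only [natArrays, List.mem_append, List.mem_cons, List.not_mem_nil, or_false, not_or]
    omega
  · intro j τ τ' h' _ hI
    rw [h' a (by omega), h' a' (by omega)]
    exact hI
  · intro j hj τ hf hcj hI
    have hf' : SameOutside [24, a, a'] [] σ τ := hf.mono (by simp [natArrays]) (by simp [realArrays])
    have hp : Prepared x N P τ := h.congr hf' (by simp; omega)
    have hfa : SameOutside [24, a, a'] [] σ (τ.setNat a (D.bag s j) 0 (P.dec c j)) :=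
      hf'.trans (SameOutside.setNat _ _ _ _ (by simp))
    refine Runs.seq (Runs.setNat le_rfl (Runs.setNat le_rfl ?_))
    simp only [NatExp.eval, hs τ hf', hc τ hf', hcj, hbag, hp.dec]
    simp only [hs _ hfa, hc _ hfa, RAMStore.setNat_nat]
    have q₁ : (24 : ℕ) ≠ a := by omega
    have q₂ : (13 : ℕ) ≠ a := by omega
    have q₃ : (16 : ℕ) ≠ a := by omega
    simp only [q₁, q₂, q₃, false_and, if_false, hcj, hp.m, hp.dec, hbag, haa', haa'.symm]
    intro i hi
    rcases Nat.lt_succ_iff_lt_or_eq.1 hi with hi' | rfl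
    · have hne : D.bag s i ≠ D.bag s j := fun e => by
        have := hD.bag_inj _ _ _ (by omega) hj e; omega
      simpa [hne] using hI i hi'
    · simp
  · rintro τ _ hI _ ⟨i, hi, rfl⟩
    simpa only [DPTables.state, hD.index_bag hi] using hI i hi

theorem runs_mergeClasses {u w : Index} {uv wv : ℕ} (h : AtNode x N P t σ)
    (ht : t < N) (hfst : (x.treeData N).fst t ≤ N)
    (hu : u.eval x σ = uv) (hw : ∀ v, w.eval x (σ.setNat 27 0 0 v) = wv)
    (hX : (x.treeData N).size ((x.treeData N).fst t) ≤ X) :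
    Runs x X 1 (mergeClasses u w) σ fun τ => ∀ y, τ.nat 42 y 0 =
      mergeAt (fun y => (x.treeData N).Mem y ((x.treeData N).fst t))
        (fun y => σ.nat 42 y 0) uv wv y := by
  classical
  set D := x.treeData N with hDdef
  set s := D.fst t with hs
  refine Runs.seq (Runs.setNat le_rfl (Runs.seq (Runs.setNat le_rfl ?_)))
  simp only [NatExp.eval, hu, hw, RAMStore.setNat_nat]
  simp only [Nat.reduceEqDiff, false_and, if_false]
  set p := σ.nat 42 uv 0 with hp
  set q := σ.nat 42 wv 0 with hq
  set σ' := (σ.setNat 27 0 0 p).setNat 28 0 0 q with hσ'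
  have hf' : SameOutside [27, 28] [] σ σ' :=
    (SameOutside.setNat _ _ _ _ (by simp)).trans (SameOutside.setNat _ _ _ _ (by simp))
  have h' : AtNode x N P t σ' := h.congr hf' (by decide)
  have hbag : ∀ i, x.nat ConnSymbol.bag s i = D.bag s i := fun _ => rfl
  refine Runs.forLoop (fun j τ => ∀ y, τ.nat 42 y 0 =
      if (∃ i < j, D.bag s i = y) ∧ σ.nat 42 y 0 = p then q else σ.nat 42 y 0) (D.size s)
    (by simp only [NatExp.eval, h'.node]; rw [h'.fst t ht]; exact h'.size _ hfst) le_rfl hX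
    (by decide) (by simp [hσ']) ?_ ?_ ?_
  · intro j τ τ' h'' _ hI
    simpa only [h'' 42 (by decide)] using hI
  · intro j hj τ hf hcj hI
    have hp' : AtNode x N P t τ := h'.congr hf (by decide)
    have e27 : τ.nat 27 0 0 = p := by rw [hf.1 27 (by decide)]; simp [hσ']
    have e28 : τ.nat 28 0 0 = q := by rw [hf.1 28 (by decide)]; simp [hσ']
    have efst : τ.nat 11 t 0 = s := hp'.fst t ht
    have hsplit : ∀ y, (∃ i < j + 1, D.bag s i = y) ↔ (∃ i < j, D.bag s i = y) ∨ D.bag s j = y := by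
      intro y
      constructor
      · rintro ⟨i, hi, e⟩
        rcases Nat.lt_succ_iff_lt_or_eq.1 hi with h₁ | rfl
        · exact Or.inl ⟨i, h₁, e⟩
        · exact Or.inr e
      · rintro (⟨i, hi, e⟩ | e)
        · exact ⟨i, by omega, e⟩
        · exact ⟨j, by omega, e⟩
    refine Runs.ite le_rfl (fun hb => Runs.setNat le_rfl ?_) (fun hb => Runs.skip le_rfl ?_)
    · simp only [TestExp.holds, NatExp.eval, hp'.node, efst, hcj, hbag, e27] at hb
      simp only [NatExp.eval, hp'.node, efst, hcj, hbag, e28, RAMStore.setNat_nat, true_and,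
        and_true]
      intro y
      rw [ite_congr_iff (iq := Classical.dec _) (and_congr_left' (hsplit y)), hI y]
      have hb' : τ.nat 42 (D.bag s j) 0 = p := le_antisymm hb.1 hb.2
      by_cases hy : y = D.bag s j
      · subst hy
        rw [hI] at hb'
        by_cases e : σ.nat 42 (D.bag s j) 0 = p
        · simp [e]
        · simp [e] at hb'
      · simp [hy, Ne.symm hy]
    · simp only [TestExp.holds, NatExp.eval, hp'.node, efst, hcj, hbag, e27] at hb
      intro y
      rw [ite_congr_iff (iq := Classical.dec _) (and_congr_left' (hsplit y)), hI y]
      by_cases hy : D.bag s j = y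
      · subst hy
        have hb' : ¬ τ.nat 42 (D.bag s j) 0 = p := fun e => hb (by omega)
        rw [hI] at hb'
        by_cases e : σ.nat 42 (D.bag s j) 0 = p
        · rcases Classical.em (∃ i < j, D.bag s i = D.bag s j) with e' | e'
          · rw [if_pos ⟨e', e⟩, if_pos ⟨Or.inl e', e⟩]
          · rw [if_neg fun c => e' c.1] at hb'
            exact absurd e hb'
        · simp [e]
      · simp [hy]
  · intro τ _ hI y
    rw [hI y, mergeAt]
    exact ite_congr_iff Iff.rfl _ _

open Classical in
theorem runs_checkLabels (h : AtNode x N P t σ) (ht : t < N) (hsnd : (x.treeData N).snd t ≤ N)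
    (hX : (x.treeData N).size ((x.treeData N).snd t) ≤ X) :
    Runs x X 1 checkLabels σ fun τ => τ.nat 46 0 0 =
      if ∀ u, (x.treeData N).Mem u ((x.treeData N).snd t) → σ.nat 43 u 0 = σ.nat 45 u 0
      then σ.nat 46 0 0 else 0 := by
  set D := x.treeData N with hDdef
  have hbag : ∀ i, x.nat ConnSymbol.bag (D.snd t) i = D.bag (D.snd t) i := fun _ => rfl
  refine Runs.checkAll (fun i => σ.nat 43 (D.bag (D.snd t) i) 0 = σ.nat 45 (D.bag (D.snd t) i) 0)
    (D.size (D.snd t)) (by simp only [NatExp.eval, h.node]; rw [h.snd t ht]; exact h.size _ hsnd) le_rfl hX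
    (by decide) ?_ ?_
  · intro j hj τ hf hcj
    have hp : AtNode x N P t τ := h.congr hf (by decide)
    simp only [TestExp.holds, NatExp.eval, hp.node, hp.snd t ht, hcj, ← hDdef, hbag,
      hf.1 43 (by decide), hf.1 45 (by decide)]
    omega
  · intro τ _ e
    rw [e]
    refine ite_congr_iff ⟨?_, ?_⟩ _ _
    · rintro h' _ ⟨i, hi, rfl⟩; exact h' i hi
    · exact fun h' i hi => h' _ ⟨i, hi, rfl⟩

theorem runs_joinRow {i : ℕ} (h : AtNode x N P t σ) (ht : t < N)
    (hfst : (x.treeData N).fst t ≤ N) (hsnd : (x.treeData N).snd t ≤ N)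
    (hX : (x.treeData N).size ((x.treeData N).fst t) ≤ X)
    (hX' : (x.treeData N).size ((x.treeData N).snd t) ≤ X) (hi : σ.nat 24 0 0 = i) :
    Runs x X 1 joinRow σ fun τ => (fun u => τ.nat 42 u 0) =
      mergeRow (fun y => (x.treeData N).Mem y ((x.treeData N).fst t))
        ((x.treeData N).bag ((x.treeData N).snd t)) (fun u => σ.nat 44 u 0)
        ((x.treeData N).bag ((x.treeData N).snd t) i)
        ((x.treeData N).size ((x.treeData N).snd t)) (fun u => σ.nat 42 u 0) := by
  set D := x.treeData N with hDdef
  have hbag : ∀ i, x.nat ConnSymbol.bag (D.snd t) i = D.bag (D.snd t) i := fun _ => rfl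
  refine Runs.forLoop (fun j τ => (fun u => τ.nat 42 u 0) =
      mergeRow (fun y => D.Mem y (D.fst t)) (D.bag (D.snd t)) (fun u => σ.nat 44 u 0)
        (D.bag (D.snd t) i) j (fun u => σ.nat 42 u 0)) (D.size (D.snd t))
    (by simp only [NatExp.eval, h.node]; rw [h.snd t ht]; exact h.size _ hsnd) le_rfl hX'
    (by decide) rfl ?_ ?_ (fun _ _ h => h)
  · intro j τ τ' h'' _ hI
    simpa only [h'' 42 (by decide)] using hI
  · intro j hj τ hf hcj hI
    have hp : AtNode x N P t τ := h.congr hf (by decide)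
    have e24 : τ.nat 24 0 0 = i := by rw [hf.1 24 (by decide), hi]
    have e44 : τ.nat 44 = σ.nat 44 := hf.1 44 (by decide)
    have hs : τ.nat 12 t 0 = D.snd t := hp.snd t ht
    refine Runs.ite le_rfl (fun hb => ?_) (fun hb => Runs.skip le_rfl ?_)
    · simp only [TestExp.holds, NatExp.eval, hp.node, hs, hcj, hbag, e24, e44] at hb
      refine (runs_mergeClasses (uv := D.bag (D.snd t) i) (wv := D.bag (D.snd t) j) hp ht hfst
        (by simp [NatExp.eval, hp.node, hs, e24, hbag])
        (by simp [NatExp.eval, hp.node, hs, hcj, hbag]) hX).weaken fun υ hυ => ?_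
      funext u
      rw [hυ u, hI, mergeRow, if_pos (le_antisymm hb.1 hb.2)]
    · simp only [TestExp.holds, NatExp.eval, hp.node, hs, hcj, hbag, e24, e44] at hb
      rw [hI, mergeRow, if_neg (by omega)]

theorem runs_joinRows (h : AtNode x N P t σ) (ht : t < N)
    (hfst : (x.treeData N).fst t ≤ N) (hsnd : (x.treeData N).snd t ≤ N)
    (hX : (x.treeData N).size ((x.treeData N).fst t) ≤ X)
    (hX' : (x.treeData N).size ((x.treeData N).snd t) ≤ X) :
    Runs x X 1 joinRows σ fun τ => (fun u => τ.nat 42 u 0) =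
      (x.treeData N).joinComp t (fun u => σ.nat 42 u 0) (fun u => σ.nat 44 u 0) := by
  set D := x.treeData N with hDdef
  refine Runs.forLoop (fun j τ => (fun u => τ.nat 42 u 0) =
      mergeRows (fun y => D.Mem y (D.fst t)) (D.bag (D.snd t)) (fun u => σ.nat 44 u 0)
        (D.size (D.snd t)) j (fun u => σ.nat 42 u 0)) (D.size (D.snd t))
    (by simp only [NatExp.eval, h.node]; rw [h.snd t ht]; exact h.size _ hsnd) le_rfl hX'
    (by decide) rfl ?_ ?_ (fun _ _ h => h)
  · intro j τ τ' h'' _ hI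
    simpa only [h'' 42 (by decide)] using hI
  · intro j hj τ hf hcj hI
    have hp : AtNode x N P t τ := h.congr hf (by decide)
    refine (runs_joinRow hp ht hfst hsnd hX hX' hcj).weaken fun υ hυ => ?_
    rw [hυ, hI, hf.1 44 (by decide)]
    rfl

open Classical in
theorem runs_introVertex (h : AtNode x N P t σ) (ht : t < N) (hfst : (x.treeData N).fst t ≤ N)
    (hX : (x.treeData N).size ((x.treeData N).fst t) ≤ X) :
    Runs x X 1 introVertex σ fun τ =>
      (τ.nat 46 0 0 = if (x.treeData N).kind t = 1 →
          ∀ u, (x.treeData N).Mem u ((x.treeData N).fst t) →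
            σ.nat 42 u 0 ≠ σ.nat 40 ((x.treeData N).lab t 0) 0
        then σ.nat 46 0 0 else 0) ∧
      (fun u => τ.nat 42 u 0) = (if (x.treeData N).kind t = 1 then
        Function.update (fun u => σ.nat 42 u 0) ((x.treeData N).lab t 0)
          (σ.nat 40 ((x.treeData N).lab t 0) 0) else fun u => σ.nat 42 u 0) ∧
      (fun u => τ.nat 43 u 0) = (x.treeData N).introLabel t (fun u => σ.nat 41 u 0)
        (fun u => σ.nat 43 u 0) := by
  set D := x.treeData N with hDdef
  have hbag : ∀ i, x.nat ConnSymbol.bag (D.fst t) i = D.bag (D.fst t) i := fun _ => rfl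
  have hkind : x.nat ConnSymbol.kind t 0 = D.kind t := rfl
  have hlab : x.nat ConnSymbol.label t 0 = D.lab t 0 := rfl
  refine Runs.ite le_rfl (fun hb => Runs.seq ?_) (fun hb => Runs.skip le_rfl ?_)
  · simp only [TestExp.holds, NatExp.eval, h.node, hkind] at hb
    have hk : D.kind t = 1 := by omega
    refine Runs.checkAll (fun i => σ.nat 42 (D.bag (D.fst t) i) 0 ≠ σ.nat 40 (D.lab t 0) 0)
      (D.size (D.fst t)) (by simp only [NatExp.eval, h.node]; rw [h.fst t ht]; exact h.size _ hfst)
      le_rfl hX (by decide) ?_ ?_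
    · intro j hj τ hf hcj
      have hp : AtNode x N P t τ := h.congr hf (by decide)
      simp only [TestExp.holds, NatExp.eval, hp.node, hp.fst t ht, hcj, ← hDdef, hbag, hlab,
        hf.1 42 (by decide), hf.1 40 (by decide)]
      omega
    · intro τ hf e
      have hp : AtNode x N P t τ := h.congr hf (by decide)
      refine Runs.seq (Runs.setNat le_rfl (Runs.setNat le_rfl ?_))
      simp only [NatExp.eval, hp.node, hlab, RAMStore.setNat_nat, hf.1 42 (by decide),
        hf.1 43 (by decide), hf.1 40 (by decide), hf.1 41 (by decide), e, hk]
      refine ⟨?_, ?_, ?_⟩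
      · simp only [Nat.reduceEqDiff, false_and, if_false, forall_const]
        refine ite_congr_iff ⟨?_, ?_⟩ _ _
        · rintro h' _ ⟨i, hi, rfl⟩; exact h' i hi
        · exact fun h' i hi => h' _ ⟨i, hi, rfl⟩
      · funext u
        by_cases hu : u = D.lab t 0 <;> simp [hu, hlab]
      · funext u
        by_cases hu : u = D.lab t 0 <;> simp [hu, hlab, TreeData.introLabel, hk]
  · simp only [TestExp.holds, NatExp.eval, h.node, hkind] at hb
    have hk : D.kind t ≠ 1 := by omega
    simp [hk, TreeData.introLabel]

open Classical in
theorem runs_introEdge (h : AtNode x N P t σ) (ht : t < N) (hfst : (x.treeData N).fst t ≤ N)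
    (hX : (x.treeData N).size ((x.treeData N).fst t) ≤ X) :
    Runs x X 1 introEdge σ fun τ =>
      (τ.nat 46 0 0 = if (x.treeData N).kind t = 2 →
          σ.nat 40 ((x.treeData N).lab t 0) 0 = σ.nat 40 ((x.treeData N).lab t 1) 0 →
          σ.nat 43 ((x.treeData N).lab t 0) 0 = σ.nat 43 ((x.treeData N).lab t 1) 0
        then σ.nat 46 0 0 else 0) ∧
      (fun u => τ.nat 42 u 0) = (if (x.treeData N).kind t = 2 ∧
          σ.nat 40 ((x.treeData N).lab t 0) 0 = σ.nat 40 ((x.treeData N).lab t 1) 0 then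
        mergeAt (fun u => (x.treeData N).Mem u ((x.treeData N).fst t)) (fun u => σ.nat 42 u 0)
          ((x.treeData N).lab t 0) ((x.treeData N).lab t 1) else fun u => σ.nat 42 u 0) := by
  set D := x.treeData N with hDdef
  have hkind : x.nat ConnSymbol.kind t 0 = D.kind t := rfl
  have hlab : ∀ i, x.nat ConnSymbol.label t i = D.lab t i := fun _ => rfl
  refine Runs.ite le_rfl (fun hb => Runs.seq (Runs.iteSetNat le_rfl ?_))
    (fun hb => Runs.skip le_rfl ?_)
  · simp only [TestExp.holds, NatExp.eval, h.node, hkind, hlab] at hb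
    have hk : D.kind t = 2 := by omega
    have hc : σ.nat 40 (D.lab t 0) 0 = σ.nat 40 (D.lab t 1) 0 := by omega
    have hf := SameOutside.setNat (W := [46]) (R := []) σ (a := 46) 0 0
      (if (natEq (entry 43 (labelAt 0)) (entry 43 (labelAt 1))).holds x σ then σ.nat 46 0 0 else 0)
      (by simp)
    set τ := σ.setNat 46 0 0
      (if (natEq (entry 43 (labelAt 0)) (entry 43 (labelAt 1))).holds x σ
        then σ.nat 46 0 0 else 0) with hτ
    have hp : AtNode x N P t τ := h.congr hf (by decide)
    refine (runs_mergeClasses (uv := D.lab t 0) (wv := D.lab t 1) hp ht hfst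
        (by simp [NatExp.eval, hp.node, hlab]) (by simp [NatExp.eval, hp.node, hlab])
        hX).frame fun υ hf' hυ => ?_
    refine ⟨?_, ?_⟩
    · rw [hf'.1 46 (by decide), hτ]
      simp only [TestExp.holds, NatExp.eval, h.node, hlab, RAMStore.setNat_nat, and_self, if_true,
        hk, hc, forall_const]
      exact ite_congr_iff (by omega) _ _
    · funext u
      rw [hυ u, hf.1 42 (by decide), if_pos ⟨hk, hc⟩]
  · simp only [TestExp.holds, NatExp.eval, h.node, hkind, hlab] at hb
    have hk : ¬ (D.kind t = 2 ∧ σ.nat 40 (D.lab t 0) 0 = σ.nat 40 (D.lab t 1) 0) := by omega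
    refine ⟨?_, by rw [if_neg hk]⟩
    rw [if_pos]
    exact fun h₁ h₂ => absurd ⟨h₁, h₂⟩ hk

open Classical in
theorem runs_forgetVertex (hk : ∀ i j, x.nat ConnSymbol.numClusters i j = k)
    (h : AtNode x N P t σ) (ht : t < N) (hfst : (x.treeData N).fst t ≤ N)
    (hX : (x.treeData N).size ((x.treeData N).fst t) ≤ X) :
    Runs x X 1 forgetVertex σ fun τ =>
      (τ.nat 46 0 0 = if (x.treeData N).kind t = 3 → σ.nat 43 ((x.treeData N).lab t 0) 0 < k
        then σ.nat 46 0 0 else 0) ∧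
      (τ.nat 47 0 0 = if (x.treeData N).kind t = 3 ∧ (x.treeData N).Alone ((x.treeData N).fst t)
        (fun u => σ.nat 42 u 0) ((x.treeData N).lab t 0) then 1 else 0) ∧
      τ.real 1 0 0 = if (x.treeData N).kind t = 3 then x.dist ((x.treeData N).lab t 0)
        (P.cen (σ.nat 43 ((x.treeData N).lab t 0) 0)) ^ 2 else 0 := by
  set D := x.treeData N with hDdef
  have hbag : ∀ i, x.nat ConnSymbol.bag (D.fst t) i = D.bag (D.fst t) i := fun _ => rfl
  have hkind : x.nat ConnSymbol.kind t 0 = D.kind t := rfl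
  have hlab : x.nat ConnSymbol.label t 0 = D.lab t 0 := rfl
  refine Runs.seq (Runs.setNat le_rfl (Runs.seq (Runs.setReal le_rfl
    (Runs.ite le_rfl (fun hb => Runs.seq (Runs.setNat le_rfl (Runs.seq ?_)))
    (fun hb => Runs.skip le_rfl ?_)))))
  · simp only [TestExp.holds, NatExp.eval, RAMStore.setReal_nat, RAMStore.setNat_nat,
      Nat.reduceEqDiff, false_and, if_false, h.node, hkind] at hb
    have hk3 : D.kind t = 3 := by omega
    set σ' := ((σ.setNat 47 _ _ _).setReal 1 _ _ _).setNat 47 _ _ _ with hσ'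
    have hf₀ : SameOutside [47] [1] σ σ' :=
      ((SameOutside.setNat _ _ _ _ (by simp)).trans (SameOutside.setReal _ _ _ _ (by simp))).trans
        (SameOutside.setNat _ _ _ _ (by simp))
    have h' : AtNode x N P t σ' := h.congr hf₀ (by decide)
    have e47 : σ'.nat 47 0 0 = 1 := by simp [hσ', NatExp.eval]
    refine Runs.checkAll (fun i => ¬ (D.bag (D.fst t) i ≠ D.lab t 0 ∧
        σ.nat 42 (D.bag (D.fst t) i) 0 = σ.nat 42 (D.lab t 0) 0))
      (D.size (D.fst t)) (by simp only [NatExp.eval, h'.node]; rw [h'.fst t ht]; exact h'.size _ hfst)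
      le_rfl hX (by decide) ?_ ?_
    · intro j hj τ hf hcj
      have hp : AtNode x N P t τ := h'.congr hf (by decide)
      simp only [TestExp.holds, NatExp.eval, hp.node, hp.fst t ht, hcj, ← hDdef, hbag, hlab,
        hf.1 42 (by decide), hf₀.1 42 (by decide)]
      omega
    · intro τ hf e
      have hp : AtNode x N P t τ := h'.congr hf (by decide)
      have e43 : τ.nat 43 = σ.nat 43 := by rw [hf.1 43 (by decide), hf₀.1 43 (by decide)]
      have e46 : τ.nat 46 = σ.nat 46 := by rw [hf.1 46 (by decide), hf₀.1 46 (by decide)]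
      refine Runs.seq (Runs.iteSetNat le_rfl (Runs.setReal le_rfl ?_))
      simp only [TestExp.holds, NatExp.eval, RealExp.eval, labelCost, hp.node, hlab,
        RAMStore.setNat_nat, RAMStore.setReal_nat, RAMStore.setReal_real, e43, e46, hp.cen, hk,
        Nat.reduceEqDiff, false_and, if_false, and_self, if_true, hk3, forall_const, true_and]
      refine ⟨ite_congr_iff (by omega) _ _, ?_, by ring⟩
      rw [e, e47]
      refine ite_congr_iff ⟨?_, ?_⟩ _ _
      · rintro h' _ ⟨i, hi, rfl⟩ h₁ h₂; exact h' i hi ⟨h₁, h₂⟩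
      · exact fun h' i hi h₁ => h' _ ⟨i, hi, rfl⟩ h₁.1 h₁.2
  · simp only [TestExp.holds, NatExp.eval, RAMStore.setReal_nat, RAMStore.setNat_nat,
      Nat.reduceEqDiff, false_and, if_false, h.node, hkind] at hb
    have hk3 : D.kind t ≠ 3 := by omega
    simp [hk3, NatExp.eval, RealExp.eval]

open Classical in
theorem runs_compareStates {e e₁ e₂ : ℕ} (h : AtNode x N P t σ) (ht : t < N)
    (hX : (x.treeData N).size t ≤ X) (h21 : σ.nat 21 0 0 = e) (h22 : σ.nat 22 0 0 = e₁)
    (h23 : σ.nat 23 0 0 = e₂) :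
    Runs x X 1 compareStates σ fun τ => τ.nat 46 0 0 =
      if (∀ u, (x.treeData N).Mem u t →
          σ.nat 40 u 0 = σ.nat 42 u 0 ∧ σ.nat 41 u 0 = σ.nat 43 u 0) ∧
        P.dec e (2 * P.m) = P.dec e₁ (2 * P.m) + P.dec e₂ (2 * P.m) + σ.nat 47 0 0
      then σ.nat 46 0 0 else 0 := by
  set D := x.treeData N with hDdef
  have hbag : ∀ i, x.nat ConnSymbol.bag t i = D.bag t i := fun _ => rfl
  refine Runs.seq (Runs.checkAll (fun i => σ.nat 40 (D.bag t i) 0 = σ.nat 42 (D.bag t i) 0 ∧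
      σ.nat 41 (D.bag t i) 0 = σ.nat 43 (D.bag t i) 0) (D.size t)
    (by simp [NatExp.eval, h.node, h.size _ ht.le, hDdef]) le_rfl hX
    (by decide) ?_ ?_)
  · intro j hj τ hf hcj
    have hp : AtNode x N P t τ := h.congr hf (by decide)
    simp only [TestExp.holds, NatExp.eval, hp.node, hcj, hbag,
      hf.1 40 (by decide), hf.1 41 (by decide), hf.1 42 (by decide), hf.1 43 (by decide)]
    omega
  · intro τ hf e
    have hp : AtNode x N P t τ := h.congr hf (by decide)
    have e21 := hf.1 21 (by decide)
    have e22 := hf.1 22 (by decide)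
    have e23 := hf.1 23 (by decide)
    have e47 := hf.1 47 (by decide)
    refine Runs.iteSetNat le_rfl ?_
    simp only [TestExp.holds, NatExp.eval, RAMStore.setNat_nat, and_self, if_true, hp.m, hp.dec,
      e21, e22, e23, e47, h21, h22, h23, ← two_mul, e]
    have hiff : (∀ i < D.size t, σ.nat 40 (D.bag t i) 0 = σ.nat 42 (D.bag t i) 0 ∧
        σ.nat 41 (D.bag t i) 0 = σ.nat 43 (D.bag t i) 0) ↔
        ∀ u, D.Mem u t → σ.nat 40 u 0 = σ.nat 42 u 0 ∧ σ.nat 41 u 0 = σ.nat 43 u 0 := by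
      constructor
      · rintro h' _ ⟨i, hi, rfl⟩; exact h' i hi
      · exact fun h' i hi => h' _ ⟨i, hi, rfl⟩
    rw [ite_congr_iff (iq := Classical.dec _) hiff]
    by_cases c₁ : ∀ u, D.Mem u t → σ.nat 40 u 0 = σ.nat 42 u 0 ∧ σ.nat 41 u 0 = σ.nat 43 u 0
    · rw [if_pos c₁]
      exact ite_congr_iff ⟨fun q => ⟨c₁, by omega⟩, fun q => by have := q.2; omega⟩ _ _
    · rw [if_neg c₁, ite_self, if_neg fun q => c₁ q.1]

end ConnectedKMeans

namespace ConnectedKMeans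

open RAMProgram

variable {x : RAMInput ConnSymbol} {X M N n k : ℕ} {σ τ : RAMStore} {P : DPTables}
  {Adj : ℕ → ℕ → Prop} {t : ℕ}

theorem ite_eq_one_iff {p : Prop} {_ : Decidable p} {a : ℕ} :
    (if p then a else 0) = 1 ↔ a = 1 ∧ p := by
  split_ifs with h <;> simp [h]

/-- Arrays `42` and `43` start with the state of the first child and are turned into the state
forced at `t` by the free choices in the target, which is finally compared with the target. The flag
survives exactly if all clauses of `Step` hold. -/
theorem runs_transition {e e₁ e₂ : ℕ} (hk : ∀ i j, x.nat ConnSymbol.numClusters i j = k)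
    (hD : (x.treeData N).IsNice n Adj) (h : AtNode x N P t σ) (ht : t < N)
    (hX : ∀ s, (x.treeData N).size s ≤ X)
    (h21 : σ.nat 21 0 0 = e) (h22 : σ.nat 22 0 0 = e₁) (h23 : σ.nat 23 0 0 = e₂) :
    Runs x X 1 transition σ fun τ =>
      (τ.nat 46 0 0 = 1 ↔ (x.treeData N).Step k t (P.state (x.treeData N) t e)
        (P.state (x.treeData N) ((x.treeData N).fst t) e₁)
        (P.state (x.treeData N) ((x.treeData N).snd t) e₂)) ∧
      τ.real 1 0 0 = P.stepCost (x.treeData N) x t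
        (P.state (x.treeData N) ((x.treeData N).fst t) e₁) := by
  classical
  set D := x.treeData N with hDdef
  have hfst : D.fst t ≤ N := hD.fst_le ht
  have hsnd : D.snd t ≤ N := hD.snd_le ht
  refine Runs.seq ((runs_loadState (s := t) (c := e) hD h.toPrepared (by decide) (by decide)
    (by decide) (fun τ hf => by
      simp only [NatExp.eval, hf.1 19 (by decide), h.node]) (fun τ hf => by
      simp only [NatExp.eval, hf.1 21 (by decide), h21]) ht.le (hX _)).frame fun σ₁ f₁ q₁ => ?_)
  have h₁ : AtNode x N P t σ₁ := h.congr f₁ (by decide)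
  refine Runs.seq ((runs_loadState (s := D.fst t) (c := e₁) hD h₁.toPrepared (by decide) (by decide)
    (by decide) (fun τ hf => by
      simp only [NatExp.eval, hf.1 19 (by decide), hf.1 11 (by decide), h₁.node, h₁.fst t ht, D])
    (fun τ hf => by
      simp only [NatExp.eval, hf.1 22 (by decide), f₁.1 22 (by decide), h22]) hfst (hX _)).frame
      fun σ₂ f₂ q₂ => ?_)
  have h₂ : AtNode x N P t σ₂ := h₁.congr f₂ (by decide)
  refine Runs.seq ((runs_loadState (s := D.snd t) (c := e₂) hD h₂.toPrepared (by decide) (by decide)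
    (by decide) (fun τ hf => by
      simp only [NatExp.eval, hf.1 19 (by decide), hf.1 12 (by decide), h₂.node, h₂.snd t ht, D])
    (fun τ hf => by
      simp only [NatExp.eval, hf.1 23 (by decide), f₂.1 23 (by decide), f₁.1 23 (by decide), h23])
      hsnd (hX _)).frame fun σ₃ f₃ q₃ => ?_)
  have h₃ : AtNode x N P t σ₃ := h₂.congr f₃ (by decide)
  obtain ⟨C₀, hC₀⟩ : ∃ C : ℕ → ℕ, ∀ u, σ₃.nat 40 u 0 = C u := ⟨_, fun _ => rfl⟩
  obtain ⟨L₀, hL₀⟩ : ∃ C : ℕ → ℕ, ∀ u, σ₃.nat 41 u 0 = C u := ⟨_, fun _ => rfl⟩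
  obtain ⟨C₁, hC₁⟩ : ∃ C : ℕ → ℕ, ∀ u, σ₃.nat 42 u 0 = C u := ⟨_, fun _ => rfl⟩
  obtain ⟨L₁, hL₁⟩ : ∃ C : ℕ → ℕ, ∀ u, σ₃.nat 43 u 0 = C u := ⟨_, fun _ => rfl⟩
  obtain ⟨C₂, hC₂⟩ : ∃ C : ℕ → ℕ, ∀ u, σ₃.nat 44 u 0 = C u := ⟨_, fun _ => rfl⟩
  obtain ⟨L₂, hL₂⟩ : ∃ C : ℕ → ℕ, ∀ u, σ₃.nat 45 u 0 = C u := ⟨_, fun _ => rfl⟩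
  have g₀ : ∀ u, D.Mem u t → C₀ u = (P.state D t e).comp u ∧ L₀ u = (P.state D t e).label u := by
    intro u hu
    rw [← hC₀, ← hL₀, f₃.1 40 (by decide), f₃.1 41 (by decide), f₂.1 40 (by decide),
      f₂.1 41 (by decide)]
    exact q₁ u hu
  have g₁ : ∀ u, D.Mem u (D.fst t) → C₁ u = (P.state D (D.fst t) e₁).comp u ∧
      L₁ u = (P.state D (D.fst t) e₁).label u := by
    intro u hu
    rw [← hC₁, ← hL₁, f₃.1 42 (by decide), f₃.1 43 (by decide)]
    exact q₂ u hu
  have g₂ : ∀ u, D.Mem u (D.snd t) → C₂ u = (P.state D (D.snd t) e₂).comp u ∧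
      L₂ u = (P.state D (D.snd t) e₂).label u := by
    intro u hu
    rw [← hC₂, ← hL₂]
    exact q₃ u hu
  have h21' : σ₃.nat 21 0 0 = e := by
    rw [f₃.1 21 (by decide), f₂.1 21 (by decide), f₁.1 21 (by decide), h21]
  have h22' : σ₃.nat 22 0 0 = e₁ := by
    rw [f₃.1 22 (by decide), f₂.1 22 (by decide), f₁.1 22 (by decide), h22]
  have h23' : σ₃.nat 23 0 0 = e₂ := by
    rw [f₃.1 23 (by decide), f₂.1 23 (by decide), f₁.1 23 (by decide), h23]
  clear q₁ q₂ q₃ h₁ h₂ f₁ f₂ f₃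
  refine Runs.seq (Runs.setNat le_rfl ?_)
  set σ₄ := σ₃.setNat 46 (NatExp.eval x σ₃ (NatExp.const 0)) (NatExp.eval x σ₃ (NatExp.const 0))
    (NatExp.eval x σ₃ one) with hσ₄
  have f₄ : SameOutside [46] [] σ₃ σ₄ := SameOutside.setNat _ _ _ _ (by simp)
  have h₄ : AtNode x N P t σ₄ := h₃.congr f₄ (by decide)
  have v₄ : σ₄.nat 46 0 0 = 1 := by simp [hσ₄, NatExp.eval]
  refine Runs.seq ((runs_checkLabels h₄ ht hsnd (hX _)).frame fun σ₅ f₅ v₅ => ?_)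
  have h₅ : AtNode x N P t σ₅ := h₄.congr f₅ (by decide)
  refine Runs.seq ((runs_joinRows h₅ ht hfst hsnd (hX _) (hX _)).frame fun σ₆ f₆ w₆ => ?_)
  have h₆ : AtNode x N P t σ₆ := h₅.congr f₆ (by decide)
  refine Runs.seq ((runs_introVertex h₆ ht hfst (hX _)).frame fun σ₇ f₇ v₇ => ?_)
  have h₇ : AtNode x N P t σ₇ := h₆.congr f₇ (by decide)
  refine Runs.seq ((runs_introEdge h₇ ht hfst (hX _)).frame fun σ₈ f₈ v₈ => ?_)
  have h₈ : AtNode x N P t σ₈ := h₇.congr f₈ (by decide)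
  refine Runs.seq ((runs_forgetVertex hk h₈ ht hfst (hX _)).frame fun σ₉ f₉ v₉ => ?_)
  have h₉ : AtNode x N P t σ₉ := h₈.congr f₉ (by decide)
  refine (runs_compareStates (e := e) (e₁ := e₁) (e₂ := e₂) h₉ ht (hX _)
    (by rw [f₉.1 21 (by decide), f₈.1 21 (by decide), f₇.1 21 (by decide), f₆.1 21 (by decide),
      f₅.1 21 (by decide), f₄.1 21 (by decide), h21'])
    (by rw [f₉.1 22 (by decide), f₈.1 22 (by decide), f₇.1 22 (by decide), f₆.1 22 (by decide),
      f₅.1 22 (by decide), f₄.1 22 (by decide), h22'])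
    (by rw [f₉.1 23 (by decide), f₈.1 23 (by decide), f₇.1 23 (by decide), f₆.1 23 (by decide),
      f₅.1 23 (by decide), f₄.1 23 (by decide), h23'])).frame fun υ f v => ?_
  obtain ⟨v₇, w₇, u₇⟩ := v₇
  obtain ⟨v₈, w₈⟩ := v₈
  obtain ⟨v₉, u₉, r₉⟩ := v₉
  rw [← hDdef] at v₅ w₆ v₇ w₇ u₇ v₈ w₈ v₉ u₉ r₉ v
  -- the arrays of colours and labels at the individual stages
  have a40 : ∀ u, σ₆.nat 40 u 0 = C₀ u := fun u => by
    rw [f₆.1 40 (by decide), f₅.1 40 (by decide), f₄.1 40 (by decide), hC₀]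
  have a41 : ∀ u, σ₆.nat 41 u 0 = L₀ u := fun u => by
    rw [f₆.1 41 (by decide), f₅.1 41 (by decide), f₄.1 41 (by decide), hL₀]
  have a43 : ∀ u, σ₆.nat 43 u 0 = L₁ u := fun u => by
    rw [f₆.1 43 (by decide), f₅.1 43 (by decide), f₄.1 43 (by decide), hL₁]
  have a42 : ∀ u, σ₆.nat 42 u 0 = D.joinComp t C₁ C₂ u := fun u => by
    have := congrFun w₆ u
    rw [f₅.1 42 (by decide), f₄.1 42 (by decide), f₅.1 44 (by decide), f₄.1 44 (by decide)] at this
    simpa only [hC₁, hC₂] using this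
  have b40 : ∀ u, σ₇.nat 40 u 0 = C₀ u := fun u => by rw [f₇.1 40 (by decide), a40]
  have b43 : ∀ u, σ₇.nat 43 u 0 = D.introLabel t L₀ L₁ u := fun u => by
    have := congrFun u₇ u
    simpa only [a41, a43] using this
  have b42 : ∀ u, σ₇.nat 42 u 0 = if D.kind t = 1 then
      Function.update (D.joinComp t C₁ C₂) (D.lab t 0) (C₀ (D.lab t 0)) u
      else D.joinComp t C₁ C₂ u := fun u => by
    have := congrFun w₇ u
    simp only [a42, a40] at this
    rw [this]
    split_ifs <;> rfl
  have c42 : ∀ u, σ₈.nat 42 u 0 = D.introComp t C₀ (D.joinComp t C₁ C₂) u := fun u => by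
    have := congrFun w₈ u
    simp only [b42, b40] at this
    rw [this]
    unfold TreeData.introComp
    by_cases e1 : D.kind t = 1
    · simp [e1]
    · simp only [if_neg e1]
  have c43 : ∀ u, σ₈.nat 43 u 0 = D.introLabel t L₀ L₁ u := fun u => by
    rw [f₈.1 43 (by decide), b43]
  have d42 : ∀ u, σ₉.nat 42 u 0 = D.introComp t C₀ (D.joinComp t C₁ C₂) u := fun u => by
    rw [f₉.1 42 (by decide), c42]
  have d43 : ∀ u, σ₉.nat 43 u 0 = D.introLabel t L₀ L₁ u := fun u => by
    rw [f₉.1 43 (by decide), c43]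
  have d40 : ∀ u, σ₉.nat 40 u 0 = C₀ u := fun u => by
    rw [f₉.1 40 (by decide), f₈.1 40 (by decide), b40]
  have d41 : ∀ u, σ₉.nat 41 u 0 = L₀ u := fun u => by
    rw [f₉.1 41 (by decide), f₈.1 41 (by decide), f₇.1 41 (by decide), a41]
  have hL : D.kind t ≠ 1 → D.introLabel t L₀ L₁ = L₁ := fun e => by
    rw [TreeData.introLabel, if_neg e]
  have hC : D.kind t = 3 → D.introComp t C₀ (D.joinComp t C₁ C₂) = D.joinComp t C₁ C₂ := fun e => by
    rw [TreeData.introComp, if_neg (by omega), if_neg (by omega)]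
  simp only [v₄, f₄.1 43 (by decide), f₄.1 45 (by decide), hL₁, hL₂] at v₅
  rw [← f₆.1 46 (by decide)] at v₅
  simp only [a42, a40] at v₇
  simp only [b40, b43] at v₈
  simp only [c43] at v₉ r₉
  have u₉' : σ₉.nat 47 0 0 = if D.kind t = 3 ∧ D.Alone (D.fst t) (D.joinComp t C₁ C₂) (D.lab t 0)
      then 1 else 0 := by
    rw [u₉]
    refine ite_congr_iff (and_congr_right fun e3 => ?_) _ _
    simp only [c42, hC e3]
  rw [u₉'] at v
  simp only [d40, d41, d42, d43] at v
  refine ⟨?_, ?_⟩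
  · rw [v, ite_eq_one_iff, v₉, ite_eq_one_iff, v₈, ite_eq_one_iff, v₇, ite_eq_one_iff, v₅,
      ite_eq_one_iff]
    -- The loaded arrays agree with the coded states only on the bags; `Step.congr` says that other
    -- entries do not matter.
    have key : D.Step k t ⟨C₀, L₀, P.dec e (2 * P.m)⟩ ⟨C₁, L₁, P.dec e₁ (2 * P.m)⟩
        ⟨C₂, L₂, P.dec e₂ (2 * P.m)⟩ ↔ D.Step k t (P.state D t e) (P.state D (D.fst t) e₁)
        (P.state D (D.snd t) e₂) :=
      ⟨fun hs => hs.congr hD ht g₀ g₁ g₂ rfl rfl rfl,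
        fun hs => hs.congr hD ht (fun u hu => ⟨(g₀ u hu).1.symm, (g₀ u hu).2.symm⟩)
          (fun u hu => ⟨(g₁ u hu).1.symm, (g₁ u hu).2.symm⟩)
          (fun u hu => ⟨(g₂ u hu).1.symm, (g₂ u hu).2.symm⟩) rfl rfl rfl⟩
    rw [← key]
    constructor
    · rintro ⟨⟨⟨⟨⟨-, p₁⟩, p₂⟩, p₃⟩, p₄⟩, p₅, p₆⟩
      refine ⟨p₁, p₂, fun e2 => ?_, fun e3 => ?_, fun u hu => (p₅ u hu).1, fun u hu => (p₅ u hu).2,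
        ?_⟩
      · have := p₃ e2
        rwa [hL (by omega)] at this
      · have := p₄ e3
        rwa [hL (by omega)] at this
      · exact p₆
    · intro hs
      refine ⟨⟨⟨⟨⟨rfl, hs.labels⟩, hs.fresh⟩, fun e2 => ?_⟩, fun e3 => ?_⟩,
        fun u hu => ⟨hs.comp u hu, hs.label u hu⟩, hs.count⟩
      · rw [hL (by omega)]
        exact hs.merge e2
      · rw [hL (by omega)]
        exact hs.label_lt e3
  · rw [f.2 1 (by decide), r₉, DPTables.stepCost]
    by_cases e3 : D.kind t = 3
    · rw [if_pos e3, if_pos e3, hL (by omega), (g₁ _ (hD.forget t ht e3).2.2.1).2]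
    · rw [if_neg e3, if_neg e3]

end ConnectedKMeans

/-! ### The table of the dynamic program -/

namespace ConnectedKMeans

open RAMProgram NatExp TestExp

/-- Total cost of the states `22` and `23` of the children, to which the transition adds
cell `0` of array `1`. -/
def addChildCosts : Code :=
  setReal 1 zero zero (RealExp.add (RealExp.add (RealExp.read 0 fstChild (cell 22))
    (RealExp.read 0 sndChild (cell 23))) (RealExp.read 1 zero zero))

def recordState : Code :=
  seq (setNat 30 (cell 19) (cell 21) one)
    (seq (setReal 0 (cell 19) (cell 21) (RealExp.read 1 zero zero))
      (seq (setNat 31 (cell 19) (cell 21) (cell 22)) (setNat 32 (cell 19) (cell 21) (cell 23))))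

/-- A target state is recorded if it is new or strictly cheaper than before. The codes of the
children are recorded with it and later serve as pointers to recover a solution. -/
def tryStates : Code :=
  ite (and (natEq (read 30 fstChild (cell 22)) one) (natEq (read 30 sndChild (cell 23)) one))
    (seq transition (seq addChildCosts
      (ite (and (natEq (cell 46) one) (not (and (natEq (read 30 (cell 19) (cell 21)) one)
          (realLe (RealExp.read 0 (cell 19) (cell 21)) (RealExp.read 1 zero zero)))))
        recordState skip)))
    skip

def fillRow : Code :=
  forLoop 21 (cell 15) (forLoop 22 (cell 15) (forLoop 23 (cell 15) tryStates))

/-- Running backwards through the order treats children before parents. The missing child `N` is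
given the single reachable state `0`; its cost is the initial value zero of the memory. -/
def fillTable : Code :=
  seq (setNat 30 numNodes zero one)
    (forLoop 20 numNodes
      (seq (assign 19 (entry 17 (sub numNodes (add (cell 20) one)))) fillRow))

end ConnectedKMeans

/-- The code `e` can arise at `t` from the codes `e₁` and `e₂` at the children. -/
def DPTables.CanStep (P : DPTables) (D : TreeData) (k t e e₁ e₂ : ℕ) : Prop :=
  D.Step k t (P.state D t e) (P.state D (D.fst t) e₁) (P.state D (D.snd t) e₂)

/-- The cost of a state that arises from the codes `e₁` and `e₂`, where the memory `σ` holds the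
costs of these. -/
noncomputable def DPTables.childCost (P : DPTables) (D : TreeData) (x : RAMInput ConnSymbol)
    (σ : RAMStore) (t e₁ e₂ : ℕ) : ℝ :=
  σ.real 0 (D.fst t) e₁ + σ.real 0 (D.snd t) e₂ + P.stepCost D x t (P.state D (D.fst t) e₁)

/-- The row of `t` in `τ` has been filled using the rows of `σ`, and the triples in `V` have been
taken into account. -/
structure RowFilled (x : RAMInput ConnSymbol) (N k : ℕ) (P : DPTables) (t : ℕ)
    (V : ℕ → ℕ → ℕ → Prop) (σ τ : RAMStore) : Prop where
  sound : ∀ e, τ.nat 30 t e = 1 →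
    σ.nat 30 ((x.treeData N).fst t) (τ.nat 31 t e) = 1 ∧
    σ.nat 30 ((x.treeData N).snd t) (τ.nat 32 t e) = 1 ∧
    P.CanStep (x.treeData N) k t e (τ.nat 31 t e) (τ.nat 32 t e) ∧
    τ.real 0 t e = P.childCost (x.treeData N) x σ t (τ.nat 31 t e) (τ.nat 32 t e)
  opt : ∀ e e₁ e₂, V e e₁ e₂ → σ.nat 30 ((x.treeData N).fst t) e₁ = 1 →
    σ.nat 30 ((x.treeData N).snd t) e₂ = 1 → P.CanStep (x.treeData N) k t e e₁ e₂ →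
    τ.nat 30 t e = 1 ∧ τ.real 0 t e ≤ P.childCost (x.treeData N) x σ t e₁ e₂

/-- The tables of `σ` and `τ` agree outside of row `t`. -/
structure SameRows (t : ℕ) (σ τ : RAMStore) : Prop where
  reached : ∀ s ≠ t, ∀ e, τ.nat 30 s e = σ.nat 30 s e
  fst : ∀ s ≠ t, ∀ e, τ.nat 31 s e = σ.nat 31 s e
  snd : ∀ s ≠ t, ∀ e, τ.nat 32 s e = σ.nat 32 s e
  cost : ∀ s ≠ t, ∀ e, τ.real 0 s e = σ.real 0 s e

namespace ConnectedKMeans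

open RAMProgram

variable {x : RAMInput ConnSymbol} {X M N n k : ℕ} {σ σ' τ : RAMStore} {P : DPTables}
  {Adj : ℕ → ℕ → Prop} {t : ℕ} {V V' : ℕ → ℕ → ℕ → Prop}

/-- Progress in filling the row of `t`. -/
structure RowInv (x : RAMInput ConnSymbol) (N k : ℕ) (P : DPTables) (t : ℕ)
    (V : ℕ → ℕ → ℕ → Prop) (σ τ : RAMStore) : Prop
    extends RowFilled x N k P t V σ τ, SameRows t σ τ

theorem RowInv.weaken (h : RowInv x N k P t V σ τ)
    (hV : ∀ e e₁ e₂, V' e e₁ e₂ → V e e₁ e₂) : RowInv x N k P t V' σ τ :=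
  ⟨⟨h.sound, fun e e₁ e₂ hv => h.opt e e₁ e₂ (hV e e₁ e₂ hv)⟩, h.toSameRows⟩

theorem RowInv.congr (h : RowInv x N k P t V σ τ) (h30 : σ'.nat 30 = τ.nat 30)
    (h31 : σ'.nat 31 = τ.nat 31) (h32 : σ'.nat 32 = τ.nat 32) (hr : σ'.real 0 = τ.real 0) :
    RowInv x N k P t V σ σ' := by
  refine ⟨⟨?_, ?_⟩, ⟨?_, ?_, ?_, ?_⟩⟩
  · rw [h30, h31, h32, hr]; exact h.sound
  · rw [h30, hr]; exact h.opt
  · rw [h30]; exact h.reached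
  · rw [h31]; exact h.fst
  · rw [h32]; exact h.snd
  · rw [hr]; exact h.cost

theorem RowInv.record {e e₁ e₂ : ℕ} {c : ℝ} (h : RowInv x N k P t V σ τ)
    (h30 : ∀ s i, σ'.nat 30 s i = if s = t ∧ i = e then 1 else τ.nat 30 s i)
    (h31 : ∀ s i, σ'.nat 31 s i = if s = t ∧ i = e then e₁ else τ.nat 31 s i)
    (h32 : ∀ s i, σ'.nat 32 s i = if s = t ∧ i = e then e₂ else τ.nat 32 s i)
    (hr : ∀ s i, σ'.real 0 s i = if s = t ∧ i = e then c else τ.real 0 s i)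
    (hc : c = P.childCost (x.treeData N) x σ t e₁ e₂)
    (hlt : τ.nat 30 t e = 1 → c ≤ τ.real 0 t e)
    (h₁ : σ.nat 30 ((x.treeData N).fst t) e₁ = 1) (h₂ : σ.nat 30 ((x.treeData N).snd t) e₂ = 1)
    (hs : P.CanStep (x.treeData N) k t e e₁ e₂) :
    RowInv x N k P t (fun a b c => V a b c ∨ a = e ∧ b = e₁ ∧ c = e₂) σ σ' := by
  refine ⟨⟨?_, ?_⟩, ⟨?_, ?_, ?_, ?_⟩⟩
  · intro i
    rw [h30, h31, h32, hr]
    by_cases hi : i = e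
    · subst hi
      simp only [and_self, if_true]
      exact fun _ => ⟨h₁, h₂, hs, hc⟩
    · simp only [hi, and_false, if_false]
      exact h.sound i
  · intro i i₁ i₂ hv g₁ g₂ gs
    rw [h30, hr]
    by_cases hi : i = e
    · subst hi
      simp only [and_self, if_true, true_and]
      rcases hv with hv | ⟨-, rfl, rfl⟩
      · obtain ⟨q₁, q₂⟩ := h.opt i i₁ i₂ hv g₁ g₂ gs
        exact (hlt q₁).trans q₂
      · exact hc.le
    · simp only [hi, and_false, if_false]
      exact h.opt i i₁ i₂ (hv.resolve_right fun q => hi q.1) g₁ g₂ gs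
  · intro s hs' i; rw [h30, if_neg fun q => hs' q.1]; exact h.reached s hs' i
  · intro s hs' i; rw [h31, if_neg fun q => hs' q.1]; exact h.fst s hs' i
  · intro s hs' i; rw [h32, if_neg fun q => hs' q.1]; exact h.snd s hs' i
  · intro s hs' i; rw [hr, if_neg fun q => hs' q.1]; exact h.cost s hs' i

theorem runs_tryStates {e e₁ e₂ : ℕ} (hk : ∀ i j, x.nat ConnSymbol.numClusters i j = k)
    (hD : (x.treeData N).IsNice n Adj) (h : AtNode x N P t τ) (ht : t < N)
    (hX : ∀ s, (x.treeData N).size s ≤ X)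
    (hfst : (x.treeData N).fst t ≠ t) (hsnd : (x.treeData N).snd t ≠ t)
    (h21 : τ.nat 21 0 0 = e) (h22 : τ.nat 22 0 0 = e₁) (h23 : τ.nat 23 0 0 = e₂)
    (hI : RowInv x N k P t V σ τ) :
    Runs x X 1 tryStates τ
      (RowInv x N k P t (fun a b c => V a b c ∨ a = e ∧ b = e₁ ∧ c = e₂) σ) := by
  set D := x.treeData N with hDdef
  -- The children differ from `t`, so their rows are still those of `σ`.
  have hr₁ : τ.nat 30 (D.fst t) e₁ = σ.nat 30 (D.fst t) e₁ := hI.reached _ hfst _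
  have hr₂ : τ.nat 30 (D.snd t) e₂ = σ.nat 30 (D.snd t) e₂ := hI.reached _ hsnd _
  refine Runs.ite le_rfl (fun hb => ?_) (fun hb => Runs.skip le_rfl ?_)
  · simp only [TestExp.holds, NatExp.eval, h.node, h.fst t ht, h.snd t ht, h22, h23, ← hDdef,
      hr₁, hr₂] at hb
    have g₁ : σ.nat 30 (D.fst t) e₁ = 1 := by omega
    have g₂ : σ.nat 30 (D.snd t) e₂ = 1 := by omega
    refine Runs.seq ((runs_transition hk hD h ht hX h21 h22 h23).frame fun υ f hυ => ?_)
    obtain ⟨hok, hcost⟩ := hυ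
    have hI' : RowInv x N k P t V σ υ := hI.congr (f.1 30 (by decide)) (f.1 31 (by decide))
      (f.1 32 (by decide)) (f.2 0 (by decide))
    have h' : AtNode x N P t υ := h.congr f (by decide)
    have h21' : υ.nat 21 0 0 = e := by rw [f.1 21 (by decide), h21]
    have h22' : υ.nat 22 0 0 = e₁ := by rw [f.1 22 (by decide), h22]
    have h23' : υ.nat 23 0 0 = e₂ := by rw [f.1 23 (by decide), h23]
    refine Runs.seq (Runs.setReal le_rfl ?_)
    have hc : RealExp.eval x υ (RealExp.add (RealExp.add (RealExp.read 0 fstChild (cell 22))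
        (RealExp.read 0 sndChild (cell 23))) (RealExp.read 1 zero zero)) =
        P.childCost D x σ t e₁ e₂ := by
      simp only [RealExp.eval, NatExp.eval, h'.node, h'.fst t ht, h'.snd t ht, h22', h23', ← hDdef,
        hcost, hI'.cost _ hfst, hI'.cost _ hsnd, DPTables.childCost]
    rw [hc]
    refine Runs.ite le_rfl (fun hb' => ?_) (fun hb' => Runs.skip le_rfl ?_)
    · simp only [TestExp.holds, NatExp.eval, RealExp.eval, RAMStore.setReal_nat,
        RAMStore.setReal_real, h'.node, h21'] at hb'
      simp only [and_self, if_true, false_and, if_false, zero_ne_one] at hb'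
      have hs : P.CanStep D k t e e₁ e₂ := hok.1 (by omega)
      refine Runs.seq (Runs.setNat le_rfl (Runs.seq (Runs.setReal le_rfl (Runs.seq
        (Runs.setNat le_rfl (Runs.setNat le_rfl ?_))))))
      refine hI'.record (e := e) (e₁ := e₁) (e₂ := e₂) (c := P.childCost D x σ t e₁ e₂) ?_ ?_ ?_ ?_
        rfl ?_ g₁ g₂ hs
      · intro s i
        simp [NatExp.eval, h'.node, h21']
      · intro s i
        simp [NatExp.eval, h'.node, h21', h22']
      · intro s i
        simp [NatExp.eval, h'.node, h21', h23']
      · intro s i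
        simp [NatExp.eval, RealExp.eval, h'.node, h21']
      · intro q
        by_contra hcon
        exact hb'.2 ⟨by omega, (not_le.1 hcon).le⟩
    · simp only [TestExp.holds, NatExp.eval, RealExp.eval, RAMStore.setReal_nat,
        RAMStore.setReal_real, h'.node, h21'] at hb'
      simp only [and_self, if_true, false_and, if_false, zero_ne_one] at hb'
      have hI₂ : RowInv x N k P t V σ (υ.setReal 1 (NatExp.eval x υ zero) (NatExp.eval x υ zero)
          (P.childCost D x σ t e₁ e₂)) := hI'.congr rfl rfl rfl (by funext s i; simp)
      refine ⟨⟨hI₂.sound, ?_⟩, hI₂.toSameRows⟩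
      rintro a b c (hv | ⟨rfl, rfl, rfl⟩) q₁ q₂ qs
      · exact hI₂.opt a b c hv q₁ q₂ qs
      · have h46 : υ.nat 46 0 0 = 1 := hok.2 qs
        by_contra hcon
        refine hb' ⟨by omega, fun q => hcon ⟨?_, ?_⟩⟩
        · simp only [RAMStore.setReal_nat]; omega
        · simpa using q.2
  · simp only [TestExp.holds, NatExp.eval, h.node, h.fst t ht, h.snd t ht, h22, h23, ← hDdef,
      hr₁, hr₂] at hb
    refine ⟨⟨hI.sound, ?_⟩, hI.toSameRows⟩
    rintro a b c (hv | ⟨rfl, rfl, rfl⟩) q₁ q₂ qs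
    · exact hI.opt a b c hv q₁ q₂ qs
    · exact absurd ⟨⟨q₁.le, q₁.ge⟩, ⟨q₂.le, q₂.ge⟩⟩ hb

theorem runs_fillRow (hk : ∀ i j, x.nat ConnSymbol.numClusters i j = k)
    (hD : (x.treeData N).IsNice n Adj) (h : AtNode x N P t σ) (ht : t < N)
    (hX : ∀ s, (x.treeData N).size s ≤ X) (hE : P.E ≤ X)
    (hfst : (x.treeData N).fst t ≠ t) (hsnd : (x.treeData N).snd t ≠ t)
    (h0 : ∀ e, σ.nat 30 t e = 0) :
    Runs x X 1 fillRow σ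
      (RowInv x N k P t (fun a b c => a < P.E ∧ b < P.E ∧ c < P.E) σ) := by
  have hcong : ∀ {V : ℕ → ℕ → ℕ → Prop} {a : ℕ} {τ τ' : RAMStore}, a ∉ [30, 31, 32] →
      (∀ a' ≠ a, τ'.nat a' = τ.nat a') → τ'.real = τ.real → RowInv x N k P t V σ τ →
      RowInv x N k P t V σ τ' := by
    intro V a τ τ' ha h' hr hI
    simp only [List.mem_cons, List.not_mem_nil, or_false, not_or] at ha
    exact hI.congr (h' 30 (by omega)) (h' 31 (by omega)) (h' 32 (by omega)) (by rw [hr])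
  refine Runs.forLoop
    (fun i τ => RowInv x N k P t (fun a b c => a < i ∧ b < P.E ∧ c < P.E) σ τ) P.E h.E le_rfl hE
    (by decide) ?_ (fun i τ τ' => hcong (by decide)) ?_ (fun τ _ hI => hI)
  · refine ⟨⟨fun e he => ?_, fun _ _ _ hv => absurd hv.1 (Nat.not_lt_zero _)⟩,
      ⟨fun _ _ _ => rfl, fun _ _ _ => rfl, fun _ _ _ => rfl, fun _ _ _ => rfl⟩⟩
    rw [h0] at he
    omega
  intro i hi τ f hci hI
  have hτ : AtNode x N P t τ := h.congr f (by decide)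
  refine Runs.forLoop (fun j υ => RowInv x N k P t
      (fun a b c => (a < i ∧ b < P.E ∧ c < P.E) ∨ a = i ∧ b < j ∧ c < P.E) σ υ) P.E hτ.E
    le_rfl hE (by decide) ?_ (fun i τ τ' => hcong (by decide)) ?_ ?_
  · exact hI.weaken fun a b c => by omega
  · intro j hj υ f' hcj hI'
    have hυ : AtNode x N P t υ := hτ.congr f' (by decide)
    refine Runs.forLoop (fun l ω => RowInv x N k P t
      (fun a b c => ((a < i ∧ b < P.E ∧ c < P.E) ∨ a = i ∧ b < j ∧ c < P.E) ∨
        a = i ∧ b = j ∧ c < l) σ ω) P.E hυ.E le_rfl hE (by decide) ?_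
      (fun i τ τ' => hcong (by decide)) ?_ ?_
    · exact hI'.weaken fun a b c => by omega
    · intro l hl ω f'' hcl hI''
      have hω : AtNode x N P t ω := hυ.congr f'' (by decide)
      refine (runs_tryStates (e := i) (e₁ := j) (e₂ := l) hk hD hω ht hX hfst hsnd
        (by rw [f''.1 21 (by decide), f'.1 21 (by decide), hci])
        (by rw [f''.1 22 (by decide), hcj]) hcl hI'').weaken fun ρ hρ => ?_
      exact hρ.weaken fun a b c => by omega
    · exact fun ω _ hω => hω.weaken fun a b c => by omega
  · exact fun υ _ hυ => hυ.weaken fun a b c => by omega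

/-- The table of the dynamic program has been filled for the nodes satisfying `done`. -/
structure Filled (x : RAMInput ConnSymbol) (N k : ℕ) (P : DPTables) (done : ℕ → Prop)
    (σ : RAMStore) : Prop where
  row : ∀ t < N, done t →
    RowFilled x N k P t (fun a b c => a < P.E ∧ b < P.E ∧ c < P.E) σ σ
  empty : ∀ t < N, ¬ done t → ∀ e, σ.nat 30 t e = 0
  reached_num : ∀ e, σ.nat 30 N e = if e = 0 then 1 else 0
  cost_num : σ.real 0 N 0 = 0

theorem Filled.congr {done : ℕ → Prop} (h : Filled x N k P done σ) (h30 : τ.nat 30 = σ.nat 30)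
    (h31 : τ.nat 31 = σ.nat 31) (h32 : τ.nat 32 = σ.nat 32) (hr : τ.real 0 = σ.real 0) :
    Filled x N k P done τ := by
  refine ⟨fun t ht hd => ⟨?_, ?_⟩, ?_, ?_, ?_⟩
  · simp only [h30, h31, h32, hr, DPTables.childCost]; exact (h.row t ht hd).sound
  · simp only [h30, hr, DPTables.childCost]; exact (h.row t ht hd).opt
  · rw [h30]; exact h.empty
  · rw [h30]; exact h.reached_num
  · rw [hr]; exact h.cost_num

/-- A finished row refers only to itself and to the rows of the children, none of which is the row
`t` being rewritten. -/
theorem RowFilled.of_sameRows {s : ℕ} (h : RowFilled x N k P s V σ σ) (hr : SameRows t σ τ)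
    (hs : s ≠ t) (hfst : (x.treeData N).fst s ≠ t) (hsnd : (x.treeData N).snd s ≠ t) :
    RowFilled x N k P s V τ τ := by
  refine ⟨?_, ?_⟩
  · simp only [hr.reached _ hs, hr.fst _ hs, hr.snd _ hs, hr.cost _ hs, hr.reached _ hfst,
      hr.reached _ hsnd, hr.cost _ hfst, hr.cost _ hsnd, DPTables.childCost]
    exact h.sound
  · simp only [hr.reached _ hs, hr.cost _ hs, hr.reached _ hfst,
      hr.reached _ hsnd, hr.cost _ hfst, hr.cost _ hsnd, DPTables.childCost]
    exact h.opt

theorem RowInv.filled (h : RowInv x N k P t V σ τ) (hfst : (x.treeData N).fst t ≠ t)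
    (hsnd : (x.treeData N).snd t ≠ t) : RowFilled x N k P t V τ τ := by
  refine ⟨?_, ?_⟩
  · simp only [h.reached _ hfst, h.reached _ hsnd, h.cost _ hfst, h.cost _ hsnd,
      DPTables.childCost]
    exact h.sound
  · simp only [h.reached _ hfst, h.reached _ hsnd, h.cost _ hfst, h.cost _ hsnd,
      DPTables.childCost]
    exact h.opt

theorem _root_.TreeData.IsOrder.fst_ne {D : TreeData} {ord : ℕ → ℕ} (ho : D.IsOrder ord)
    {i j : ℕ} (hi : i < D.num) (hj : j ≤ i) : D.fst (ord i) ≠ ord j := by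
  intro e
  obtain ⟨l, h₁, h₂, h₃⟩ := ho.fst_later i hi (e ▸ ho.lt j (by omega))
  have := ho.inj l h₂ j (by omega) (h₃.trans e)
  omega

theorem _root_.TreeData.IsOrder.snd_ne {D : TreeData} {ord : ℕ → ℕ} (ho : D.IsOrder ord)
    {i j : ℕ} (hi : i < D.num) (hj : j ≤ i) : D.snd (ord i) ≠ ord j := by
  intro e
  obtain ⟨l, h₁, h₂, h₃⟩ := ho.snd_later i hi (e ▸ ho.lt j (by omega))
  have := ho.inj l h₂ j (by omega) (h₃.trans e)
  omega

theorem runs_fillTable (hk : ∀ i j, x.nat ConnSymbol.numClusters i j = k)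
    (hN : ∀ i j, x.nat ConnSymbol.numNodes i j = N) (hD : (x.treeData N).IsNice n Adj)
    (ho : (x.treeData N).IsOrder P.ord) (h : Prepared x N P σ)
    (hX : ∀ s, (x.treeData N).size s ≤ X) (hE : P.E ≤ X) (hM : N < M)
    (h0 : ∀ t e, σ.nat 30 t e = 0) (hr : σ.real 0 N 0 = 0) :
    Runs x X M fillTable σ (Filled x N k P fun _ => True) := by
  refine Runs.seq (Runs.setNat (by omega) ?_)
  set σ' := σ.setNat 30 (NatExp.eval x σ numNodes) (NatExp.eval x σ zero) (NatExp.eval x σ one)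
    with hσ'
  have f' : SameOutside [30] [] σ σ' := SameOutside.setNat _ _ _ _ (by simp)
  have h' : Prepared x N P σ' := h.congr f' (by decide)
  refine Runs.forLoop_large
    (fun i τ => Filled x N k P (fun t => ∃ j, N - i ≤ j ∧ j < N ∧ P.ord j = t) τ) N
    (by simp [NatExp.eval, hN]) hM (by decide) ?_ ?_ ?_ ?_
  · refine ⟨fun t _ hd => ?_, fun t ht _ e => ?_, fun e => ?_, hr⟩
    · obtain ⟨j, h₁, h₂, -⟩ := hd
      omega
    · simp [hσ', NatExp.eval, hN, h0, ht.ne]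
    · simp [hσ', NatExp.eval, hN, h0]
  · exact fun i τ τ' h' hr' hI => hI.congr (h' 30 (by decide)) (h' 31 (by decide))
      (h' 32 (by decide)) (by rw [hr'])
  · intro i hi τ f hci hI
    refine Runs.seq (Runs.setNat le_rfl ?_)
    have hτ : Prepared x N P τ := h'.congr f (by decide)
    have e : NatExp.eval x τ (entry 17 (NatExp.sub numNodes (NatExp.add (cell 20) one))) =
        P.ord (N - (i + 1)) := by simp only [NatExp.eval, hci, hN, hτ.ord]
    rw [e]
    set t := P.ord (N - (i + 1)) with ht
    have htN : t < N := ho.lt _ (show N - (i + 1) < N by omega)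
    set υ := τ.setNat 19 (NatExp.eval x τ zero) (NatExp.eval x τ zero) t with hυ
    have fυ : SameOutside [19] [] τ υ := SameOutside.setNat _ _ _ _ (by simp)
    have hIυ := hI.congr (fυ.1 30 (by decide)) (fυ.1 31 (by decide)) (fυ.1 32 (by decide))
      (fυ.2 0 (by decide))
    have hat : AtNode x N P t υ := ⟨hτ.congr fυ (by decide), by simp [hυ, NatExp.eval]⟩
    have hf : (x.treeData N).fst t ≠ t := ho.fst_ne (show N - (i + 1) < N by omega) le_rfl
    have hs : (x.treeData N).snd t ≠ t := ho.snd_ne (show N - (i + 1) < N by omega) le_rfl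
    have hnew : ¬ ∃ j, N - i ≤ j ∧ j < N ∧ P.ord j = t := by
      rintro ⟨j, h₁, h₂, h₃⟩
      have := ho.inj j h₂ (N - (i + 1)) (show N - (i + 1) < N by omega) h₃
      omega
    refine (runs_fillRow hk hD hat htN hX hE hf hs (hIυ.empty t htN hnew)).weaken fun ω hω => ?_
    refine ⟨fun s hsN hd => ?_, fun s hsN hd c => ?_, fun c => ?_, ?_⟩
    · by_cases hst : s = t
      · rw [hst]
        exact hω.filled hf hs
      · obtain ⟨j, h₁, h₂, rfl⟩ := hd
        have hj : N - i ≤ j := by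
          by_contra hcon
          have : j = N - (i + 1) := by omega
          exact hst (by rw [this])
        -- The children of a finished node stand still later in the order, so they are not the node
        -- treated now.
        refine RowFilled.of_sameRows (hIυ.row _ hsN ⟨j, hj, h₂, rfl⟩) hω.toSameRows hst
          (ho.fst_ne h₂ ?_) (ho.snd_ne h₂ ?_) <;> omega
    · have hst : s ≠ t := by
        rintro rfl
        exact hd ⟨N - (i + 1), le_rfl, by omega, rfl⟩
      rw [hω.reached s hst]
      exact hIυ.empty s hsN (fun ⟨j, h₁, h₂, h₃⟩ => hd ⟨j, by omega, h₂, h₃⟩) c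
    · rw [hω.reached N htN.ne']
      exact hIυ.reached_num c
    · rw [hω.cost N htN.ne']
      exact hIυ.cost_num
  · intro τ _ hI
    refine ⟨fun t ht _ => hI.row t ht ?_, fun _ _ hc => absurd trivial hc, hI.reached_num,
      hI.cost_num⟩
    obtain ⟨j, hj, e⟩ := ho.exists_eq (show t < (x.treeData N).num from ht)
    exact ⟨j, by omega, hj, e⟩

end ConnectedKMeans

/-! ### Reading off a solution -/

namespace ConnectedKMeans

open RAMProgram NatExp TestExp

abbrev rootNode : Index := input ConnSymbol.root zero zero

abbrev numPoints : Index := input ConnSymbol.numPoints zero zero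

/-- Store a cheapest state of the root with the right number of clusters, or the number of codes
if there is none. -/
def chooseBest : Code :=
  seq (assign 50 (cell 15))
    (forLoop 21 (cell 15)
      (ite (and (and (natEq (read 30 rootNode (cell 21)) one)
            (natEq (read 16 (cell 21) (add (cell 13) (cell 13))) numClusters))
          (not (and (not (natEq (cell 50) (cell 15)))
            (realLe (RealExp.read 0 rootNode (cell 50)) (RealExp.read 0 rootNode (cell 21))))))
        (assign 50 (cell 21)) skip))

/-- The pointers recorded at a node fix the states of its children, from the root downwards. A
missing child causes a harmless write to the entry of `N`. -/
def selectStates : Code :=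
  seq (setNat 51 rootNode zero (cell 50))
    (forLoop 20 numNodes
      (seq (assign 19 (entry 17 (cell 20)))
        (seq (setNat 51 fstChild zero (read 31 (cell 19) (entry 51 (cell 19))))
          (setNat 51 sndChild zero (read 32 (cell 19) (entry 51 (cell 19)))))))

/-- Put the forgotten vertex into the cluster of a vertex of its component, if there is one. -/
def joinCluster : Code :=
  seq (assign 47 one)
    (forLoop 24 (entry 10 fstChild)
      (ite (and (not (natEq (bagAt fstChild (cell 24)) (labelAt 0)))
          (natEq (entry 42 (bagAt fstChild (cell 24))) (entry 42 (labelAt 0))))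
        (seq (assign 47 zero) (setNat 1 (labelAt 0) zero (entry 1 (bagAt fstChild (cell 24)))))
        skip))

def newCluster : Code :=
  seq (setNat 1 (labelAt 0) zero (cell 52))
    (seq (setNat 0 (cell 52) zero (labelAt 0))
      (seq (setNat 53 (cell 52) zero (entry 43 (labelAt 0))) (assign 52 (add (cell 52) one))))

def assignVertex : Code :=
  seq (loadState 42 43 fstChild (entry 51 fstChild))
    (seq joinCluster (ite (natEq (cell 47) one) newCluster skip))

def assignClusters : Code :=
  seq (assign 52 zero)
    (forLoop 20 numNodes
      (seq (assign 19 (entry 17 (cell 20))) (ite (kindIs 3) assignVertex skip)))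

/-- The center, chosen by the algorithm for unconstrained `k`-means, for the cluster of the
vertex `20`. -/
abbrev targetCenter : Index := entry 100 (entry 53 (entry 1 (cell 20)))

/-- The center of a cluster moves to each vertex that is at least as close to the target center, and
so ends at a member of the cluster closest to it. -/
def improveCenters : Code :=
  forLoop 20 numPoints
    (ite (realLe (RealExp.dist (cell 20) targetCenter)
        (RealExp.dist (entry 0 (entry 1 (cell 20))) targetCenter))
      (setNat 0 (entry 1 (cell 20)) zero (cell 20)) skip)

end ConnectedKMeans

namespace TreeData

variable {D : TreeData} {n : ℕ} {Adj : ℕ → ℕ → Prop} {ord : ℕ → ℕ}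

/-- Every node is a child at most once. -/
theorem IsOrder.child_unique (ho : D.IsOrder ord) {s : ℕ} (hs : s < D.num) :
    (∀ i < D.num, ∀ j < D.num, i ≠ j → D.fst (ord i) = s ∨ D.snd (ord i) = s →
      ¬ (D.fst (ord j) = s ∨ D.snd (ord j) = s)) ∧
    ∀ i < D.num, ¬ (D.fst (ord i) = s ∧ D.snd (ord i) = s) := by
  classical
  -- Applied to the indicator of `s`, the identity counts how often `s` is a child; the total is at
  -- most `1`.
  have hsum := ho.sum_children (fun t => if t = s then 1 else 0) (if_neg (by omega))
  have h₁ : ∑ i ∈ Finset.range D.num, (if ord i = s then (1 : ℝ) else 0) = 1 := by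
    obtain ⟨j, hj, e⟩ := ho.exists_eq hs
    rw [Finset.sum_eq_single j]
    · rw [if_pos e]
    · intro i hi hij
      exact if_neg fun e' => hij (ho.inj i (Finset.mem_range.1 hi) j hj (e'.trans e.symm))
    · exact fun h => absurd (Finset.mem_range.2 hj) h
  set f : ℕ → ℝ := fun i => (if D.fst (ord i) = s then 1 else 0) + if D.snd (ord i) = s then 1 else 0
    with hf
  have hf0 : ∀ i, 0 ≤ f i := fun i => by simp only [hf]; split_ifs <;> norm_num
  have hle : ∑ i ∈ Finset.range D.num, f i ≤ 1 := by
    have : (0 : ℝ) ≤ if D.root = s then 1 else 0 := by split_ifs <;> norm_num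
    linarith
  have hf1 : ∀ i, D.fst (ord i) = s ∨ D.snd (ord i) = s → 1 ≤ f i := by
    rintro i (e | e) <;> simp only [hf, e, if_true] <;> split_ifs <;> norm_num
  refine ⟨fun i hi j hj hij hi' hj' => ?_, fun i hi hi' => ?_⟩
  · have := Finset.sum_le_sum_of_subset_of_nonneg (f := f) (s := {i, j}) (t := Finset.range D.num)
      (by simp [Finset.insert_subset_iff, hi, hj]) fun i _ _ => hf0 i
    rw [Finset.sum_pair hij] at this
    linarith [hf1 i hi', hf1 j hj']
  · have := Finset.single_le_sum (f := f) (fun i _ => hf0 i) (Finset.mem_range.2 hi)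
    have : f i = 2 := by simp only [hf, hi'.1, hi'.2, if_true]; norm_num
    linarith

/-- A vertex that is forgotten late is not in the bag where another vertex is forgotten earlier,
as long as it is not that vertex. -/
theorem ne_of_forgotten_later (h : D.IsNice n Adj) (ho : D.IsOrder ord) {i j v w : ℕ}
    (hij : i < j) (hj : j < D.num) (hv : v < n) (ev : D.forgetNode v = ord i)
    (ew : D.forgetNode w = ord j) :
    v ≠ w ∧ ∀ u, D.Mem u (D.fst (D.forgetNode v)) → u ≠ v → u ≠ w := by
  obtain ⟨f₁, f₂, f₃⟩ := h.forgetNode_spec hv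
  refine ⟨?_, ?_⟩
  · rintro rfl
    have := ho.inj i (by omega) j hj (ev.symm.trans ew)
    omega
  · rintro u hu huv rfl
    have hm : D.Mem u (D.forgetNode v) :=
      ((h.forget _ f₁ f₂).2.2.2 _).2 ⟨by rw [f₃]; exact huv, hu⟩
    obtain ⟨i', j', r₁, r₂, r₃, r₄⟩ := mem_forgotten_earlier h ho f₁ hm
    have e₁ := ho.inj _ r₂ _ (by omega) (r₃.trans ev)
    have e₂ := ho.inj _ (by omega) _ (by omega) (r₄.trans ew)
    omega

end TreeData

namespace ConnectedKMeans

open RAMProgram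

variable {x : RAMInput ConnSymbol} {X M N n k : ℕ} {σ τ : RAMStore} {P : DPTables}
  {Adj : ℕ → ℕ → Prop}

theorem runs_chooseBest {r : ℕ} (hk : ∀ i j, x.nat ConnSymbol.numClusters i j = k)
    (hroot : ∀ i j, x.nat ConnSymbol.root i j = r) (h : Prepared x N P σ) (hM : 1 ≤ M)
    (hE : P.E ≤ X) :
    Runs x X M chooseBest σ fun τ =>
      (τ.nat 50 0 0 ≠ P.E →
        σ.nat 30 r (τ.nat 50 0 0) = 1 ∧ P.dec (τ.nat 50 0 0) (2 * P.m) = k) ∧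
      ∀ e < P.E, σ.nat 30 r e = 1 → P.dec e (2 * P.m) = k →
        τ.nat 50 0 0 ≠ P.E ∧ σ.real 0 r (τ.nat 50 0 0) ≤ σ.real 0 r e := by
  refine Runs.seq (Runs.setNat hM ?_)
  set σ' := σ.setNat 50 (NatExp.eval x σ zero) (NatExp.eval x σ zero) (NatExp.eval x σ (cell 15))
    with hσ'
  have f' : SameOutside [50] [] σ σ' := SameOutside.setNat _ _ _ _ (by simp)
  have h' : Prepared x N P σ' := h.congr f' (by decide)
  refine Runs.forLoop (fun i τ => (τ.nat 50 0 0 ≠ P.E →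
        σ.nat 30 r (τ.nat 50 0 0) = 1 ∧ P.dec (τ.nat 50 0 0) (2 * P.m) = k) ∧
      ∀ e < i, σ.nat 30 r e = 1 → P.dec e (2 * P.m) = k →
        τ.nat 50 0 0 ≠ P.E ∧ σ.real 0 r (τ.nat 50 0 0) ≤ σ.real 0 r e) P.E h'.E hM hE
    (by decide) ?_ ?_ ?_ (fun _ _ h => h)
  · refine ⟨fun hne => absurd ?_ hne, by simp⟩
    simp [hσ', NatExp.eval, h.E]
  · intro i τ τ' h₁ _ hI
    rw [h₁ 50 (by decide)]
    exact hI
  · intro i hi τ f hci hI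
    have hτ : Prepared x N P τ := h'.congr f (by decide)
    have e30 : τ.nat 30 = σ.nat 30 := by rw [f.1 30 (by decide), f'.1 30 (by decide)]
    have er : τ.real 0 = σ.real 0 := by rw [f.2 0 (by decide), f'.2 0 (by decide)]
    have htest : ∀ b : Prop, (b ↔ TestExp.holds x τ (TestExp.and (TestExp.and
        (natEq (NatExp.read 30 rootNode (cell 21)) one)
        (natEq (NatExp.read 16 (cell 21) (NatExp.add (cell 13) (cell 13))) numClusters))
        (TestExp.not (TestExp.and (TestExp.not (natEq (cell 50) (cell 15)))
          (TestExp.realLe (RealExp.read 0 rootNode (cell 50))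
            (RealExp.read 0 rootNode (cell 21))))))) →
        (b ↔ (σ.nat 30 r i = 1 ∧ P.dec i (2 * P.m) = k) ∧
          ¬ (τ.nat 50 0 0 ≠ P.E ∧ σ.real 0 r (τ.nat 50 0 0) ≤ σ.real 0 r i)) := by
      intro b hb
      rw [hb]
      simp only [TestExp.holds, NatExp.eval, RealExp.eval, hroot, hk, hci, e30, er, hτ.m, hτ.E,
        hτ.dec, ← two_mul, ← Nat.le_antisymm_iff, ne_eq]
    refine Runs.ite hM (fun hb => Runs.setNat hM ?_) (fun hb => Runs.skip hM ?_)
    · obtain ⟨⟨q₁, q₂⟩, q₃⟩ := (htest _ Iff.rfl).1 hb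
      simp only [RAMStore.setNat_nat, NatExp.eval, and_self, if_true, hci]
      refine ⟨fun _ => ⟨q₁, q₂⟩, fun e he g₁ g₂ => ⟨hi.ne, ?_⟩⟩
      rcases Nat.lt_succ_iff_lt_or_eq.1 he with he' | rfl
      · obtain ⟨g₃, g₄⟩ := hI.2 e he' g₁ g₂
        have : ¬ σ.real 0 r (τ.nat 50 0 0) ≤ σ.real 0 r i := fun g => q₃ ⟨g₃, g⟩
        exact (not_le.1 this).le.trans g₄
      · exact le_rfl
    · rw [htest _ Iff.rfl] at hb
      refine ⟨hI.1, fun e he g₁ g₂ => ?_⟩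
      rcases Nat.lt_succ_iff_lt_or_eq.1 he with he' | rfl
      · exact hI.2 e he' g₁ g₂
      · by_contra hcon
        exact hb ⟨⟨g₁, g₂⟩, hcon⟩

/-- `sel` selects a state for every node, following the pointers stored in `σ`. -/
structure Selected (x : RAMInput ConnSymbol) (N : ℕ) (σ : RAMStore) (best : ℕ) (sel : ℕ → ℕ) :
    Prop where
  root : sel (x.treeData N).root = best
  num : sel N = 0
  step : ∀ t < N, σ.nat 30 t (sel t) = 1 ∧
    sel ((x.treeData N).fst t) = σ.nat 31 t (sel t) ∧
    sel ((x.treeData N).snd t) = σ.nat 32 t (sel t)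

theorem runs_selectStates (hN : ∀ i j, x.nat ConnSymbol.numNodes i j = N)
    (hroot : ∀ i j, x.nat ConnSymbol.root i j = (x.treeData N).root)
    (hD : (x.treeData N).IsNice n Adj) (ho : (x.treeData N).IsOrder P.ord) (h : Prepared x N P σ)
    (hM : N < M) (hF : Filled x N k P (fun _ => True) σ)
    (hbest : σ.nat 30 (x.treeData N).root (σ.nat 50 0 0) = 1) (h0 : ∀ i, σ.nat 51 i 0 = 0) :
    Runs x X M selectStates σ fun τ =>
      Selected x N σ (σ.nat 50 0 0) fun t => τ.nat 51 t 0 := by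
  set D := x.treeData N with hDdef
  have hnum : D.num = N := rfl
  refine Runs.seq (Runs.setNat (by omega) ?_)
  set σ' := σ.setNat 51 (NatExp.eval x σ rootNode) (NatExp.eval x σ zero)
    (NatExp.eval x σ (cell 50)) with hσ'
  have f' : SameOutside [51] [] σ σ' := SameOutside.setNat _ _ _ _ (by simp)
  have h' : Prepared x N P σ' := h.congr f' (by decide)
  refine Runs.forLoop_large (fun i τ => τ.nat 51 D.root 0 = σ.nat 50 0 0 ∧ τ.nat 51 N 0 = 0 ∧
      ∀ j < i, σ.nat 30 (P.ord j) (τ.nat 51 (P.ord j) 0) = 1 ∧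
        τ.nat 51 (D.fst (P.ord j)) 0 = σ.nat 31 (P.ord j) (τ.nat 51 (P.ord j) 0) ∧
        τ.nat 51 (D.snd (P.ord j)) 0 = σ.nat 32 (P.ord j) (τ.nat 51 (P.ord j) 0)) N
    (by simp [NatExp.eval, hN]) hM (by decide) ?_ ?_ ?_ ?_
  · refine ⟨by simp [hσ', NatExp.eval, hroot, hDdef], ?_, by simp⟩
    have : N ≠ D.root := hD.root_lt.ne'
    simp [hσ', NatExp.eval, hroot, this, h0]
  · intro i τ τ' h₁ _ hI
    simpa only [h₁ 51 (by decide)] using hI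
  · rintro i hi τ f hci ⟨hI₁, hI₂, hI₃⟩
    have hτ : Prepared x N P τ := h'.congr f (by decide)
    have e31 : τ.nat 31 = σ.nat 31 := by rw [f.1 31 (by decide), f'.1 31 (by decide)]
    have e32 : τ.nat 32 = σ.nat 32 := by rw [f.1 32 (by decide), f'.1 32 (by decide)]
    set t := P.ord i with ht
    have htN : t < N := ho.lt i hi
    -- The selected state is reachable: at the root by assumption, elsewhere because the pointers of
    -- the parent name reachable states.
    have hflag : σ.nat 30 t (τ.nat 51 t 0) = 1 := by
      rcases Nat.eq_zero_or_pos i with rfl | hpos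
      · rw [ht, ho.zero, hI₁]
        exact hbest
      · obtain ⟨j, hj, hc⟩ := ho.earlier i hi hpos
        obtain ⟨q₁, q₂, q₃⟩ := hI₃ j hj
        obtain ⟨s₁, s₂, -⟩ := (hF.row _ (ho.lt j (by omega)) trivial).sound _ q₁
        rcases hc with hc | hc
        · rw [ht, ← hc, q₂]; exact s₁
        · rw [ht, ← hc, q₃]; exact s₂
    obtain ⟨s₁, s₂, -⟩ := (hF.row t htN trivial).sound _ hflag
    have hfst : D.fst t ≠ t := ho.fst_ne (show i < D.num from hi) le_rfl
    -- A pointer for a missing child can only name code `0`, its sole reachable state, so the entry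
    -- of `N` stays `0`.
    have z₁ : D.fst t = N → σ.nat 31 t (τ.nat 51 t 0) = 0 := fun e => by
      rw [← hDdef, e, hF.reached_num] at s₁
      by_contra hne
      rw [if_neg hne] at s₁
      omega
    have z₂ : D.snd t = N → σ.nat 32 t (τ.nat 51 t 0) = 0 := fun e => by
      rw [← hDdef, e, hF.reached_num] at s₂
      by_contra hne
      rw [if_neg hne] at s₂
      omega
    refine Runs.seq (Runs.setNat le_rfl (Runs.seq (Runs.setNat le_rfl (Runs.setNat le_rfl ?_))))
    simp only [NatExp.eval, hci, hτ.ord, RAMStore.setNat_nat, Nat.reduceEqDiff, false_and, if_false,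
      and_self, if_true, ← ht, hτ.fst t htN, hτ.snd t htN, e31, e32, ← hDdef, and_true, true_and,
      hfst.symm]
    set b₁ := σ.nat 31 t (τ.nat 51 t 0) with hb₁
    set b₂ := σ.nat 32 t (τ.nat 51 t 0) with hb₂
    set sel : ℕ → ℕ := fun s => if s = D.snd t then b₂ else if s = D.fst t then b₁ else
      τ.nat 51 s 0 with hsel
    have hNz : sel N = 0 := by
      simp only [hsel]
      split_ifs with c₁ c₂
      · exact z₂ c₁.symm
      · exact z₁ c₂.symm
      · exact hI₂
    have hother : ∀ s, s ≠ D.fst t → s ≠ D.snd t → sel s = τ.nat 51 s 0 := fun s c₁ c₂ => by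
      simp only [hsel, if_neg c₂, if_neg c₁]
    have hord : ∀ j ≤ i, sel (P.ord j) = τ.nat 51 (P.ord j) 0 := fun j hj =>
      hother _ (ho.fst_ne (show i < D.num from hi) hj).symm
        (ho.snd_ne (show i < D.num from hi) hj).symm
    change sel D.root = _ ∧ sel N = 0 ∧ ∀ j < i + 1, σ.nat 30 (P.ord j) (sel (P.ord j)) = 1 ∧
      sel (D.fst (P.ord j)) = σ.nat 31 (P.ord j) (sel (P.ord j)) ∧
      sel (D.snd (P.ord j)) = σ.nat 32 (P.ord j) (sel (P.ord j))
    refine ⟨?_, hNz, fun j hj => ?_⟩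
    · rw [← ho.zero, hord 0 (Nat.zero_le i), ho.zero]
      exact hI₁
    rw [hord j (by omega)]
    rcases Nat.lt_succ_iff_lt_or_eq.1 hj with hj' | rfl
    · obtain ⟨q₁, q₂, q₃⟩ := hI₃ j hj'
      have hjN : P.ord j < N := ho.lt j (by omega)
      -- No node is a child of two nodes, so entries written for children of earlier nodes survive;
      -- for `N` the value is `0` in any case.
      have aux : ∀ s, s ≤ N → (D.fst (P.ord j) = s ∨ D.snd (P.ord j) = s) →
          sel s = τ.nat 51 s 0 := by
        intro s hsN hs
        rcases hsN.lt_or_eq with hlt | rfl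
        · have := (ho.child_unique (show s < D.num from hlt)).1 j (by omega) i hi hj'.ne hs
          exact hother s (fun c => this (Or.inl c.symm)) (fun c => this (Or.inr c.symm))
        · rw [hNz, hI₂]
      rw [aux _ (hD.fst_le hjN) (Or.inl rfl), aux _ (hD.snd_le hjN) (Or.inr rfl)]
      exact ⟨q₁, q₂, q₃⟩
    · refine ⟨hflag, ?_, by simp only [hsel, if_true, ← ht, hb₂]⟩
      -- The two children coincide only if both are missing; otherwise the second write does not
      -- touch the first.
      by_cases c : D.fst t = D.snd t
      · have : D.fst t = N := by
          by_contra hne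
          exact (ho.child_unique (lt_of_le_of_ne (hD.fst_le htN) hne)).2 j hi ⟨rfl, c.symm⟩
        rw [← ht, this, hNz]
        exact (z₁ this).symm
      · simp only [hsel, ← ht, if_neg c, if_true, hb₁]
  · rintro τ _ ⟨h₁, h₂, h₃⟩
    refine ⟨h₁, h₂, fun t ht => ?_⟩
    obtain ⟨j, hj, rfl⟩ := ho.exists_eq (show t < D.num from ht)
    exact h₃ j hj

end ConnectedKMeans

namespace ConnectedKMeans

open RAMProgram

variable {x : RAMInput ConnSymbol} {X M N n k : ℕ} {σ τ : RAMStore} {P : DPTables}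
  {Adj : ℕ → ℕ → Prop} {t : ℕ}

/-- The states selected for the nodes. -/
noncomputable def _root_.DPTables.states (P : DPTables) (D : TreeData) (sel : ℕ → ℕ) (t : ℕ) :
    DPState :=
  P.state D t (sel t)

theorem runs_joinCluster {C : ℕ → ℕ} (hD : (x.treeData N).IsNice n Adj) (h : AtNode x N P t σ)
    (ht : t < N) (hX : ∀ s, (x.treeData N).size s ≤ X)
    (h3 : (x.treeData N).kind t = 3)
    (hC : ∀ u, (x.treeData N).Mem u ((x.treeData N).fst t) → σ.nat 42 u 0 = C u) :
    Runs x X 1 joinCluster σ fun τ =>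
      (∀ u ≠ (x.treeData N).lab t 0, τ.nat 1 u 0 = σ.nat 1 u 0) ∧
      ((τ.nat 47 0 0 = 1 ∧ (x.treeData N).Alone ((x.treeData N).fst t) C ((x.treeData N).lab t 0)) ∨
       (τ.nat 47 0 0 = 0 ∧ ∃ u, (x.treeData N).Mem u ((x.treeData N).fst t) ∧
          u ≠ (x.treeData N).lab t 0 ∧ C u = C ((x.treeData N).lab t 0) ∧
          σ.nat 1 u 0 = τ.nat 1 ((x.treeData N).lab t 0) 0)) := by
  set D := x.treeData N with hDdef
  have hbag : ∀ i, x.nat ConnSymbol.bag (D.fst t) i = D.bag (D.fst t) i := fun _ => rfl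
  have hlab : x.nat ConnSymbol.label t 0 = D.lab t 0 := rfl
  have hfst : D.fst t ≤ N := hD.fst_le ht
  set v := D.lab t 0 with hv
  have hvm : D.Mem v (D.fst t) := (hD.forget t ht h3).2.2.1
  refine Runs.seq (Runs.setNat le_rfl ?_)
  set σ' := σ.setNat 47 (NatExp.eval x σ zero) (NatExp.eval x σ zero) (NatExp.eval x σ one)
    with hσ'
  have f' : SameOutside [47] [] σ σ' := SameOutside.setNat _ _ _ _ (by simp)
  have h' : AtNode x N P t σ' := h.congr f' (by decide)
  refine Runs.forLoop (fun j τ => (∀ u ≠ v, τ.nat 1 u 0 = σ.nat 1 u 0) ∧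
      ((τ.nat 47 0 0 = 1 ∧ ∀ i < j, D.bag (D.fst t) i ≠ v → C (D.bag (D.fst t) i) ≠ C v) ∨
       (τ.nat 47 0 0 = 0 ∧ ∃ u, D.Mem u (D.fst t) ∧ u ≠ v ∧ C u = C v ∧
          σ.nat 1 u 0 = τ.nat 1 v 0))) (D.size (D.fst t))
    (by simp only [NatExp.eval, h'.node]; rw [h'.fst t ht]; exact h'.size _ hfst) le_rfl (hX _)
    (by decide) ?_ ?_ ?_ ?_
  · refine ⟨fun u _ => by rw [f'.1 1 (by decide)], Or.inl ⟨by simp [hσ', NatExp.eval], ?_⟩⟩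
    exact fun i hi => absurd hi (Nat.not_lt_zero i)
  · intro j τ τ' h₁ _ hI
    rw [h₁ 1 (by decide), h₁ 47 (by decide)]
    exact hI
  · rintro j hj τ f hcj ⟨hI₁, hI₂⟩
    have hτ : AtNode x N P t τ := h'.congr f (by decide)
    have e42 : ∀ u, D.Mem u (D.fst t) → τ.nat 42 u 0 = C u := fun u hu => by
      rw [f.1 42 (by decide), f'.1 42 (by decide), hC u hu]
    set w := D.bag (D.fst t) j with hw
    have hwm : D.Mem w (D.fst t) := ⟨j, hj, rfl⟩
    refine Runs.ite le_rfl (fun hb => Runs.seq (Runs.setNat le_rfl (Runs.setNat le_rfl ?_)))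
      (fun hb => Runs.skip le_rfl ?_)
    · simp only [TestExp.holds, NatExp.eval, hτ.node, hτ.fst t ht, ← hDdef, hcj, hbag, hlab,
        ← hw, e42 _ hwm, e42 _ hvm] at hb
      have hwv : w ≠ v := by omega
      simp only [NatExp.eval, hτ.node, RAMStore.setNat_nat, hτ.fst t ht, ← hDdef, hcj, hbag, hlab,
        ← hw, Nat.reduceEqDiff, false_and, if_false, and_self, if_true, and_true, true_and]
      refine ⟨fun u hu => by rw [if_neg hu]; exact hI₁ u hu, Or.inr ⟨w, hwm, hwv,
        by omega, (hI₁ w hwv).symm⟩⟩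
    · simp only [TestExp.holds, NatExp.eval, hτ.node, hτ.fst t ht, ← hDdef, hcj, hbag, hlab,
        ← hw, e42 _ hwm, e42 _ hvm] at hb
      refine ⟨hI₁, hI₂.imp_left fun ⟨q₁, q₂⟩ => ⟨q₁, fun i hi => ?_⟩⟩
      rcases Nat.lt_succ_iff_lt_or_eq.1 hi with hi' | rfl
      · exact q₂ i hi'
      · intro g₁ g₂
        exact hb ⟨fun q => g₁ (le_antisymm q.1 q.2), g₂.le, g₂.ge⟩
  · rintro τ _ ⟨h₁, h₂⟩
    refine ⟨h₁, h₂.imp_left fun ⟨q₁, q₂⟩ => ⟨q₁, ?_⟩⟩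
    rintro _ ⟨i, hi, rfl⟩
    exact q₂ i hi

/-- A part of the invariant of the assignment of clusters: the clusters below `c` are those of the
vertices in `V` that are the last ones of their clusters. -/
structure Clusters (D : TreeData) (S : ℕ → DPState) (V : ℕ → Prop) (part ctr loc : ℕ → ℕ)
    (c : ℕ) : Prop where
  follow : ∀ v, V v → ¬ D.IsLast S v → ∃ u, D.Mem u (D.fst (D.forgetNode v)) ∧ u ≠ v ∧
    (S (D.fst (D.forgetNode v))).comp u = (S (D.fst (D.forgetNode v))).comp v ∧ part u = part v
  last : ∀ v, V v → D.IsLast S v → part v < c ∧ ctr (part v) = v ∧ loc (part v) = D.vertexLabel S v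
  center : ∀ i < c, V (ctr i) ∧ D.IsLast S (ctr i) ∧ part (ctr i) = i

/-- By `hV` no vertex treated so far is `v₀` or could be following `v₀`, and index `c` is unused, so
the new entries leave the old facts intact. -/
theorem Clusters.insert_last {D : TreeData} {S : ℕ → DPState} {V : ℕ → Prop}
    {part ctr loc part' ctr' loc' : ℕ → ℕ} {c v₀ : ℕ} (h : Clusters D S V part ctr loc c)
    (hV : ∀ v, V v → v ≠ v₀ ∧ ∀ u, D.Mem u (D.fst (D.forgetNode v)) → u ≠ v → u ≠ v₀)
    (hl : D.IsLast S v₀) (hp : ∀ v, part' v = if v = v₀ then c else part v)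
    (hc : ∀ i, ctr' i = if i = c then v₀ else ctr i)
    (hloc : ∀ i, loc' i = if i = c then D.vertexLabel S v₀ else loc i) :
    Clusters D S (fun v => V v ∨ v = v₀) part' ctr' loc' (c + 1) := by
  refine ⟨?_, ?_, ?_⟩
  · rintro v (hv | rfl) hnl
    · obtain ⟨u, q₁, q₂, q₃, q₄⟩ := h.follow v hv hnl
      refine ⟨u, q₁, q₂, q₃, ?_⟩
      rw [hp, hp, if_neg (hV v hv).1, if_neg ((hV v hv).2 u q₁ q₂), q₄]
    · exact absurd hl hnl
  · rintro v (hv | rfl) hvl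
    · obtain ⟨q₁, q₂, q₃⟩ := h.last v hv hvl
      rw [hp, if_neg (hV v hv).1, hc, hloc, if_neg q₁.ne, if_neg q₁.ne]
      exact ⟨by omega, q₂, q₃⟩
    · rw [hp, if_pos rfl, hc, hloc, if_pos rfl, if_pos rfl]
      exact ⟨by omega, rfl, rfl⟩
  · intro i hi
    rcases Nat.lt_succ_iff_lt_or_eq.1 hi with hi' | rfl
    · obtain ⟨q₁, q₂, q₃⟩ := h.center i hi'
      rw [hc, if_neg hi'.ne, hp, if_neg (hV _ q₁).1]
      exact ⟨Or.inl q₁, q₂, q₃⟩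
    · rw [hc, if_pos rfl, hp, if_pos rfl]
      exact ⟨Or.inr rfl, hl, rfl⟩

theorem Clusters.insert_follow {D : TreeData} {S : ℕ → DPState} {V : ℕ → Prop}
    {part ctr loc part' : ℕ → ℕ} {c v₀ u₀ : ℕ} (h : Clusters D S V part ctr loc c)
    (hV : ∀ v, V v → v ≠ v₀ ∧ ∀ u, D.Mem u (D.fst (D.forgetNode v)) → u ≠ v → u ≠ v₀)
    (hu : D.Mem u₀ (D.fst (D.forgetNode v₀))) (huv : u₀ ≠ v₀)
    (hC : (S (D.fst (D.forgetNode v₀))).comp u₀ = (S (D.fst (D.forgetNode v₀))).comp v₀)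
    (hp : ∀ v ≠ v₀, part' v = part v) (hp' : part u₀ = part' v₀) :
    Clusters D S (fun v => V v ∨ v = v₀) part' ctr loc c := by
  refine ⟨?_, ?_, ?_⟩
  · rintro v (hv | rfl) hnl
    · obtain ⟨u, q₁, q₂, q₃, q₄⟩ := h.follow v hv hnl
      refine ⟨u, q₁, q₂, q₃, ?_⟩
      rw [hp _ (hV v hv).1, hp _ ((hV v hv).2 u q₁ q₂), q₄]
    · exact ⟨u₀, hu, huv, hC, by rw [hp _ huv, hp']⟩
  · rintro v (hv | rfl) hvl
    · rw [hp _ (hV v hv).1]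
      exact h.last v hv hvl
    · exact absurd hC (hvl u₀ hu huv)
  · intro i hi
    obtain ⟨q₁, q₂, q₃⟩ := h.center i hi
    rw [hp _ (hV _ q₁).1]
    exact ⟨Or.inl q₁, q₂, q₃⟩

theorem runs_assignVertex {S : ℕ → DPState} {V : ℕ → Prop} {sel : ℕ → ℕ}
    (hS : S = P.states (x.treeData N) sel)
    (hD : (x.treeData N).IsNice n Adj) (h : AtNode x N P t σ)
    (ht : t < N) (hX : ∀ s, (x.treeData N).size s ≤ X)
    (h3 : (x.treeData N).kind t = 3) (hsel : ∀ s, σ.nat 51 s 0 = sel s)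
    (hV : ∀ v, V v → v ≠ (x.treeData N).lab t 0 ∧
      ∀ u, (x.treeData N).Mem u ((x.treeData N).fst ((x.treeData N).forgetNode v)) → u ≠ v →
        u ≠ (x.treeData N).lab t 0)
    (hI : Clusters (x.treeData N) S V (fun v => σ.nat 1 v 0) (fun i => σ.nat 0 i 0)
      (fun i => σ.nat 53 i 0) (σ.nat 52 0 0)) :
    Runs x X 1 assignVertex σ fun τ =>
      Clusters (x.treeData N) S (fun v => V v ∨ v = (x.treeData N).lab t 0) (fun v => τ.nat 1 v 0)
        (fun i => τ.nat 0 i 0) (fun i => τ.nat 53 i 0) (τ.nat 52 0 0) := by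
  set D := x.treeData N with hDdef
  have hlab : x.nat ConnSymbol.label t 0 = D.lab t 0 := rfl
  have hfst : D.fst t ≤ N := hD.fst_le ht
  set v := D.lab t 0 with hv
  have hvm : D.Mem v (D.fst t) := (hD.forget t ht h3).2.2.1
  have hf : D.forgetNode v = t := hD.forgetNode_lab ht h3
  refine Runs.seq ((runs_loadState (s := D.fst t) (c := sel (D.fst t)) hD h.toPrepared (by decide)
    (by decide) (by decide) (fun τ hf => by
      simp only [NatExp.eval, hf.1 19 (by decide), hf.1 11 (by decide), h.node, h.fst t ht, D])
    (fun τ hf => by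
      simp only [NatExp.eval, hf.1 19 (by decide), hf.1 11 (by decide), h.node, h.fst t ht,
        hf.1 51 (by decide), hsel, D]) hfst (hX _)).frame
      fun σ₁ f₁ q₁ => ?_)
  have h₁ : AtNode x N P t σ₁ := h.congr f₁ (by decide)
  refine Runs.seq ((runs_joinCluster hD h₁ ht hX h3 fun u hu => (q₁ u hu).1).frame
    fun σ₂ f₂ q₂ => ?_)
  have h₂ : AtNode x N P t σ₂ := h₁.congr f₂ (by decide)
  rw [← hDdef] at q₁ q₂
  have hSf : S (D.fst t) = P.state D (D.fst t) (sel (D.fst t)) := by rw [hS]; rfl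
  rw [← hSf] at q₁ q₂
  obtain ⟨q₂, q₃⟩ := q₂
  rw [f₁.1 1 (by decide)] at q₂ q₃
  have e0 : σ₂.nat 0 = σ.nat 0 := by rw [f₂.1 0 (by decide), f₁.1 0 (by decide)]
  have e52 : σ₂.nat 52 = σ.nat 52 := by rw [f₂.1 52 (by decide), f₁.1 52 (by decide)]
  have e53 : σ₂.nat 53 = σ.nat 53 := by rw [f₂.1 53 (by decide), f₁.1 53 (by decide)]
  have e43 : σ₂.nat 43 v 0 = D.vertexLabel S v := by
    rw [f₂.1 43 (by decide), (q₁ v hvm).2, TreeData.vertexLabel, hf]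
  refine Runs.ite le_rfl (fun hb => Runs.seq (Runs.setNat le_rfl (Runs.seq (Runs.setNat le_rfl
    (Runs.seq (Runs.setNat le_rfl (Runs.setNat le_rfl ?_))))))) (fun hb => Runs.skip le_rfl ?_)
  · simp only [TestExp.holds, NatExp.eval] at hb
    have hal : D.IsLast S v := by
      rcases q₃ with q₃ | q₃
      · rw [TreeData.IsLast, hf]
        exact q₃.2
      · omega
    simp only [NatExp.eval, h₂.node, RAMStore.setNat_nat, hlab, Nat.reduceEqDiff, false_and,
      if_false, and_self, if_true, and_true, true_and, e52, e53, e43, e0, OfNat.one_ne_ofNat,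
      OfNat.zero_ne_ofNat, zero_ne_one, one_ne_zero, OfNat.ofNat_ne_one, OfNat.ofNat_ne_zero]
    refine hI.insert_last hV hal ?_ ?_ ?_
    · intro w
      split_ifs with hw
      · rfl
      · exact q₂ w hw
    · intro i; rfl
    · intro i; rfl
  · simp only [TestExp.holds, NatExp.eval] at hb
    obtain ⟨-, u, r₁, r₂, r₃, r₄⟩ := q₃.resolve_left fun q => hb (by omega)
    rw [e0, e52, e53]
    exact hI.insert_follow hV (by rw [hf]; exact r₁) r₂ (by rw [hf]; exact r₃) q₂ r₄

theorem runs_assignClusters {sel : ℕ → ℕ} (hN : ∀ i j, x.nat ConnSymbol.numNodes i j = N)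
    (hD : (x.treeData N).IsNice n Adj) (ho : (x.treeData N).IsOrder P.ord) (h : Prepared x N P σ)
    (hX : ∀ s, (x.treeData N).size s ≤ X) (hM : N < M) (hsel : ∀ s, σ.nat 51 s 0 = sel s) :
    Runs x X M assignClusters σ fun τ =>
      Clusters (x.treeData N) (P.states (x.treeData N) sel) (fun v => v < n)
        (fun v => τ.nat 1 v 0) (fun i => τ.nat 0 i 0) (fun i => τ.nat 53 i 0) (τ.nat 52 0 0) := by
  set D := x.treeData N with hDdef
  refine Runs.seq (Runs.setNat (by omega) ?_)
  set σ' := σ.setNat 52 (NatExp.eval x σ zero) (NatExp.eval x σ zero) (NatExp.eval x σ zero)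
    with hσ'
  have f' : SameOutside [52] [] σ σ' := SameOutside.setNat _ _ _ _ (by simp)
  have h' : Prepared x N P σ' := h.congr f' (by decide)
  refine Runs.forLoop_large (fun i τ => Clusters D (P.states D sel)
      (fun v => v < n ∧ ∃ j < i, D.forgetNode v = P.ord j)
      (fun v => τ.nat 1 v 0) (fun i => τ.nat 0 i 0) (fun i => τ.nat 53 i 0) (τ.nat 52 0 0)) N
    (by simp [NatExp.eval, hN]) hM (by decide) ?_ ?_ ?_ ?_
  · refine ⟨?_, ?_, ?_⟩
    · rintro v ⟨-, j, hj, -⟩; omega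
    · rintro v ⟨-, j, hj, -⟩; omega
    · intro i hi
      simp [hσ', NatExp.eval] at hi
  · intro i τ τ' h₁ _ hI
    simpa only [h₁ 1 (by decide), h₁ 0 (by decide), h₁ 53 (by decide), h₁ 52 (by decide)] using hI
  · intro i hi τ f hci hI
    refine Runs.seq (Runs.setNat le_rfl ?_)
    have hτ : Prepared x N P τ := h'.congr f (by decide)
    have e : NatExp.eval x τ (entry 17 (cell 20)) = P.ord i := by
      simp only [NatExp.eval, hci, hτ.ord]
    rw [e]
    set t := P.ord i with ht
    have htN : t < N := ho.lt _ hi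
    set υ := τ.setNat 19 (NatExp.eval x τ zero) (NatExp.eval x τ zero) t with hυ
    have fυ : SameOutside [19] [] τ υ := SameOutside.setNat _ _ _ _ (by simp)
    have hat : AtNode x N P t υ := ⟨hτ.congr fυ (by decide), by simp [hυ, NatExp.eval]⟩
    have hkind : x.nat ConnSymbol.kind t 0 = D.kind t := rfl
    have hI' : Clusters D (P.states D sel) (fun v => v < n ∧ ∃ j < i, D.forgetNode v = P.ord j)
      (fun v => υ.nat 1 v 0) (fun i => υ.nat 0 i 0) (fun i => υ.nat 53 i 0) (υ.nat 52 0 0) := by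
      simpa only [fυ.1 1 (by decide), fυ.1 0 (by decide), fυ.1 53 (by decide),
        fυ.1 52 (by decide)] using hI
    refine Runs.ite le_rfl (fun hb => ?_) (fun hb => Runs.skip le_rfl ?_)
    · simp only [TestExp.holds, NatExp.eval, hat.node, hkind] at hb
      have h3 : D.kind t = 3 := by omega
      have hf : D.forgetNode (D.lab t 0) = t := hD.forgetNode_lab htN h3
      refine (runs_assignVertex (S := P.states D sel) (sel := sel)
        (V := fun v => v < n ∧ ∃ j < i, D.forgetNode v = P.ord j) rfl hD hat htN hX h3
        (fun s => by rw [fυ.1 51 (by decide), f.1 51 (by decide), f'.1 51 (by decide), hsel])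
        ?_ hI').weaken fun ω hω => ?_
      · rintro v ⟨hv, j, hj, e⟩
        exact TreeData.ne_of_forgotten_later hD ho hj hi hv e hf
      · have : (fun v => v < n ∧ ∃ j < i + 1, D.forgetNode v = P.ord j) =
            fun v => (v < n ∧ ∃ j < i, D.forgetNode v = P.ord j) ∨ v = D.lab t 0 := by
          funext v
          refine propext ⟨?_, ?_⟩
          · rintro ⟨hv, j, hj, e'⟩
            rcases Nat.lt_succ_iff_lt_or_eq.1 hj with hj' | rfl
            · exact Or.inl ⟨hv, j, hj', e'⟩
            · refine Or.inr ?_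
              have := (hD.forgetNode_spec hv).2.2
              rw [e'] at this
              exact this.symm
          · rintro (⟨hv, j, hj, e⟩ | rfl)
            · exact ⟨hv, j, by omega, e⟩
            · exact ⟨hD.lab_lt htN h3, i, by omega, hf⟩
        rw [this]
        exact hω
    · simp only [TestExp.holds, NatExp.eval, hat.node, hkind] at hb
      have : (fun v => v < n ∧ ∃ j < i + 1, D.forgetNode v = P.ord j) =
            fun v => v < n ∧ ∃ j < i, D.forgetNode v = P.ord j := by
        funext v
        refine propext ⟨?_, ?_⟩
        · rintro ⟨hv, j, hj, e'⟩
          rcases Nat.lt_succ_iff_lt_or_eq.1 hj with hj' | rfl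
          · exact ⟨hv, j, hj', e'⟩
          · have h3 : D.kind t = 3 := by
              rw [ht, ← e']
              exact (hD.forgetNode_spec hv).2.1
            omega
        · rintro ⟨hv, j, hj, e⟩
          exact ⟨hv, j, by omega, e⟩
      rw [this]
      exact hI'
  · intro τ _ hI
    have : (fun v => v < n ∧ ∃ j < N, D.forgetNode v = P.ord j) = fun v => v < n := by
      funext v
      refine propext ⟨fun q => q.1, fun hv => ⟨hv, ?_⟩⟩
      obtain ⟨j, hj, e⟩ := ho.exists_eq (hD.forgetNode_spec hv).1
      exact ⟨j, hj, e.symm⟩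
    rw [this] at hI
    exact hI

theorem runs_improveCenters (hn : ∀ i j, x.nat ConnSymbol.numPoints i j = n)
    (h : Prepared x N P σ) (hM : n < M)
    (hc : ∀ i < k, σ.nat 0 i 0 < n ∧ σ.nat 1 (σ.nat 0 i 0) 0 = i) :
    Runs x X M improveCenters σ fun τ =>
      (∀ i < k, τ.nat 0 i 0 < n ∧ σ.nat 1 (τ.nat 0 i 0) 0 = i) ∧
      ∀ v < n, x.dist (τ.nat 0 (σ.nat 1 v 0) 0) (P.cen (σ.nat 53 (σ.nat 1 v 0) 0)) ≤
        x.dist v (P.cen (σ.nat 53 (σ.nat 1 v 0) 0)) := by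
  refine Runs.forLoop_large (fun j τ =>
      (∀ i < k, τ.nat 0 i 0 < n ∧ σ.nat 1 (τ.nat 0 i 0) 0 = i) ∧
      ∀ v < j, x.dist (τ.nat 0 (σ.nat 1 v 0) 0) (P.cen (σ.nat 53 (σ.nat 1 v 0) 0)) ≤
        x.dist v (P.cen (σ.nat 53 (σ.nat 1 v 0) 0))) n
    (by simp [NatExp.eval, hn]) hM (by decide) ⟨hc, by simp⟩ ?_ ?_ (fun _ _ hI => hI)
  · intro i τ τ' h₁ _ hI
    simpa only [h₁ 0 (by decide)] using hI
  · rintro j hj τ f hcj ⟨hI₁, hI₂⟩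
    have hτ : Prepared x N P τ := h.congr f (by decide)
    have e1 : τ.nat 1 = σ.nat 1 := f.1 1 (by decide)
    have e53 : τ.nat 53 = σ.nat 53 := f.1 53 (by decide)
    refine Runs.ite le_rfl (fun hb => Runs.setNat le_rfl ?_) (fun hb => Runs.skip le_rfl ?_)
    · simp only [TestExp.holds, RealExp.eval, NatExp.eval, hcj, e1, e53, hτ.cen] at hb
      simp only [NatExp.eval, hcj, e1, RAMStore.setNat_nat, and_true, true_and]
      refine ⟨fun i hi => ?_, fun v hv => ?_⟩
      · by_cases hij : i = σ.nat 1 j 0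
        · rw [if_pos hij]
          exact ⟨hj, hij.symm⟩
        · rw [if_neg hij]
          exact hI₁ i hi
      · by_cases hij : σ.nat 1 v 0 = σ.nat 1 j 0
        · rw [if_pos hij]
          rcases Nat.lt_succ_iff_lt_or_eq.1 hv with hv' | rfl
          · have := hI₂ v hv'
            rw [hij] at this ⊢
            exact hb.trans this
          · exact le_rfl
        · rw [if_neg hij]
          rcases Nat.lt_succ_iff_lt_or_eq.1 hv with hv' | rfl
          · exact hI₂ v hv'
          · exact absurd rfl hij
    · simp only [TestExp.holds, RealExp.eval, NatExp.eval, hcj, e1, e53, hτ.cen] at hb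
      refine ⟨hI₁, fun v hv => ?_⟩
      rcases Nat.lt_succ_iff_lt_or_eq.1 hv with hv' | rfl
      · exact hI₂ v hv'
      · exact (not_le.1 hb).le

end ConnectedKMeans

/-! ### Labelled costs and the specification of the output -/

/-- Total squared distance of the vertices below `n` from the centers given by their labels. -/
noncomputable def DPTables.labelledCost (P : DPTables) (D : TreeData) (x : RAMInput ConnSymbol)
    (n : ℕ) (S : ℕ → DPState) : ℝ :=
  ∑ v ∈ Finset.range n, x.dist v (P.cen (D.vertexLabel S v)) ^ 2

/-- What the program finds: a clustering that comes from the states `S`, with clusters `part` and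
centers `ctr`. -/
structure IsSolution (D : TreeData) (P : DPTables) (x : RAMInput ConnSymbol) (n k : ℕ)
    (Adj : ℕ → ℕ → Prop) (S : ℕ → DPState) (part ctr : ℕ → ℕ) : Prop where
  part_lt : ∀ v < n, part v < k
  center : ∀ i < k, ctr i < n ∧ part (ctr i) = i
  near : ∀ v < n, x.dist (ctr (part v)) (P.cen (D.vertexLabel S v)) ≤
    x.dist v (P.cen (D.vertexLabel S v))
  label_lt : ∀ v < n, D.vertexLabel S v < k
  conn : ∀ R : ℕ → ℕ → Prop, Equivalence R → (∀ y z, Adj y z → part y = part z → R y z) →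
    ∀ u < n, ∀ w < n, part u = part w → R u w

namespace ConnectedKMeans

open RAMProgram

variable {x : RAMInput ConnSymbol} {X M N n k : ℕ} {σ τ : RAMStore} {P : DPTables}
  {Adj : ℕ → ℕ → Prop} {t : ℕ}

/-! ### Correctness of the table -/

theorem derivation_of_selected {sel : ℕ → ℕ} {best : ℕ} (hF : Filled x N k P (fun _ => True) σ)
    (hsel : Selected x N σ best sel) (h0 : P.dec 0 (2 * P.m) = 0) :
    (x.treeData N).Derivation k (P.states (x.treeData N) sel) := by
  refine ⟨?_, fun t ht => ?_⟩
  · change P.dec (sel N) (2 * P.m) = 0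
    rw [hsel.num, h0]
  · obtain ⟨q₁, q₂, q₃⟩ := hsel.step t ht
    obtain ⟨-, -, hs, -⟩ := (hF.row t ht trivial).sound _ q₁
    rw [← q₂, ← q₃] at hs
    exact hs

/-- The recorded costs of the selected states add up from the children and grow only at forget
nodes, so `root_eq_sum` evaluates them. -/
theorem cost_of_selected {sel : ℕ → ℕ} {best : ℕ} (hD : (x.treeData N).IsNice n Adj)
    (ho : (x.treeData N).IsOrder P.ord) (hF : Filled x N k P (fun _ => True) σ)
    (hsel : Selected x N σ best sel) :
    σ.real 0 (x.treeData N).root best =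
      P.labelledCost (x.treeData N) x n (P.states (x.treeData N) sel) := by
  have := ho.root_eq_sum hD (fun t => σ.real 0 t (sel t)) (fun v => x.dist v
    (P.cen ((x.treeData N).vertexLabel (P.states (x.treeData N) sel) v)) ^ 2) (by
      change σ.real 0 N (sel N) = 0
      rw [hsel.num, hF.cost_num]) fun t ht => by
    obtain ⟨q₁, q₂, q₃⟩ := hsel.step t ht
    obtain ⟨-, -, -, hc⟩ := (hF.row t ht trivial).sound _ q₁
    rw [hc, DPTables.childCost, q₂, q₃, DPTables.stepCost, ← q₂]
    congr 1
    by_cases h3 : (x.treeData N).kind t = 3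
    · rw [if_pos h3, if_pos h3, TreeData.vertexLabel, hD.forgetNode_lab ht h3]
      rfl
    · rw [if_neg h3, if_neg h3]
  rw [← hsel.root]
  exact this

/-- The states `S` are represented by codes. -/
structure Codable (D : TreeData) (b : ℕ) (S : ℕ → DPState) : Prop where
  comp : ∀ t < D.num, ∀ u, D.Mem u t → (S t).comp u < b
  label : ∀ t < D.num, ∀ u, D.Mem u t → (S t).label u < b
  count : ∀ t < D.num, (S t).count < b

/-- The code `e` represents the state `S` of `t`. -/
structure Encodes (P : DPTables) (D : TreeData) (t e : ℕ) (S : DPState) : Prop where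
  comp_label : ∀ u, D.Mem u t → (P.state D t e).comp u = S.comp u ∧
    (P.state D t e).label u = S.label u
  count : (P.state D t e).count = S.count

theorem exists_encodes {S : ℕ → DPState} {b : ℕ} (hD : (x.treeData N).IsNice n Adj)
    (hb : IsCodeTable b (2 * P.m + 1) P.E P.dec) (hm : ∀ t, (x.treeData N).size t ≤ P.m)
    (hS : Codable (x.treeData N) b S) (ht : t < N) :
    ∃ e < P.E, Encodes P (x.treeData N) t e (S t) := by
  set D := x.treeData N with hDdef
  have hpos : 0 < b := (Nat.zero_le _).trans_lt (hS.count t ht)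
  -- Layout of a code: colours in the places below `m`, labels in the places from `m` to `2 * m -
  -- 1`, the count in place `2 * m`. Places that exceed the bag are filled with `0`.
  obtain ⟨e, he, hdec⟩ := hb.surj (fun i => if i < P.m then
      (if i < D.size t then (S t).comp (D.bag t i) else 0)
    else if i < 2 * P.m then
      (if i - P.m < D.size t then (S t).label (D.bag t (i - P.m)) else 0)
    else (S t).count) (by
      intro i _
      split_ifs with h₁ h₂ h₃ h₄
      · exact hS.comp t ht _ ⟨i, h₂, rfl⟩
      · exact hpos
      · exact hS.label t ht _ ⟨i - P.m, h₄, rfl⟩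
      · exact hpos
      · exact hS.count t ht)
  refine ⟨e, he, ?_, ?_⟩
  · rintro _ ⟨i, hi, rfl⟩
    have him : i < P.m := hi.trans_le (hm t)
    have e₁ := hdec i (by omega)
    have e₂ := hdec (P.m + i) (by omega)
    rw [if_pos him, if_pos hi] at e₁
    rw [if_neg (by omega), if_pos (by omega), Nat.add_sub_cancel_left, if_pos hi] at e₂
    simp only [DPTables.state, hD.index_bag hi]
    exact ⟨e₁, e₂⟩
  · have e₃ := hdec (2 * P.m) (by omega)
    rw [if_neg (by omega), if_neg (by omega)] at e₃
    exact e₃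

/-- Optimality of the table. From the leaves upwards, the state of `S` at each node has a reachable
code whose recorded cost does not exceed what `S` has paid so far, because the triple of codes taken
from `S` is among those tried. -/
theorem exists_code_le {S : ℕ → DPState} {b : ℕ} (hD : (x.treeData N).IsNice n Adj)
    (ho : (x.treeData N).IsOrder P.ord) (hF : Filled x N k P (fun _ => True) σ)
    (hb : IsCodeTable b (2 * P.m + 1) P.E P.dec) (hm : ∀ t, (x.treeData N).size t ≤ P.m)
    (hS : (x.treeData N).Derivation k S) (hcod : Codable (x.treeData N) b S) :
    ∃ e < P.E, P.dec e (2 * P.m) = (S (x.treeData N).root).count ∧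
      σ.nat 30 (x.treeData N).root e = 1 ∧
      σ.real 0 (x.treeData N).root e ≤ P.labelledCost (x.treeData N) x n S := by
  set D := x.treeData N with hDdef
  -- Here `g t` is the cost that the derivation `S` has accumulated up to `t`.
  obtain ⟨g, hg₀, hg⟩ := ho.exists_bottomUp hD (fun _ _ => True)
    (fun t a a₁ a₂ => a = a₁ + a₂ + P.stepCost D x t (S (D.fst t))) (0 : ℝ) trivial
    (fun t _ a₁ a₂ _ _ => ⟨_, trivial, rfl⟩)
  have hcost : g D.root = P.labelledCost D x n S := by
    refine ho.root_eq_sum hD g (fun v => x.dist v (P.cen (D.vertexLabel S v)) ^ 2) hg₀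
      fun t ht => ?_
    rw [(hg t ht).2, DPTables.stepCost]
    congr 1
    by_cases h3 : D.kind t = 3
    · rw [if_pos h3, if_pos h3, TreeData.vertexLabel, hD.forgetNode_lab ht h3]
    · rw [if_neg h3, if_neg h3]
  have key : ∀ t < D.num, ∃ e < P.E, Encodes P D t e (S t) ∧ σ.nat 30 t e = 1 ∧
      σ.real 0 t e ≤ g t := by
    refine ho.bottomUp hD ?_ ?_
    -- This only shows that codes exist at all, so that `0` is one; it is the code used for the
    -- missing child.
    · obtain ⟨e, he, -⟩ := exists_encodes hD hb hm hcod hD.root_lt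
      refine ⟨0, by omega, ⟨fun u hu => absurd hu (hD.not_mem_num u), ?_⟩, ?_, ?_⟩
      · rw [hS.1]
        exact hb.zero _ (by omega)
      · change σ.nat 30 N 0 = 1
        rw [hF.reached_num, if_pos rfl]
      · rw [hg₀]
        exact hF.cost_num.le
    · rintro t ht ⟨e₁, he₁, c₁, f₁, r₁⟩ ⟨e₂, he₂, c₂, f₂, r₂⟩
      obtain ⟨e, he, c⟩ := exists_encodes hD hb hm hcod ht
      have hs : P.CanStep D k t e e₁ e₂ := (hS.2 t ht).congr hD ht
        (fun u hu => ⟨(c.comp_label u hu).1.symm, (c.comp_label u hu).2.symm⟩)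
        (fun u hu => ⟨(c₁.comp_label u hu).1.symm, (c₁.comp_label u hu).2.symm⟩)
        (fun u hu => ⟨(c₂.comp_label u hu).1.symm, (c₂.comp_label u hu).2.symm⟩)
        c.count.symm c₁.count.symm c₂.count.symm
      obtain ⟨q₁, q₂⟩ := (hF.row t ht trivial).opt e e₁ e₂ ⟨he, he₁, he₂⟩ f₁ f₂ hs
      refine ⟨e, he, c, q₁, q₂.trans ?_⟩
      have hstep : P.stepCost D x t (P.state D (D.fst t) e₁) = P.stepCost D x t (S (D.fst t)) := by
        unfold DPTables.stepCost
        by_cases h3 : D.kind t = 3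
        · rw [if_pos h3, if_pos h3, (c₁.comp_label _ (hD.forget t ht h3).2.2.1).2]
        · rw [if_neg h3, if_neg h3]
      rw [DPTables.childCost, hstep, (hg t ht).2]
      gcongr
  obtain ⟨e, he, c, q₁, q₂⟩ := key _ hD.root_lt
  exact ⟨e, he, c.count, q₁, by rw [← hcost]; exact q₂⟩

/-! ### Correctness of the clusters -/

/-- The numbering of the clusters and the count at the root both enumerate the last vertices. -/
theorem Clusters.count_eq {D : TreeData} {S : ℕ → DPState} {part ctr loc : ℕ → ℕ} {c : ℕ}
    (h : Clusters D S (fun v => v < n) part ctr loc c) (hD : D.IsNice n Adj) {ord : ℕ → ℕ}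
    (ho : D.IsOrder ord) (hS : D.Derivation k S) : (S D.root).count = c := by
  classical
  rw [TreeData.count_root hD ho hS]
  conv_rhs => rw [← Finset.card_range c]
  refine Finset.card_bij (fun v _ => part v) ?_ ?_ ?_
  · intro v hv
    simp only [Finset.mem_filter, Finset.mem_range] at hv ⊢
    exact (h.last v hv.1 hv.2).1
  · intro v hv w hw e
    simp only [Finset.mem_filter, Finset.mem_range] at hv hw
    rw [← (h.last v hv.1 hv.2).2.1, ← (h.last w hw.1 hw.2).2.1, e]
  · intro i hi
    obtain ⟨q₁, q₂, q₃⟩ := h.center i (Finset.mem_range.1 hi)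
    exact ⟨ctr i, by simp [q₁, q₂], q₃⟩

/-- Labels agree along components. -/
theorem vertexLabel_eq {D : TreeData} {S : ℕ → DPState} (hD : D.IsNice n Adj) {ord : ℕ → ℕ}
    (ho : D.IsOrder ord) (hS : D.Derivation k S) {t : ℕ} (ht : t < D.num) (h2 : D.kind t = 2)
    (e : (S t).comp (D.lab t 0) = (S t).comp (D.lab t 1)) :
    D.vertexLabel S (D.lab t 0) = D.vertexLabel S (D.lab t 1) := by
  obtain ⟨hf, -, -, q₁, q₂, q₃⟩ := hD.introEdge t ht h2
  rw [← TreeData.label_eq_vertexLabel hD ho hS _ hf _ ((q₃ _).1 q₁),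
    ← TreeData.label_eq_vertexLabel hD ho hS _ hf _ ((q₃ _).1 q₂)]
  exact (hS.2 t ht).merge h2 e

/-- Every vertex shares part and label with a last vertex and is connected to it. The index of a
cluster determines its last vertex through `ctr`, so two vertices of one cluster lead to the same
last vertex and are connected to each other. -/
theorem Clusters.isSolution {D : TreeData} {S : ℕ → DPState} {part ctr loc ctr' : ℕ → ℕ}
    (h : Clusters D S (fun v => v < n) part ctr loc k) (hD : D.IsNice n Adj) {ord : ℕ → ℕ}
    (ho : D.IsOrder ord) (hS : D.Derivation k S)
    (hc : ∀ i < k, ctr' i < n ∧ part (ctr' i) = i)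
    (hnear : ∀ v < n, x.dist (ctr' (part v)) (P.cen (loc (part v))) ≤
      x.dist v (P.cen (loc (part v)))) :
    IsSolution D P x n k Adj S part ctr' := by
  have hfol : D.FollowsParts n S part := h.follow
  have hloc : ∀ v < n, part v < k ∧ loc (part v) = D.vertexLabel S v := by
    intro v hv
    obtain ⟨w, q₁, q₂, q₃, q₄⟩ := TreeData.exists_last hD ho hS
      (R := fun u w => D.vertexLabel S u = D.vertexLabel S w)
      ⟨fun _ => rfl, fun e => e.symm, fun e e' => e.trans e'⟩
      (fun t ht h2 e => vertexLabel_eq hD ho hS ht h2 e) hfol hv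
    obtain ⟨r₁, -, r₃⟩ := h.last w q₁ q₂
    rw [q₃] at r₁ r₃
    exact ⟨r₁, r₃.trans q₄.symm⟩
  refine ⟨fun v hv => (hloc v hv).1, hc, fun v hv => ?_, fun v hv => ?_, ?_⟩
  · rw [← (hloc v hv).2]
    exact hnear v hv
  · obtain ⟨f₁, f₂, f₃⟩ := hD.forgetNode_spec hv
    have := (hS.2 _ f₁).label_lt f₂
    rwa [f₃] at this
  · intro R hR hRe u hu w hw e
    have he : ∀ t < D.num, D.kind t = 2 → (S t).comp (D.lab t 0) = (S t).comp (D.lab t 1) →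
        R (D.lab t 0) (D.lab t 1) := by
      intro t ht h2 e
      obtain ⟨-, -, ha, q₁, q₂, -⟩ := hD.introEdge t ht h2
      exact hRe _ _ ha (TreeData.part_eq_of_comp_eq hD ho hS hfol t ht _ _ q₁ q₂ e)
    obtain ⟨u', p₁, p₂, p₃, p₄⟩ := TreeData.exists_last hD ho hS hR he hfol hu
    obtain ⟨w', q₁, q₂, q₃, q₄⟩ := TreeData.exists_last hD ho hS hR he hfol hw
    have : u' = w' := by
      rw [← (h.last u' p₁ p₂).2.1, ← (h.last w' q₁ q₂).2.1, p₃, q₃, e]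
    rw [this] at p₄
    exact hR.trans p₄ (hR.symm q₄)

/-! ### The whole program -/

def extractSolution : Code := seq selectStates (seq assignClusters improveCenters)

theorem runs_extractSolution (hN : ∀ i j, x.nat ConnSymbol.numNodes i j = N)
    (hn : ∀ i j, x.nat ConnSymbol.numPoints i j = n)
    (hroot : ∀ i j, x.nat ConnSymbol.root i j = (x.treeData N).root)
    (hD : (x.treeData N).IsNice n Adj) (ho : (x.treeData N).IsOrder P.ord) (h : Prepared x N P σ)
    (hM : N < M) (hM' : n < M) (hX : ∀ s, (x.treeData N).size s ≤ X)
    (hF : Filled x N k P (fun _ => True) σ) (hdec : P.dec 0 (2 * P.m) = 0)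
    (hbest : σ.nat 30 (x.treeData N).root (σ.nat 50 0 0) = 1)
    (hcount : P.dec (σ.nat 50 0 0) (2 * P.m) = k) (h0 : ∀ i, σ.nat 51 i 0 = 0) :
    Runs x X M extractSolution σ fun τ => ∃ S,
      IsSolution (x.treeData N) P x n k Adj S (fun v => τ.nat 1 v 0) (fun i => τ.nat 0 i 0) ∧
      P.labelledCost (x.treeData N) x n S = σ.real 0 (x.treeData N).root (σ.nat 50 0 0) := by
  refine Runs.seq ((runs_selectStates hN hroot hD ho h hM hF hbest h0).frame fun σ₁ f₁ hsel => ?_)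
  set sel : ℕ → ℕ := fun t => σ₁.nat 51 t 0 with hseldef
  have hS := derivation_of_selected hF hsel hdec
  have hcost := cost_of_selected hD ho hF hsel
  have h₁ : Prepared x N P σ₁ := h.congr f₁ (by decide)
  refine Runs.seq ((runs_assignClusters (sel := sel) hN hD ho h₁ hX hM fun _ => rfl).frame
    fun σ₂ f₂ hcl => ?_)
  have h₂ : Prepared x N P σ₂ := h₁.congr f₂ (by decide)
  have hck : σ₂.nat 52 0 0 = k := by
    rw [← Clusters.count_eq hcl hD ho hS, ← hcount, ← hsel.root]
    rfl
  rw [hck] at hcl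
  refine (runs_improveCenters (k := k) hn h₂ hM' fun i hi => ?_).frame fun τ f hτ => ?_
  · obtain ⟨q₁, -, q₃⟩ := hcl.center i hi
    exact ⟨q₁, q₃⟩
  · refine ⟨_, ?_, hcost.symm⟩
    rw [f.1 1 (by decide)]
    exact hcl.isSolution hD ho hS hτ.1 hτ.2

def solve : Code :=
  seq readTree (seq makeCodes (seq orderNodes (seq fillTable (seq chooseBest
    (ite (natEq (cell 50) (cell 15)) skip extractSolution)))))

/-- Nothing is claimed unless some derivation competes, which is why the program may stop without a
clustering when no suitable state of the root is found. -/
theorem runs_solve {m b : ℕ} (hN : ∀ i j, x.nat ConnSymbol.numNodes i j = N)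
    (hn : ∀ i j, x.nat ConnSymbol.numPoints i j = n)
    (hk : ∀ i j, x.nat ConnSymbol.numClusters i j = k)
    (hroot : ∀ i j, x.nat ConnSymbol.root i j = (x.treeData N).root)
    (hD : (x.treeData N).IsNice n Adj) (hR : (x.treeData N).IsRooted)
    (hm : ∀ t, (x.treeData N).size t ≤ m) (hm' : ∃ t < N, (x.treeData N).size t = m)
    (hb : b = m + k) (hb2 : 2 ≤ b) (hM : N < M) (hM' : n < M)
    (h0 : ∀ a < 100, ∀ i j, σ.nat a i j = 0) (hr0 : ∀ a < 100, ∀ i j, σ.real a i j = 0) :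
    Runs x (b ^ (2 * m + 1)) M solve σ fun τ =>
      ∃ P : DPTables, (∀ i, P.cen i = σ.nat 100 i 0) ∧ (x.treeData N).IsOrder P.ord ∧
        ∀ S, (x.treeData N).Derivation k S → Codable (x.treeData N) b S →
          (S (x.treeData N).root).count = k → ∃ S',
            IsSolution (x.treeData N) P x n k Adj S' (fun v => τ.nat 1 v 0)
              (fun i => τ.nat 0 i 0) ∧
            P.labelledCost (x.treeData N) x n S' ≤ P.labelledCost (x.treeData N) x n S := by
  -- As `2 ≤ b`, the number of codes is at least the base, the number of digits and every bag size,
  -- so it bounds all loops except those over nodes and vertices.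
  have hbX : b ≤ b ^ (2 * m + 1) := Nat.le_self_pow (by omega) b
  have hlX : 2 * m + 1 ≤ b ^ (2 * m + 1) := (Nat.lt_pow_self (by omega)).le
  have hX : ∀ t, (x.treeData N).size t ≤ b ^ (2 * m + 1) := fun t => (hm t).trans (by omega)
  have hM1 : 1 ≤ M := by omega
  refine Runs.seq ((runs_readTree hN hM (h0 13 (by omega) 0 0)).frame fun σ₁ f₁ q₁ => ?_)
  obtain ⟨p₁, p₂, p₃, p₄⟩ := q₁
  have e13 : σ₁.nat 13 0 0 = m := by
    obtain ⟨t, ht, e⟩ := hm'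
    have h₁ := p₃ t ht
    rcases p₄ with p₄ | ⟨s, hs, p₄⟩
    · omega
    · have := hm s
      omega
  refine Runs.seq ((runs_makeCodes hk e13 hb (by omega) hM1 hbX hlX le_rfl).frame
    fun σ₂ f₂ q₂ => ?_)
  refine Runs.seq ((runs_orderNodes (D := x.treeData N) rfl hR hN hM (hroot 0 0)
    (fun t ht => by rw [f₂.1 11 (by decide)]; exact (p₁ t ht).2.1)
    (fun t ht => by rw [f₂.1 12 (by decide)]; exact (p₁ t ht).2.2)).frame fun σ₃ f₃ q₃ => ?_)
  obtain ⟨c₁, c₂⟩ := q₂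
  set P : DPTables := ⟨m, b ^ (2 * m + 1), σ₂.nat 16, fun i => σ₃.nat 17 i 0,
    fun i => σ.nat 100 i 0⟩ with hP
  have h₃ : Prepared x N P σ₃ := by
    refine ⟨fun t ht => ?_, fun t ht => ?_, fun t ht => ?_, ?_, ?_, fun e j => ?_, fun _ => rfl,
      fun i => ?_⟩
    · rw [f₃.1 10 (by decide), f₂.1 10 (by decide)]
      rcases ht.lt_or_eq with ht | rfl
      · exact (p₁ t ht).1
      · rw [p₂ _ le_rfl, h0 10 (by omega)]
        exact hD.size_num.symm
    · rw [f₃.1 11 (by decide), f₂.1 11 (by decide)]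
      exact (p₁ t ht).2.1
    · rw [f₃.1 12 (by decide), f₂.1 12 (by decide)]
      exact (p₁ t ht).2.2
    · rw [f₃.1 13 (by decide), f₂.1 13 (by decide), e13]
    · rw [f₃.1 15 (by decide), c₁]
    · rw [f₃.1 16 (by decide)]
    · rw [f₃.1 100 (by decide), f₂.1 100 (by decide), f₁.1 100 (by decide)]
  refine Runs.seq ((runs_fillTable hk hN hD q₃ h₃ hX le_rfl hM (fun t e => by
      rw [f₃.1 30 (by decide), f₂.1 30 (by decide), f₁.1 30 (by decide), h0 30 (by omega)])
      (by rw [f₃.2 0 (by decide), f₂.2 0 (by decide), f₁.2 0 (by decide), hr0 0 (by omega)])).frame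
    fun σ₄ f₄ hF => ?_)
  have h₄ : Prepared x N P σ₄ := h₃.congr f₄ (by decide)
  refine Runs.seq ((runs_chooseBest hk hroot h₄ hM1 le_rfl).frame fun σ₅ f₅ q₅ => ?_)
  obtain ⟨g₁, g₂⟩ := q₅
  have h₅ : Prepared x N P σ₅ := h₄.congr f₅ (by decide)
  have hF' : Filled x N k P (fun _ => True) σ₅ := hF.congr (f₅.1 30 (by decide))
    (f₅.1 31 (by decide)) (f₅.1 32 (by decide)) (f₅.2 0 (by decide))
  have hbound : ∀ S, (x.treeData N).Derivation k S → Codable (x.treeData N) b S →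
      (S (x.treeData N).root).count = k → σ₅.nat 50 0 0 ≠ P.E ∧
        σ₅.real 0 (x.treeData N).root (σ₅.nat 50 0 0) ≤ P.labelledCost (x.treeData N) x n S := by
    intro S hS hcod hcount
    obtain ⟨e, he, r₁, r₂, r₃⟩ := exists_code_le hD q₃ hF c₂ hm hS hcod
    obtain ⟨s₁, s₂⟩ := g₂ e he r₂ (r₁.trans hcount)
    exact ⟨s₁, by rw [f₅.2 0 (by decide)]; exact s₂.trans r₃⟩
  refine Runs.ite hM1 (fun hb => Runs.skip hM1 ?_) (fun hb => ?_)
  · simp only [TestExp.holds, NatExp.eval, h₅.E] at hb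
    exact ⟨P, fun _ => rfl, q₃, fun S hS hcod hcount =>
      absurd (le_antisymm hb.1 hb.2) (hbound S hS hcod hcount).1⟩
  · simp only [TestExp.holds, NatExp.eval, h₅.E] at hb
    have hne : σ₅.nat 50 0 0 ≠ P.E := fun e => hb ⟨e.le, e.ge⟩
    obtain ⟨g₃, g₄⟩ := g₁ hne
    refine (runs_extractSolution hN hn hroot hD q₃ h₅ hM hM' hX hF' (c₂.zero _ (by simp [hP]))
      (by rw [f₅.1 30 (by decide)]; exact g₃) g₄ (fun i => by
        rw [f₅.1 51 (by decide), f₄.1 51 (by decide), f₃.1 51 (by decide), f₂.1 51 (by decide),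
          f₁.1 51 (by decide), h0 51 (by omega)])).weaken fun τ hτ => ?_
    obtain ⟨S', hS', hcost⟩ := hτ
    refine ⟨P, fun _ => rfl, q₃, fun S hS hcod hcount => ⟨S', hS', ?_⟩⟩
    rw [hcost]
    exact (hbound S hS hcod hcount).2

end ConnectedKMeans

/-! ## Costs and clusterings -/

section Costs

variable {n k : ℕ} {d : Fin n → Fin n → ℝ}

theorem IsMetric.nonneg {V : Type} {d : V → V → ℝ} (hd : IsMetric d) (u v : V) : 0 ≤ d u v := by
  have h₁ := hd.triangle u v u
  have h₂ := (hd.eq_zero_iff u u).2 rfl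
  have h₃ := hd.symm u v
  linarith

theorem connectedKMeansCost_eq (d : Fin n → Fin n → ℝ) (part : Fin n → Fin k)
    (center : Fin k → Fin n) :
    connectedKMeansCost d part center = ∑ v, d v (center (part v)) ^ 2 := by
  rw [connectedKMeansCost, ← Finset.sum_fiberwise (s := Finset.univ) (g := part)]
  refine Finset.sum_congr rfl fun i _ => Finset.sum_congr rfl fun v hv => ?_
  rw [(Finset.mem_filter.1 hv).2]

theorem kMeansCost_le (d : Fin n → Fin n → ℝ) (c : Fin k → Fin n) (part : Fin n → Fin k) :
    kMeansCost d c ≤ ∑ v, d v (c (part v)) ^ 2 :=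
  Finset.sum_le_sum fun v _ => ciInf_le (Set.finite_range _).bddBelow (part v)

/-- A `k`-means algorithm cannot be better than optimal. -/
theorem ApproximatesKMeans.one_le {A : RAMProgram KMeansSymbol} {α : ℝ} {p : ℕ → ℕ}
    (hA : ApproximatesKMeans A α p) : 1 ≤ α := by
  classical
  -- Two points at distance `1` and a single center: every solution has positive cost.
  set d : Fin 2 → Fin 2 → ℝ := fun u v => if u = v then 0 else 1 with hd
  have hmetric : IsMetric d := by
    refine ⟨fun u v => ?_, fun u v => ?_, fun u v w => ?_⟩
    · simp only [hd]
      split_ifs with h <;> simp [h]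
    · simp only [hd, eq_comm]
    · by_cases huv : u = v
      · simp [hd, huv]
      · simp only [hd, if_neg huv]
        split_ifs <;> norm_num
  obtain ⟨τ, t, -, -, c, -, hc⟩ := hA 2 1 d hmetric le_rfl (by norm_num)
  have hpos : 0 < kMeansCost d c := by
    refine Finset.sum_pos' (fun v _ => Real.iInf_nonneg fun i => sq_nonneg _) ?_
    refine ⟨c 0 + 1, Finset.mem_univ _, ?_⟩
    have hne : c 0 + 1 ≠ c 0 := by
      generalize c 0 = u
      revert u
      decide
    rw [ciInf_unique]
    have : (default : Fin 1) = 0 := rfl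
    rw [this]
    simp [hd, hne]
  -- The output is compared with itself.
  have := hc c
  by_contra hlt
  nlinarith

/-- Replacing every center of a clustering by the nearest of the given centers `c` costs at most
`8` times the cost of the clustering and twice the cost of `c`. -/
theorem exists_label_cost_le (hd : IsMetric d) (hk : 1 ≤ k) (c : Fin k → Fin n)
    (part : Fin n → Fin k) (center : Fin k → Fin n) :
    ∃ ℓ : Fin k → Fin k, ∑ v, d v (c (ℓ (part v))) ^ 2 ≤
      8 * connectedKMeansCost d part center + 2 * kMeansCost d c := by
  have : Nonempty (Fin k) := ⟨⟨0, hk⟩⟩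
  have hmin : ∀ v, ∃ i, d v (c i) ^ 2 = ⨅ j, d v (c j) ^ 2 := fun v =>
    exists_eq_ciInf_of_finite (f := fun j => d v (c j) ^ 2)
  choose φ hφ using hmin
  have hle : ∀ v i, d v (c (φ v)) ≤ d v (c i) := fun v i => by
    have : d v (c (φ v)) ^ 2 ≤ d v (c i) ^ 2 := by
      rw [hφ v]
      exact ciInf_le (Set.finite_range _).bddBelow i
    exact (pow_le_pow_iff_left₀ (hd.nonneg _ _) (hd.nonneg _ _) two_ne_zero).1 this
  refine ⟨fun i => φ (center i), ?_⟩
  rw [connectedKMeansCost_eq, kMeansCost, Finset.mul_sum, Finset.mul_sum, ← Finset.sum_add_distrib]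
  refine Finset.sum_le_sum fun v _ => ?_
  rw [← hφ v]
  set o := center (part v)
  have h₁ := hd.triangle v o (c (φ o))
  have h₂ := hle o (φ v)
  have h₃ := hd.triangle o v (c (φ v))
  rw [hd.symm o v] at h₃
  -- A detour through `o`: the center nearest to `o` is no farther from `o` than the one nearest to
  -- `v`.
  have h₄ : d v (c (φ o)) ≤ 2 * d v o + d v (c (φ v)) := by linarith
  have h₅ := pow_le_pow_left₀ (hd.nonneg v (c (φ o))) h₄ 2
  -- With `a = d v o` and `b = d v (c (φ v))`, the difference of `8a² + 2b²` and `(2a + b)²` is `(2a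
  -- - b)²`.
  nlinarith [sq_nonneg (2 * d v o - d v (c (φ v)))]

end Costs

/-! ### Connected clusterings versus derivations -/

section Clusterings

variable {n k N : ℕ} {G : SimpleGraph (Fin n)} {d : Fin n → Fin n → ℝ} {x : RAMInput ConnSymbol}
  {P : DPTables} {D : TreeData}

/-- Connected parts are not separated by an equivalence relation that contains the edges within
the parts. -/
theorem IsConnectedClustering.rel {part : Fin n → Fin k} {center : Fin k → Fin n}
    (h : IsConnectedClustering G part center) {R : Fin n → Fin n → Prop} (hR : Equivalence R)
    (he : ∀ u v, G.Adj u v → part u = part v → R u v) {u v : Fin n} (huv : part u = part v) :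
    R u v := by
  obtain ⟨p⟩ := (h.connected (part v)).preconnected ⟨u, huv⟩ ⟨v, rfl⟩
  have key : ∀ {a b : {w | part w = part v}}, (G.induce {w | part w = part v}).Walk a b →
      R a b := by
    intro a b p
    induction p with
    | nil => exact hR.refl _
    | @cons a b c hab _ ih =>
      exact hR.trans (he _ _ hab (a.2.trans b.2.symm)) ih
  exact key p

/-- Parts that are not separated by any such relation are connected. -/
theorem connected_induce_of_rel {part : Fin n → Fin k} {i : Fin k} (hne : ∃ v, part v = i)
    (h : ∀ R : Fin n → Fin n → Prop, Equivalence R →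
      (∀ u v, G.Adj u v → part u = part v → R u v) → ∀ u v, part u = part v → R u v) :
    (G.induce {v | part v = i}).Connected := by
  obtain ⟨v₀, hv₀⟩ := hne
  have : Nonempty {v | part v = i} := ⟨⟨v₀, hv₀⟩⟩
  refine ⟨fun u w => ?_⟩
  -- The test relation requires equal parts and, inside part `i`, reachability within this part. It
  -- contains all edges inside parts, so it relates all members of part `i`.
  have := h (fun a b => part a = part b ∧ ∀ (ha : part a = i) (hb : part b = i),
      (G.induce {v | part v = i}).Reachable ⟨a, ha⟩ ⟨b, hb⟩)
    ⟨fun a => ⟨rfl, fun _ _ => SimpleGraph.Reachable.refl _⟩,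
      fun hab => ⟨hab.1.symm, fun ha hb => (hab.2 hb ha).symm⟩,
      fun hab hbc => ⟨hab.1.trans hbc.1, fun ha hc =>
        (hab.2 ha (hab.1.symm.trans ha)).trans (hbc.2 (hab.1.symm.trans ha) hc)⟩⟩
    (fun a b hab e => ⟨e, fun ha hb => SimpleGraph.Adj.reachable (by simpa using hab)⟩)
    u w (u.2.trans w.2.symm)
  exact this.2 u.2 w.2

theorem distTable_eq (d : Fin n → Fin n → ℝ) (u v : Fin n) : distTable d u v = d u v := by
  simp [distTable]

/-- The factor `4`: the new center `o` of a cluster is at least as close to the named center `w` as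
the vertex `v`, so `d v o ≤ d v w + d o w ≤ 2 * d v w`. -/
theorem IsSolution.exists_clustering {S : ℕ → DPState} {part ctr : ℕ → ℕ}
    (h : IsSolution D P x n k (AdjNat G) S part ctr) (hd : IsMetric d) (hx : x.dist = distTable d)
    (c : Fin k → Fin n) (hc : ∀ i : Fin k, P.cen i = c i) :
    ∃ (part' : Fin n → Fin k) (center : Fin k → Fin n), (∀ i : Fin k, ctr i = center i) ∧
      (∀ v : Fin n, part v = part' v) ∧ IsConnectedClustering G part' center ∧
      connectedKMeansCost d part' center ≤ 4 * P.labelledCost D x n S := by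
  refine ⟨fun v => ⟨part v, h.part_lt v v.2⟩, fun i => ⟨ctr i, (h.center i i.2).1⟩,
    fun _ => rfl, fun _ => rfl, ⟨fun i => ?_, fun i => Fin.ext (h.center i i.2).2⟩, ?_⟩
  · refine connected_induce_of_rel ⟨⟨ctr i, (h.center i i.2).1⟩, Fin.ext (h.center i i.2).2⟩ ?_
    intro R hR he u v huv
    have hn : 0 < n := (Nat.zero_le _).trans_lt u.2
    -- Reduction modulo `n` extends an equivalence relation on `Fin n` to all natural numbers.
    have hmod : ∀ w : Fin n, (⟨w % n, Nat.mod_lt _ hn⟩ : Fin n) = w := fun w =>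
      Fin.ext (Nat.mod_eq_of_lt w.2)
    have := h.conn (fun a b => R ⟨a % n, Nat.mod_lt _ hn⟩ ⟨b % n, Nat.mod_lt _ hn⟩)
      ⟨fun a => hR.refl _, fun hab => hR.symm hab, fun hab hbc => hR.trans hab hbc⟩ ?_ u u.2 v v.2
      (congrArg Fin.val huv)
    · rwa [hmod, hmod] at this
    · rintro y z ⟨hy, hz, hyz⟩ e
      have e₁ := hmod ⟨y, hy⟩
      have e₂ := hmod ⟨z, hz⟩
      dsimp only at e₁ e₂
      rw [e₁, e₂]
      exact he _ _ hyz (Fin.ext e)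
  · rw [connectedKMeansCost_eq, DPTables.labelledCost, Finset.mul_sum, ← Fin.sum_univ_eq_sum_range
      (fun v => 4 * x.dist v (P.cen (D.vertexLabel S v)) ^ 2)]
    refine Finset.sum_le_sum fun v _ => ?_
    have hlab := h.label_lt v v.2
    have hcen : P.cen (D.vertexLabel S v) = c ⟨D.vertexLabel S v, hlab⟩ := hc ⟨_, hlab⟩
    have hnear := h.near v v.2
    set w := c ⟨D.vertexLabel S v, hlab⟩ with hw
    set o : Fin n := ⟨ctr (part v), (h.center _ (h.part_lt v v.2)).1⟩ with ho
    have e₁ : x.dist (ctr (part v)) w = d o w := by rw [hx]; exact distTable_eq d o w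
    have e₂ : x.dist v w = d v w := by rw [hx]; exact distTable_eq d v w
    rw [hcen, e₁, e₂] at hnear
    rw [hcen, e₂]
    change d v o ^ 2 ≤ _
    have h₁ := hd.triangle v w o
    rw [hd.symm w o] at h₁
    have h₂ := pow_le_pow_left₀ (hd.nonneg v o) (show d v o ≤ 2 * d v w by linarith) 2
    linarith [h₂, mul_pow 2 (d v w) 2]

theorem IsConnectedClustering.exists_derivation {part : Fin n → Fin k} {center : Fin k → Fin n}
    (h : IsConnectedClustering G part center) (hD : D.IsNice n (AdjNat G)) {ord : ℕ → ℕ}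
    (ho : D.IsOrder ord) {m b : ℕ} (hm : ∀ t, D.size t ≤ m) (hm1 : 1 ≤ m) (hk : 1 ≤ k)
    (hb : b = m + k) (ℓ : Fin k → Fin k) (hx : x.dist = distTable d)
    (c : Fin k → Fin n) (hc : ∀ i : Fin k, P.cen i = c i) :
    ∃ S, D.Derivation k S ∧ ConnectedKMeans.Codable D b S ∧ (S D.root).count = k ∧
      P.labelledCost D x n S = ∑ v, d v (c (ℓ (part v))) ^ 2 := by
  set p : ℕ → ℕ := fun v => if hv : v < n then part ⟨v, hv⟩ else 0 with hp
  set l : ℕ → ℕ := fun i => if hi : i < k then ℓ ⟨i, hi⟩ else 0 with hl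
  have hpv : ∀ v : Fin n, p v = part v := fun v => by simp [hp]
  have hli : ∀ i : Fin k, l i = ℓ i := fun i => by simp [hl]
  have hlt : ∀ v < n, l (p v) < k := fun v hv => by
    rw [hpv ⟨v, hv⟩, hli]
    exact (ℓ _).2
  obtain ⟨S, hS, hcount, hresp⟩ := TreeData.exists_derivation (k := k) (b := b) (P := p) (ℓ := l)
    hD ho (fun t => (hm t).trans_lt (by omega)) hlt
    (fun v hv => by rw [hpv ⟨v, hv⟩]; exact (part _).2)
    (fun i hi => ⟨center ⟨i, hi⟩, (center _).2, by rw [hpv, h.center_mem]⟩) (by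
      intro u hu w hw e R hR he
      rw [hpv ⟨u, hu⟩, hpv ⟨w, hw⟩] at e
      exact h.rel (R := fun a b => R a b)
        ⟨fun a => hR.refl _, fun hab => hR.symm hab, fun hab hbc => hR.trans hab hbc⟩
        (fun a b hab e' => he a b ⟨a.2, b.2, hab⟩ (by rw [hpv, hpv, e'])) (Fin.ext e))
  refine ⟨S, hS, ⟨fun t ht u hu => (hresp t ht).lt u hu, fun t ht u hu => ?_, fun t ht => ?_⟩,
    hcount, ?_⟩
  · rw [(hresp t ht).label u hu]
    have := hlt u (hD.lt_of_mem hu)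
    omega
  -- The count is at most `k`, and `k < m + k` because `1 ≤ m`.
  · have := TreeData.count_le_root ho hS t ht
    omega
  · rw [DPTables.labelledCost, ← Fin.sum_univ_eq_sum_range
      (fun v => x.dist v (P.cen (D.vertexLabel S v)) ^ 2)]
    refine Finset.sum_congr rfl fun v _ => ?_
    obtain ⟨f₁, f₂, f₃⟩ := hD.forgetNode_spec v.2
    obtain ⟨g₁, -, g₂, -⟩ := hD.forget _ f₁ f₂
    rw [f₃] at g₂
    rw [TreeData.vertexLabel, (hresp _ g₁).label v g₂, hpv, hli, hc, hx, distTable_eq]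

end Clusterings

/-! ## The algorithm for connected `k`-means -/

/-- The input symbols of the unconstrained problem. -/
def KMeansSymbol.toConn : KMeansSymbol → ConnSymbol
  | numPoints => ConnSymbol.numPoints
  | numClusters => ConnSymbol.numClusters

namespace ConnectedKMeans

/-- Run the algorithm `A` for unconstrained `k`-means, then the dynamic program. -/
def algorithm (A : RAMProgram KMeansSymbol) : Code :=
  RAMProgram.seq (A.shift KMeansSymbol.toConn 100) solve

variable {n k N : ℕ} {G : SimpleGraph (Fin n)} {d : Fin n → Fin n → ℝ}
  {D : NiceTreeDecomposition G (Fin N)} {x : RAMInput ConnSymbol}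

theorem runsWithin_algorithm {A : RAMProgram KMeansSymbol} {α : ℝ} {p : ℕ → ℕ}
    (hA : ApproximatesKMeans A α p) (hd : IsMetric d) (hk : 1 ≤ k) (hkn : k ≤ n)
    (hx : EncodesConnected k G d D x) :
    ∃ m, 1 ≤ m ∧ m ≤ D.width + 1 ∧
      RunsWithin (algorithm A) x (p n + solve.size *
        ((N + n + 1) * ((m + k) ^ (2 * m + 1) + 1) ^ solve.depth)) fun τ =>
      (∃ (part : Fin n → Fin k) (center : Fin k → Fin n),
        IsConnectedClustering G part center) →
      ∃ (part : Fin n → Fin k) (center : Fin k → Fin n),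
        (∀ i : Fin k, τ.nat 0 i 0 = center i) ∧ (∀ v : Fin n, τ.nat 1 v 0 = part v) ∧
        IsConnectedClustering G part center ∧
        ∀ (part' : Fin n → Fin k) (center' : Fin k → Fin n),
          IsConnectedClustering G part' center' →
          connectedKMeansCost d part center ≤
            (8 * α + 32) * connectedKMeansCost d part' center' := by
  have hn : 0 < n := by omega
  have hnice := hx.isNice
  obtain ⟨t₀, ht₀⟩ := D.cover ⟨0, hn⟩
  set m := Finset.univ.sup fun t => (D.bag t).card with hm
  have hm1 : 1 ≤ m := (Finset.card_pos.2 ⟨_, ht₀⟩).trans_le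
    (Finset.le_sup (f := fun t => (D.bag t).card) (Finset.mem_univ t₀))
  have hsize : ∀ t, (x.treeData N).size t ≤ m := by
    intro t
    by_cases ht : t < N
    · rw [hx.size_eq ⟨t, ht⟩]
      exact Finset.le_sup (f := fun t => (D.bag t).card) (Finset.mem_univ _)
    · simp [RAMInput.treeData, ht]
  have hmax : ∃ t < N, (x.treeData N).size t = m := by
    obtain ⟨t, -, ht⟩ := Finset.exists_mem_eq_sup (Finset.univ : Finset (Fin N)) ⟨t₀, Finset.mem_univ _⟩
      fun t => (D.bag t).card
    exact ⟨t, t.2, by rw [hx.size_eq t, hm, ht]⟩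
  refine ⟨m, hm1, by rw [TreeDecomposition.width]; omega, ?_⟩
  obtain ⟨σ, s, hrun, hs, c, hc, happ⟩ := hA n k d hd hk hkn
  have hsym : ∀ s, x.nat (KMeansSymbol.toConn s) = (kMeansInput k d).nat s := by
    intro s
    funext i j
    cases s
    · exact hx.numPoints i j
    · exact hx.numClusters i j
  obtain ⟨σ', hrun', hσ'⟩ := hrun.shift hsym hx.dist (ShiftedStore.zero (o := 100))
  have hcen : ∀ i : Fin k, σ'.nat 100 i 0 = c i := fun i => by
    rw [← hc i, ← hσ'.nat 0]
  -- The arrays below `100` are still zero after the run of the shifted program, and `N + n + 1`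
  -- exceeds both the number of nodes and the number of vertices.
  obtain ⟨τ, t, hrunt, ht, P, hP, ho, hbest⟩ := runs_solve (M := N + n + 1) (n := n) hx.numNodes
    hx.numPoints hx.numClusters (fun i j => (hx.root i j).trans (hx.root 0 0).symm) hnice
    hx.isRooted hsize hmax rfl (by omega) (by omega) (by omega) hσ'.nat_zero hσ'.real_zero
  refine ⟨τ, s + t, hrun'.seq hrunt, by omega, ?_⟩
  have hPc : ∀ i : Fin k, P.cen i = c i := fun i => by rw [hP, hcen]
  have key : ∀ (part' : Fin n → Fin k) (center' : Fin k → Fin n),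
      IsConnectedClustering G part' center' → ∃ (part : Fin n → Fin k) (center : Fin k → Fin n),
        (∀ i : Fin k, τ.nat 0 i 0 = center i) ∧ (∀ v : Fin n, τ.nat 1 v 0 = part v) ∧
        IsConnectedClustering G part center ∧ connectedKMeansCost d part center ≤
          (8 * α + 32) * connectedKMeansCost d part' center' := by
    intro part' center' h'
    obtain ⟨ℓ, hℓ⟩ := exists_label_cost_le hd hk c part' center'
    obtain ⟨S, hS, hcod, hcount, hcost⟩ := h'.exists_derivation hnice ho hsize hm1 hk rfl ℓ hx.dist
      c hPc
    obtain ⟨S', hsol, hle⟩ := hbest S hS hcod hcount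
    obtain ⟨part, center, q₁, q₂, q₃, q₄⟩ := hsol.exists_clustering hd hx.dist c hPc
    refine ⟨part, center, q₁, q₂, q₃, ?_⟩
    -- The centers of the connected clustering compete in the unconstrained problem. Multiplying by
    -- `α` needs `0 ≤ α`, which follows from `1 ≤ α`.
    have hU : kMeansCost d c ≤ α * connectedKMeansCost d part' center' := by
      refine (happ center').trans (mul_le_mul_of_nonneg_left ?_ (by linarith [hA.one_le]))
      rw [connectedKMeansCost_eq]
      exact kMeansCost_le d center' part'
    -- The factors combine as `4 * (8 + 2 * α) = 8 * α + 32`.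
    linarith
  rintro ⟨part₀, center₀, h₀⟩
  obtain ⟨part, center, q₁, q₂, q₃, -⟩ := key part₀ center₀ h₀
  refine ⟨part, center, q₁, q₂, q₃, fun part' center' h' => ?_⟩
  -- Formally `key` returns a clustering that depends on the competitor, but it is read off the
  -- final memory and hence is always the same.
  obtain ⟨part'', center'', r₁, r₂, -, r₄⟩ := key part' center' h'
  have e₁ : part = part'' := funext fun v => Fin.ext ((q₂ v).symm.trans (r₂ v))
  have e₂ : center = center'' := funext fun i => Fin.ext ((q₁ i).symm.trans (r₁ i))
  rw [e₁, e₂]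
  exact r₄

/-- The factor `3 ^ e` must go into a power of `a`, as `e` will grow with the width. For `2 ≤ a`
this works by `3 * a ≤ a ^ 3`; for `a = 1` the exponent is assumed to be bounded by `f`. -/
theorem pow_three_mul_le {a e f : ℕ} (ha : 1 ≤ a) (he : a = 1 → e ≤ f) :
    (3 * a) ^ e ≤ 3 ^ f * a ^ (3 * e) := by
  rcases ha.lt_or_eq with h | rfl
  · have h₁ : 3 * a ≤ a ^ 3 := by nlinarith [Nat.pow_le_pow_left h 2]
    calc (3 * a) ^ e ≤ (a ^ 3) ^ e := Nat.pow_le_pow_left h₁ e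
      _ = a ^ (3 * e) := by rw [← pow_mul]
      _ ≤ 3 ^ f * a ^ (3 * e) := Nat.le_mul_of_pos_left _ (by positivity)
  · simpa using Nat.pow_le_pow_right (by norm_num) (he rfl)

/-- The running time of the dynamic program. -/
theorem time_bound {K m w : ℕ} (hk : 1 ≤ k) (hn : 1 ≤ n) (hm : m ≤ w + 1)
    (hN : N ≤ K * n * max w 1) (s δ : ℕ) :
    s * ((N + n + 1) * ((m + k) ^ (2 * m + 1) + 1) ^ δ) ≤
      (s * (K + 2) * 2 ^ δ * 3 ^ (5 * δ)) *
        (n * (max w 1 * k) ^ ((15 * δ + 1) * max w 1)) := by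
  set W := max w 1 with hW
  have hW1 : 1 ≤ W := le_max_right _ _
  have hwW : w ≤ W := le_max_left _ _
  have ha : 1 ≤ W * k := Nat.mul_pos hW1 hk
  have hWa : W ≤ W * k := Nat.le_mul_of_pos_right _ hk
  have hka : k ≤ W * k := Nat.le_mul_of_pos_left _ hW1
  set a := W * k with hadef
  -- Here `m + k ≤ W + 1 + k ≤ 3 * a` and `2 * m + 1 ≤ 2 * W + 3 ≤ 5 * W`.
  have h₁ : (m + k) ^ (2 * m + 1) ≤ (3 * a) ^ (5 * W) :=
    (Nat.pow_le_pow_left (by omega) _).trans (Nat.pow_le_pow_right (by omega) (by omega))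
  have h₂ : (m + k) ^ (2 * m + 1) + 1 ≤ 2 * (3 * a) ^ (5 * W) := by
    have : 1 ≤ (3 * a) ^ (5 * W) := Nat.one_le_pow _ _ (by omega)
    omega
  have h₃ : ((m + k) ^ (2 * m + 1) + 1) ^ δ ≤ 2 ^ δ * (3 ^ (5 * δ) * a ^ (15 * δ * W)) := by
    calc ((m + k) ^ (2 * m + 1) + 1) ^ δ ≤ (2 * (3 * a) ^ (5 * W)) ^ δ := Nat.pow_le_pow_left h₂ δ
      _ = 2 ^ δ * (3 * a) ^ (5 * W * δ) := by rw [mul_pow, ← pow_mul]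
      _ ≤ 2 ^ δ * (3 ^ (5 * δ) * a ^ (3 * (5 * W * δ))) := by
          refine Nat.mul_le_mul_left _ (pow_three_mul_le ha fun h1 => ?_)
          -- From `W * k = 1` one gets `W = 1`, so the exponent is the constant `5 * δ`.
          have : W = 1 := by omega
          rw [this]
      _ = _ := by congr 3; ring
  -- The number of nodes brings a factor `W`, which the additional power `a ^ W` absorbs; this is
  -- the `+ 1` in the exponent `15 * δ + 1`.
  have h₄ : N + n + 1 ≤ (K + 2) * n * a ^ W := by
    have e₁ : W ≤ a ^ W := hWa.trans (Nat.le_self_pow (by omega) a)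
    have e₂ : 1 ≤ a ^ W := Nat.one_le_pow _ _ ha
    calc N + n + 1 ≤ K * n * W + n * 1 + n * 1 := by omega
      _ ≤ K * n * a ^ W + n * a ^ W + n * a ^ W := by gcongr
      _ = _ := by ring
  calc s * ((N + n + 1) * ((m + k) ^ (2 * m + 1) + 1) ^ δ)
      ≤ s * (((K + 2) * n * a ^ W) * (2 ^ δ * (3 ^ (5 * δ) * a ^ (15 * δ * W)))) := by gcongr
    _ = (s * (K + 2) * 2 ^ δ * 3 ^ (5 * δ)) * (n * (a ^ (15 * δ * W) * a ^ W)) := by ring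
    _ = _ := by rw [← pow_add]; congr 3; ring

end ConnectedKMeans

theorem ApproximatesConnectedKMeans.mono {B : RAMProgram ConnSymbol} {ρ : ℝ} {K : ℕ}
    {T T' : ℕ → ℕ → ℕ → ℕ} (h : ApproximatesConnectedKMeans B ρ K T)
    (hT : ∀ n k w, T n k w ≤ T' n k w) : ApproximatesConnectedKMeans B ρ K T' := by
  intro n k N G d D x h₁ h₂ h₃ h₄ h₅
  obtain ⟨τ, t, q₁, q₂, q₃⟩ := h n k N G d D x h₁ h₂ h₃ h₄ h₅
  exact ⟨τ, t, q₁, q₂.trans (hT _ _ _), q₃⟩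

theorem mainTheorem7 :
    ∃ (C : ℕ → ℕ) (c : ℕ),
      ∀ (α : ℝ) (p : ℕ → ℕ) (A : RAMProgram KMeansSymbol), ApproximatesKMeans A α p →
        ∃ B : RAMProgram ConnSymbol, ∀ K : ℕ,
          ApproximatesConnectedKMeans B (8 * α + 32) K
            (fun n k w => C K * (p n + n * (max w 1 * k) ^ (c * max w 1))) ∧
          ((∃ q : Polynomial ℕ, ∀ n, p n ≤ q.eval n) →
            ∃ (f : ℕ → ℕ) (q : Polynomial ℕ),
              ApproximatesConnectedKMeans B (8 * α + 32) K
                (fun n k w => f (max w k) * q.eval n)) := by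
  -- The text of `solve` depends on nothing, so its size and depth are absolute constants, and `C`
  -- and `c` can be chosen before `α`, `p` and `A`.
  set s := ConnectedKMeans.solve.size
  set δ := ConnectedKMeans.solve.depth
  set C : ℕ → ℕ := fun K => s * (K + 2) * 2 ^ δ * 3 ^ (5 * δ) + 1 with hC
  set c : ℕ := 15 * δ + 1
  refine ⟨C, c, fun α p A hA => ⟨ConnectedKMeans.algorithm A, fun K => ?_⟩⟩
  have main : ApproximatesConnectedKMeans (ConnectedKMeans.algorithm A) (8 * α + 32) K
      (fun n k w => C K * (p n + n * (max w 1 * k) ^ (c * max w 1))) := by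
    intro n k N G d D x hd hk hkn hN hx
    obtain ⟨m, -, hm, τ, t, q₁, q₂, q₃⟩ := ConnectedKMeans.runsWithin_algorithm hA hd hk hkn hx
    refine ⟨τ, t, q₁, q₂.trans ?_, q₃⟩
    have := ConnectedKMeans.time_bound (K := K) hk (hk.trans hkn) hm hN s δ
    calc _ ≤ p n + (s * (K + 2) * 2 ^ δ * 3 ^ (5 * δ)) *
          (n * (max D.width 1 * k) ^ (c * max D.width 1)) := Nat.add_le_add_left this _
      _ ≤ C K * p n + C K * (n * (max D.width 1 * k) ^ (c * max D.width 1)) :=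
          Nat.add_le_add (Nat.le_mul_of_pos_left _ (Nat.succ_pos _))
            (Nat.mul_le_mul_right _ (Nat.le_succ _))
      _ = _ := (Nat.mul_add _ _ _).symm
  refine ⟨main, fun ⟨q, hq⟩ => ?_⟩
  -- With `j` the larger of width and `k`, `max j 1` bounds both `max w 1` and `k`; the summand
  -- `Polynomial.X` accounts for the factor `n` of the dynamic program.
  refine ⟨fun j => C K * (max j 1 * max j 1) ^ (c * max j 1), q + Polynomial.X,
    main.mono fun n k w => ?_⟩
  set j := max (max w k) 1 with hj
  have hj1 : 1 ≤ j := le_max_right _ _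
  have h₁ : (max w 1 * k) ^ (c * max w 1) ≤ (j * j) ^ (c * j) := by
    have hw : max w 1 ≤ j := by omega
    have hk : k ≤ j := by omega
    exact (Nat.pow_le_pow_left (Nat.mul_le_mul hw hk) _).trans
      (Nat.pow_le_pow_right (Nat.mul_pos hj1 hj1) (Nat.mul_le_mul_left _ hw))
  have h₂ : 1 ≤ (j * j) ^ (c * j) := Nat.one_le_pow _ _ (Nat.mul_pos hj1 hj1)
  rw [Polynomial.eval_add, Polynomial.eval_X, Nat.mul_assoc]
  refine Nat.mul_le_mul_left _ ?_
  rw [Nat.mul_add, Nat.mul_comm _ n]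
  exact Nat.add_le_add ((hq n).trans (Nat.le_mul_of_pos_left _ h₂)) (Nat.mul_le_mul_left _ h₁)
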